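/- Let $a,b:\mathbb Z\to\mathbb R$ be bounded sequences with $a_n>0$ for all $n$, and let $J$ be the associated Jacobi matrix, i.e. the bounded operator on $\ell^2(\mathbb Z)$ given by $$(Ju)_n=a_nu_{n+1}+a_{n-1}u_{n-1}+b_nu_n .$$ For $z\in\mathbb C^+=\{\operatorname{Im} z>0\}$, let $f_\pm(\cdot,z)$ be the (unique up to constant factors) nontrivial solutions of $a_nf(n+1)+a_{n-1}f(n-1)+b_nf(n)=zf(n)$, $n\in\mathbb Z$, that are square summable near $\pm\infty$, and put $$m_\pm(z)=\mp\frac{f_\pm(1,z)}{a_0f_\pm(0,z)} .$$ $J$ is called reflectionless on $(-2,2)$ if $m_+(x)=-\overline{m_-(x)}$ for Lebesgue almost every $x\in(-2,2)$, where $m_\pm(x)=\lim_{y\to0+}m_\pm(x+iy)$. For $R\ge 2$, let $\mathcal M_R$ be the set of all such Jacobi matrices $J$ that are reflectionless on $(-2,2)$ and satisfy $\|J\|\le R$. Put $M(z)=m_+(z)$ for $z\in\mathbb C^+$, $M(z)=-\overline{m_-(\overline z)}$ for $\operatorname{Im}z<0$, and $M(x)=\lim_{y\to0+}m_+(x+iy)$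 for $x\in(-2,2)$, and let $$F(\lambda)=M\left(-\lambda-\frac1\lambda\right),\qquad \lambda\in\mathbb C^+ .$$ Let $R\ge2$ and let $r\in(0,1]$ be the solution of $r+1/r=R$. For a measure $\sigma$, write $\sigma_n=\int t^n\,d\sigma(t)$ $(n\in\mathbb Z)$. Call $\sigma$ admissible if it is a finite Borel measure on $(-1/r,-r)\cup(r,1/r)$ with $$1-\sigma_{-2}+\int\frac{d\sigma(t)}{t^2+Et+1}>0\qquad\text{for all real } E \text{ with } |E|>R .$$ **Theorem.** A bounded Jacobi matrix $J$ belongs to $\mathcal M_R$ if and only if there is an admissible measure $\sigma$ such that $$F(\lambda)=-\sigma_{-1}+(1-\sigma_{-2})\lambda+\int\frac{d\sigma(t)}{t-\lambda}\qquad\text{for all }\lambda\in\mathbb C^+ .\tag{$*$}$$ Moreover, for every $J\in\mathcal M_R$ there is exactly one admissible $\sigma$ with $(*)$, and for every admissible $\sigma$ there is exactly one $J\in\mathcal M_R$ whose function $F$ satisfies $(*)$. Thus $(*)$ sets up a bijection between $\mathcal M_R$ and the set of admissible measures. -/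

import Mathlib

noncomputable section

open MeasureTheory Filter Topology Set
open scoped ComplexConjugate ENNReal

namespace Marchenko

/-- The complex Hilbert space of square summable two-sided sequences. -/
abbrev SeqSpace : Type := lp (fun _ : ℤ => ℂ) 2

theorem memℓp_weightedShift (c : ℤ → ℝ) (hc : ∃ C, ∀ n, |c n| ≤ C) (k : ℤ) (u : SeqSpace) :
    Memℓp (fun n : ℤ => (c n : ℂ) * u (n + k)) 2 := by
  obtain ⟨C, hC⟩ := hc
  have h2 : (0 : ℝ) < (2 : ℝ≥0∞).toReal := by norm_num
  apply memℓp_gen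
  have hs : Summable fun n : ℤ => ‖u (n + k)‖ ^ (2 : ℝ≥0∞).toReal :=
    (Equiv.addRight k).summable_iff.mpr ((lp.memℓp u).summable h2)
  refine Summable.of_nonneg_of_le (fun n => by positivity) (fun n => ?_)
    (hs.mul_left (C ^ (2 : ℝ≥0∞).toReal))
  have h0 : 0 ≤ C := (abs_nonneg _).trans (hC 0)
  rw [← Real.mul_rpow h0 (norm_nonneg _), norm_mul, Complex.norm_real, Real.norm_eq_abs]
  gcongr
  exact hC n

/-- The bounded operator `(u n) ↦ (c n * u (n + k))` on `ℓ²(ℤ)`, for a bounded real sequence `c`. -/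
def weightedShift (c : ℤ → ℝ) (hc : ∃ C, ∀ n, |c n| ≤ C) (k : ℤ) : SeqSpace →L[ℂ] SeqSpace :=
  LinearMap.mkContinuousOfExistsBound
    { toFun := fun u => ⟨fun n => (c n : ℂ) * u (n + k), memℓp_weightedShift c hc k u⟩
      map_add' := fun u v => by
        ext n
        simp only [lp.coeFn_add, Pi.add_apply, mul_add]
      map_smul' := fun z u => by
        ext n
        simp [mul_left_comm] }
    (by
      obtain ⟨C, hC⟩ := id hc
      have h0 : 0 ≤ C := (abs_nonneg _).trans (hC 0)
      have h2 : (0 : ℝ) < (2 : ℝ≥0∞).toReal := by norm_num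
      refine ⟨C, fun u => lp.norm_le_of_tsum_le h2 (by positivity) ?_⟩
      have hs : Summable fun n : ℤ => ‖u (n + k)‖ ^ (2 : ℝ≥0∞).toReal :=
        (Equiv.addRight k).summable_iff.mpr ((lp.memℓp u).summable h2)
      rw [Real.mul_rpow h0 (norm_nonneg _), lp.norm_rpow_eq_tsum h2,
        ← (Equiv.addRight k).tsum_eq (fun n : ℤ => ‖u n‖ ^ (2 : ℝ≥0∞).toReal), ← tsum_mul_left]
      refine Summable.tsum_le_tsum (fun n => ?_)
        ((memℓp_weightedShift c hc k u).summable h2) (hs.mul_left _)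
      simp only [LinearMap.coe_mk, AddHom.coe_mk, Equiv.coe_addRight]
      rw [← Real.mul_rpow h0 (norm_nonneg _), norm_mul, Complex.norm_real, Real.norm_eq_abs]
      gcongr
      exact hC n)

/-- Bounded two-sided Jacobi coefficients: `a n > 0`, `b n` real, both sequences bounded. -/
@[ext]
structure JacobiMatrix where
  a : ℤ → ℝ
  b : ℤ → ℝ
  a_pos : ∀ n, 0 < a n
  a_bdd : ∃ C, ∀ n, |a n| ≤ C
  b_bdd : ∃ C, ∀ n, |b n| ≤ C

namespace JacobiMatrix

variable (J : JacobiMatrix)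

/-- The bounded operator on `ℓ²(ℤ)` given by the Jacobi matrix; see `toCLM_apply`. -/
def toCLM : SeqSpace →L[ℂ] SeqSpace :=
  weightedShift J.a J.a_bdd 1
    + weightedShift (fun n => J.a (n - 1)) (J.a_bdd.imp fun _ h n => h (n - 1)) (-1)
    + weightedShift J.b J.b_bdd 0

theorem toCLM_apply (u : SeqSpace) (n : ℤ) :
    J.toCLM u n = J.a n * u (n + 1) + J.a (n - 1) * u (n - 1) + J.b n * u n := by
  have h : J.toCLM u n = J.a n * u (n + 1) + J.a (n - 1) * u (n + -1) + J.b n * u (n + 0) := rfl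
  rw [h, add_zero, ← sub_eq_add_neg]

/-- `f` solves the difference equation `a n f (n+1) + a (n-1) f (n-1) + b n f n = z f n`. -/
def IsSolution (z : ℂ) (f : ℤ → ℂ) : Prop :=
  ∀ n : ℤ, (J.a n : ℂ) * f (n + 1) + (J.a (n - 1) : ℂ) * f (n - 1) + (J.b n : ℂ) * f n = z * f n

/-- A nontrivial solution that is square summable near `+∞`. -/
def IsWeylPlus (z : ℂ) (f : ℤ → ℂ) : Prop :=
  J.IsSolution z f ∧ f ≠ 0 ∧ Summable fun n : ℕ => ‖f (n : ℤ)‖ ^ 2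

/-- A nontrivial solution that is square summable near `-∞`. -/
def IsWeylMinus (z : ℂ) (f : ℤ → ℂ) : Prop :=
  J.IsSolution z f ∧ f ≠ 0 ∧ Summable fun n : ℕ => ‖f (-(n : ℤ))‖ ^ 2

/-- A choice of `f₊(·, z)`; for `z` in the upper half plane such a solution exists and is unique
up to a nonzero constant factor. -/
def fPlus (z : ℂ) : ℤ → ℂ := Classical.epsilon (J.IsWeylPlus z)

/-- A choice of `f₋(·, z)`; for `z` in the upper half plane such a solution exists and is unique
up to a nonzero constant factor. -/
def fMinus (z : ℂ) : ℤ → ℂ := Classical.epsilon (J.IsWeylMinus z)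

/-- The half line `m` function `m₊(z) = -f₊(1,z) / (a₀ f₊(0,z))`, used for `Im z > 0`. -/
def mPlus (z : ℂ) : ℂ := -(J.fPlus z 1 / (J.a 0 * J.fPlus z 0))

/-- The half line `m` function `m₋(z) = f₋(1,z) / (a₀ f₋(0,z))`, used for `Im z > 0`. -/
def mMinus (z : ℂ) : ℂ := J.fMinus z 1 / (J.a 0 * J.fMinus z 0)

/-- `J` is reflectionless on `S`: for Lebesgue almost every `x ∈ S`, the boundary values
`m±(x) = lim_{y → 0+} m±(x + i y)` exist and `m₊(x) = -conj (m₋(x))`. -/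
def IsReflectionless (S : Set ℝ) : Prop :=
  ∀ᵐ x : ℝ ∂(volume.restrict S), ∃ wp wm : ℂ,
    Tendsto (fun y : ℝ => J.mPlus (x + y * Complex.I)) (𝓝[>] 0) (𝓝 wp) ∧
    Tendsto (fun y : ℝ => J.mMinus (x + y * Complex.I)) (𝓝[>] 0) (𝓝 wm) ∧
    wp = -conj wm

/-- The function `M` combining `m₊` and `m₋`: it is `m₊(z)` on the upper half plane,
`-conj (m₋(conj z))` on the lower half plane, and the boundary value
`lim_{y → 0+} m₊(x + i y)` at a real point `x`. -/
def M (z : ℂ) : ℂ :=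
  if 0 < z.im then J.mPlus z
  else if z.im < 0 then -conj (J.mMinus (conj z))
  else limUnder (𝓝[>] (0 : ℝ)) fun y : ℝ => J.mPlus (z + y * Complex.I)

/-- The function `F(l) = M(-l - 1/l)`, used for `Im l > 0`. -/
def F (l : ℂ) : ℂ := J.M (-l - 1 / l)

end JacobiMatrix

/-- The class of Jacobi matrices that are reflectionless on `(-2, 2)` with operator norm
at most `R`. -/
def MClass (R : ℝ) : Set JacobiMatrix :=
  {J | J.IsReflectionless (Ioo (-2) 2) ∧ ‖J.toCLM‖ ≤ R}

/-- The generalized moment `σ_n = ∫ t ^ n dσ(t)`, for an integer `n`. -/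
def moment (σ : Measure ℝ) (n : ℤ) : ℝ := ∫ t, t ^ n ∂σ

/-- Finite Borel measures on `(-1/r, -r) ∪ (r, 1/r)` satisfying
`1 - σ_{-2} + ∫ dσ(t) / (t² + E t + 1) > 0` for all `|E| > R`. -/
def IsAdmissible (R r : ℝ) (σ : Measure ℝ) : Prop :=
  IsFiniteMeasure σ ∧
  σ (Ioo (-(1 / r)) (-r) ∪ Ioo r (1 / r))ᶜ = 0 ∧
  ∀ E : ℝ, R < |E| → 0 < 1 - moment σ (-2) + ∫ t, 1 / (t ^ 2 + E * t + 1) ∂σ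

/-- The function `-σ_{-1} + (1 - σ_{-2}) l + ∫ dσ(t) / (t - l)`. -/
def marchenkoF (σ : Measure ℝ) (l : ℂ) : ℂ :=
  -(moment σ (-1) : ℂ) + (1 - (moment σ (-2) : ℂ)) * l + ∫ t : ℝ, 1 / ((t : ℂ) - l) ∂σ

/-- The `F` function of `J` equals `marchenkoF σ` on the upper half plane. -/
def Represents (σ : Measure ℝ) (J : JacobiMatrix) : Prop :=
  ∀ l : ℂ, 0 < l.im → J.F l = marchenkoF σ l

end Marchenko

end

/-! Under z = -λ - 1/λ the upper half of the unit disc goes to the upper half plane, the part of the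
upper half plane outside the disc goes to the lower half plane, and the upper unit semicircle goes
to (-2,2). Being reflectionless means that M has matching vertical boundary values almost everywhere
on (-2,2). Since M has positive imaginary part on both sides, it continues holomorphically across
(`exists_extension_of_im_pos`), and F becomes a holomorphic function on the upper half plane with
nonnegative imaginary part. If ‖J‖ ≤ R, then F has real boundary values at real x with 0 < |x| < r
or |x| > 1/r. The Herglotz representation therefore has a measure on the closed bands r ≤ |t| ≤ 1/r
and possibly a pole at 0. The asymptotics m₊(z) ~ -1/z give F(λ) ~ λ at 0, which removes the pole
and fixes the constant and linear coefficients as -σ₋₁ and 1 - σ₋₂ (`eq_marchenkoF_of_normalized`).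
The admissibility inequality is the same as x(F(1/x) - F(x)) > 0 for 0 < |x| < r. It follows from
definiteness of E - J, E = -x - 1/x, tested on one vector (`gap_pos`); it also excludes mass at the
band edges.

Conversely, the m functions at consecutive sites are tied by a Riccati equation. If F has the
required form, -1/F is again of Herglotz type, and this equation can be solved for the neighbour on
the right (`IsMarchenko.exists_right`) and, with the roles exchanged, on the left
(`IsMarchenko.exists_left`); both steps preserve the inequality. The resulting two-sided chain of
measures supplies the coefficients. At a real point of the gap around 0 the Riccati equation splits
the form of E - J into degenerate nonnegative 2 × 2 blocks, hence the coefficients are bounded and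
‖J‖ ≤ R. For λ in the upper half plane the functions of the chain are the ratios of a solution with
nonnegative flux, which is square summable at +∞ when Im z > 0 and at -∞ when Im z < 0. So the
function at site 0 is the F of J, and its holomorphy across the semicircle makes J reflectionless.

Uniqueness: the Riccati equations and the asymptotics at i∞ recover all coefficients from F
(`eq_of_F_eq`). The Taylor coefficients of F at 0 are inverse moments of σ, which determine σ by
Weierstrass approximation in 1/t (`eq_of_integral_inv_pow_eq`). -/

noncomputable section

open MeasureTheory Filter Topology Set
open scoped ComplexConjugate ENNReal

namespace Marchenko

/-! ### Herglotz representation on the unit disc -/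

section Disc

variable {u : ℂ → ℂ}

/-- The approximating boundary measure `(2π)⁻¹ Im u(ρ e^{iθ}) dθ` on `(0, 2π]`. -/
def circleMeasure (u : ℂ → ℂ) (ρ : ℝ) : Measure ℝ :=
  (volume.restrict (Ioc 0 (2 * Real.pi))).withDensity
    fun θ => ENNReal.ofReal ((2 * Real.pi)⁻¹ * (u (ρ * circleMap 0 1 θ)).im)

theorem mul_circleMap_mem_ball {ρ : ℝ} (h0 : 0 ≤ ρ) (h1 : ρ < 1) (θ : ℝ) :
    (ρ : ℂ) * circleMap 0 1 θ ∈ Metric.ball (0 : ℂ) 1 := by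
  simp [abs_of_nonneg h0, h1]

theorem continuous_im_comp_mul_circleMap (hu : DifferentiableOn ℂ u (Metric.ball 0 1))
    {ρ : ℝ} (h0 : 0 ≤ ρ) (h1 : ρ < 1) :
    Continuous fun θ : ℝ => (u (ρ * circleMap 0 1 θ)).im := by
  have h : Continuous fun θ : ℝ => u (ρ * circleMap 0 1 θ) :=
    hu.continuousOn.comp_continuous (continuous_const.mul (continuous_circleMap 0 1))
      (mul_circleMap_mem_ball h0 h1)
  exact Complex.continuous_im.comp h

theorem continuous_poissonKernel_circleMap {w : ℂ} (hw : w ∈ Metric.ball (0 : ℂ) 1) :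
    Continuous fun θ : ℝ => poissonKernel 0 w (circleMap 0 1 θ) := by
  simp only [poissonKernel]
  refine Continuous.div (by fun_prop) (by fun_prop) fun θ => ?_
  have hne : circleMap 0 1 θ - 0 - (w - 0) ≠ 0 := by
    intro h
    have : circleMap 0 1 θ = w := by simpa [sub_eq_zero] using h
    have h3 : ‖w‖ < 1 := by simpa using hw
    rw [← this] at h3
    simp at h3
  positivity

theorem integral_circleMeasure (hu : DifferentiableOn ℂ u (Metric.ball 0 1))
    (him : ∀ w ∈ Metric.ball (0 : ℂ) 1, 0 ≤ (u w).im) {ρ : ℝ} (h0 : 0 ≤ ρ) (h1 : ρ < 1)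
    (φ : ℝ → ℝ) :
    ∫ θ, φ θ ∂(circleMeasure u ρ) =
      ∫ θ in Ioc 0 (2 * Real.pi), (2 * Real.pi)⁻¹ * (u (ρ * circleMap 0 1 θ)).im * φ θ := by
  have hc := continuous_im_comp_mul_circleMap hu h0 h1
  rw [circleMeasure, integral_withDensity_eq_integral_toReal_smul]
  · refine integral_congr_ae (Eventually.of_forall fun θ => ?_)
    have := him _ (mul_circleMap_mem_ball h0 h1 θ)
    simp only [smul_eq_mul]
    rw [ENNReal.toReal_ofReal (by positivity)]
  · exact (hc.measurable.const_mul _).ennreal_ofReal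
  · exact Eventually.of_forall fun θ => ENNReal.ofReal_lt_top

/-- The dilate w ↦ u(ρw) is holomorphic up to the closed disc, so the classical Poisson formula
applies to it; take imaginary parts. -/
theorem poisson_circleMeasure (hu : DifferentiableOn ℂ u (Metric.ball 0 1))
    (him : ∀ w ∈ Metric.ball (0 : ℂ) 1, 0 ≤ (u w).im) {ρ : ℝ} (h0 : 0 ≤ ρ) (h1 : ρ < 1)
    {w : ℂ} (hw : w ∈ Metric.ball (0 : ℂ) 1) :
    ∫ θ, poissonKernel 0 w (circleMap 0 1 θ) ∂(circleMeasure u ρ) = (u (ρ * w)).im := by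
  have hmaps : MapsTo (fun w : ℂ => (ρ : ℂ) * w) (Metric.closedBall 0 1) (Metric.ball 0 1) := by
    intro v hv
    have hv' : ‖v‖ ≤ 1 := by simpa using hv
    simp only [Metric.mem_ball, dist_zero_right, norm_mul, Complex.norm_real, Real.norm_eq_abs,
      abs_of_nonneg h0]
    nlinarith [norm_nonneg v]
  have hd : DiffContOnCl ℂ (fun w : ℂ => u (ρ * w)) (Metric.ball 0 1) := by
    apply DifferentiableOn.diffContOnCl
    rw [closure_ball _ one_ne_zero]
    exact hu.comp (by fun_prop) hmaps
  have hP := hd.circleAverage_poissonKernel_smul hw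
  rw [integral_circleMeasure hu him h0 h1]
  rw [Real.circleAverage_def] at hP
  have h2 := congrArg Complex.im hP
  rw [← h2, Complex.smul_im, intervalIntegral.integral_of_le Real.two_pi_pos.le]
  have hint : Integrable (fun θ => ((poissonKernel 0 w • fun w : ℂ => u (ρ * w))
      (circleMap 0 1 θ))) (volume.restrict (Ioc 0 (2 * Real.pi))) := by
    have hc : Continuous (fun θ => ((poissonKernel 0 w • fun w : ℂ => u (ρ * w))
      (circleMap 0 1 θ))) := by
      change Continuous fun θ => poissonKernel 0 w (circleMap 0 1 θ) • u (ρ * circleMap 0 1 θ)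
      exact (continuous_poissonKernel_circleMap hw).smul
        (hu.continuousOn.comp_continuous (continuous_const.mul (continuous_circleMap 0 1))
          (mul_circleMap_mem_ball h0 h1))
    exact (hc.integrableOn_Icc).mono_set Ioc_subset_Icc_self
  have h3 : (∫ θ in Ioc 0 (2 * Real.pi), ((poissonKernel 0 w • fun w : ℂ => u (ρ * w))
      (circleMap 0 1 θ))).im = ∫ θ in Ioc 0 (2 * Real.pi),
        ((poissonKernel 0 w • fun w : ℂ => u (ρ * w)) (circleMap 0 1 θ)).im := by
    exact (Complex.imCLM.integral_comp_comm hint).symm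
  rw [h3, smul_eq_mul, ← integral_const_mul]
  refine integral_congr_ae (Eventually.of_forall fun θ => ?_)
  simp only [Pi.smul_apply', Complex.smul_im, smul_eq_mul]
  ring

theorem poissonKernel_zero_circleMap (θ : ℝ) : poissonKernel 0 0 (circleMap 0 1 θ) = 1 := by
  simp [poissonKernel]

/-- The Poisson kernel at the centre is 1. That the mass does not depend on ρ is what allows a weak
limit as ρ → 1. -/
theorem circleMeasure_univ (hu : DifferentiableOn ℂ u (Metric.ball 0 1))
    (him : ∀ w ∈ Metric.ball (0 : ℂ) 1, 0 ≤ (u w).im) {ρ : ℝ} (h0 : 0 ≤ ρ) (h1 : ρ < 1) :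
    IsFiniteMeasure (circleMeasure u ρ) ∧
      (circleMeasure u ρ) univ = ENNReal.ofReal (u 0).im := by
  have hc := continuous_im_comp_mul_circleMap hu h0 h1
  have hfin : IsFiniteMeasure (circleMeasure u ρ) := by
    refine isFiniteMeasure_withDensity_ofReal ?_
    exact (((hc.const_mul _).integrableOn_Icc).mono_set Ioc_subset_Icc_self).2
  refine ⟨hfin, ?_⟩
  have h := poisson_circleMeasure hu him h0 h1 (w := 0) (by simp)
  simp only [poissonKernel_zero_circleMap, integral_const, smul_eq_mul, mul_one, mul_zero] at h
  rw [← h, Measure.real, ENNReal.ofReal_toReal (measure_ne_top _ _)]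

theorem exists_bound_poissonKernel_circleMap {w : ℂ} (hw : w ∈ Metric.ball (0 : ℂ) 1) :
    ∃ C, ∀ θ : ℝ, ‖poissonKernel 0 w (circleMap 0 1 θ)‖ ≤ C := by
  have hc := continuous_poissonKernel_circleMap hw
  obtain ⟨C, hC⟩ := isCompact_Icc (a := (0 : ℝ)) (b := 2 * Real.pi)
    |>.exists_bound_of_continuousOn hc.continuousOn
  refine ⟨C, fun θ => ?_⟩
  obtain ⟨y, hy, he⟩ := (periodic_circleMap 0 1).exists_mem_Ico₀ Real.two_pi_pos θ
  rw [he]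
  exact hC y ⟨hy.1, hy.2.le⟩

/-- **Herglotz representation on the disc**, together with the vanishing of the boundary measure
near boundary points at which the imaginary part tends to zero. -/
theorem exists_measure_poisson (hu : DifferentiableOn ℂ u (Metric.ball 0 1))
    (him : ∀ w ∈ Metric.ball (0 : ℂ) 1, 0 ≤ (u w).im) :
    ∃ μ : Measure ℝ, IsFiniteMeasure μ ∧ μ (Icc 0 (2 * Real.pi))ᶜ = 0 ∧
      (∀ w ∈ Metric.ball (0 : ℂ) 1,
        (u w).im = ∫ θ, poissonKernel 0 w (circleMap 0 1 θ) ∂μ) ∧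
      ∀ θ₀ : ℝ, (∀ᶠ θ in 𝓝 θ₀,
          Tendsto (fun w => (u w).im) (𝓝[Metric.ball 0 1] (circleMap 0 1 θ)) (𝓝 0)) →
        ∃ δ > 0, μ (Metric.ball θ₀ δ) = 0 := by
  let ρ : ℕ → ℝ := fun n => 1 - 1 / ((n : ℝ) + 1)
  have hρ0 : ∀ n, 0 ≤ ρ n := fun n => by
    have : 1 / ((n : ℝ) + 1) ≤ 1 := by
      rw [div_le_one (by positivity)]
      linarith [n.cast_nonneg (α := ℝ)]
    simp only [ρ]
    linarith
  have hρ1 : ∀ n, ρ n < 1 := fun n => by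
    have : 0 < 1 / ((n : ℝ) + 1) := by positivity
    simp only [ρ]
    linarith
  have hρ : Tendsto ρ atTop (𝓝 1) := by
    have := (tendsto_one_div_add_atTop_nhds_zero_nat (𝕜 := ℝ)).const_sub 1
    simpa [ρ] using this
  have hρC : Tendsto (fun n => (ρ n : ℂ)) atTop (𝓝 1) :=
    (Complex.continuous_ofReal.tendsto 1).comp hρ
  let μs : ℕ → FiniteMeasure ℝ := fun n =>
    ⟨circleMeasure u (ρ n), (circleMeasure_univ hu him (hρ0 n) (hρ1 n)).1⟩
  have hcpt := isCompact_setOfPred_finiteMeasure_le_of_isCompact (E := ℝ)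
    ((u 0).im.toNNReal) (K := Icc 0 (2 * Real.pi)) isCompact_Icc
  -- Measures of bounded mass on a compact interval form a weakly compact set; a limit along an
  -- ultrafilter replaces the choice of a subsequence.
  let U : Ultrafilter ℕ := Ultrafilter.of atTop
  have hU : (U : Filter ℕ) ≤ atTop := Ultrafilter.of_le atTop
  have hmem : ∀ n, μs n ∈ {μ : FiniteMeasure ℝ | μ.mass ≤ (u 0).im.toNNReal ∧
      μ (Icc 0 (2 * Real.pi))ᶜ = 0} := by
    intro n
    constructor
    · rw [← ENNReal.coe_le_coe, FiniteMeasure.ennreal_mass]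
      change circleMeasure u (ρ n) univ ≤ _
      rw [(circleMeasure_univ hu him (hρ0 n) (hρ1 n)).2]
      exact le_rfl
    · rw [FiniteMeasure.null_iff_toMeasure_null]
      change circleMeasure u (ρ n) _ = 0
      refine withDensity_absolutelyContinuous _ _ ?_
      rw [Measure.restrict_apply measurableSet_Icc.compl]
      convert measure_empty (μ := volume)
      ext x
      simp only [mem_inter_iff, mem_compl_iff, mem_Icc, mem_Ioc, mem_empty_iff_false, iff_false]
      rintro ⟨h, h1, h2⟩
      exact h ⟨h1.le, h2⟩
  obtain ⟨μ, hμ, hle⟩ := hcpt.ultrafilter_le_nhds (U.map μs)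
    (by rw [le_principal_iff]; exact Filter.Eventually.of_forall (f := (U : Filter ℕ)) hmem)
  have hlim : Tendsto μs U (𝓝 μ) := hle
  rw [FiniteMeasure.tendsto_iff_forall_integral_tendsto] at hlim
  refine ⟨μ, inferInstance, ?_, ?_, ?_⟩
  · rw [← FiniteMeasure.null_iff_toMeasure_null]
    exact hμ.2
  · intro w hw
    obtain ⟨C, hC⟩ := exists_bound_poissonKernel_circleMap hw
    have h1 := hlim (BoundedContinuousFunction.ofNormedAddCommGroup _
      (continuous_poissonKernel_circleMap hw) C hC)
    simp only [BoundedContinuousFunction.coe_ofNormedAddCommGroup] at h1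
    have h2 : Tendsto (fun n => ∫ θ, poissonKernel 0 w (circleMap 0 1 θ)
        ∂(μs n : Measure ℝ)) U (𝓝 (u w).im) := by
      have h3 : Tendsto (fun n => (u (ρ n * w)).im) atTop (𝓝 (u w).im) := by
        have h4 : ContinuousAt u w :=
          hu.continuousOn.continuousAt (Metric.isOpen_ball.mem_nhds hw)
        have h5 : Tendsto (fun n => (ρ n : ℂ) * w) atTop (𝓝 w) := by
          simpa using hρC.mul_const w
        exact (Complex.continuous_im.tendsto _).comp (h4.tendsto.comp h5)
      refine (h3.mono_left hU).congr fun n => ?_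
      exact (poisson_circleMeasure hu him (hρ0 n) (hρ1 n) hw).symm
    exact tendsto_nhds_unique h2 h1
  · intro θ₀ ht
    -- Pointwise vanishing on the arc is not enough for dominated convergence; the limit 0 at θ₀
    -- itself, taken within the whole disc, supplies the uniform bound 1 nearby.
    have hev : ∀ᶠ w in 𝓝[Metric.ball 0 1] (circleMap 0 1 θ₀), (u w).im ≤ 1 :=
      ht.self_of_nhds.eventually (ge_mem_nhds zero_lt_one)
    obtain ⟨ε, hε, hb⟩ := Metric.mem_nhdsWithin_iff.mp hev
    have hnear : ∀ᶠ θ in 𝓝 θ₀, dist (circleMap 0 1 θ) (circleMap 0 1 θ₀) < ε / 2 :=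
      (continuous_circleMap 0 1).continuousAt.eventually (Metric.ball_mem_nhds _ (half_pos hε))
    obtain ⟨δ, hδ, hδ'⟩ := Metric.eventually_nhds_iff.mp (ht.and hnear)
    refine ⟨δ, hδ, ?_⟩
    -- A continuous tent, positive exactly on the ball: if its integral vanishes, so does the
    -- measure of the ball.
    let φ : ℝ → ℝ := fun θ => max 0 (δ - |θ - θ₀|)
    have hφc : Continuous φ := by fun_prop
    have hφ0 : ∀ θ, 0 ≤ φ θ := fun θ => le_max_left _ _
    have hφb : ∀ θ, ‖φ θ‖ ≤ δ := fun θ => by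
      rw [Real.norm_of_nonneg (hφ0 θ)]
      exact max_le hδ.le (by linarith [abs_nonneg (θ - θ₀)])
    have hφz : ∀ θ, ¬ dist θ θ₀ < δ → φ θ = 0 := fun θ h => by
      rw [Real.dist_eq, not_lt] at h
      exact max_eq_left (by linarith)
    have h1 := hlim (BoundedContinuousFunction.ofNormedAddCommGroup φ hφc δ hφb)
    simp only [BoundedContinuousFunction.coe_ofNormedAddCommGroup] at h1
    have h2 : Tendsto (fun n => ∫ θ in Ioc 0 (2 * Real.pi),
        (2 * Real.pi)⁻¹ * (u (ρ n * circleMap 0 1 θ)).im * φ θ) atTop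
        (𝓝 (∫ _ in Ioc 0 (2 * Real.pi), (0 : ℝ))) := by
      have hlarge : ∀ᶠ n in atTop, 1 - ε / 2 < ρ n := hρ.eventually (lt_mem_nhds (by linarith))
      refine tendsto_integral_filter_of_dominated_convergence
        (fun _ => (2 * Real.pi)⁻¹ * δ) ?_ ?_ ?_ ?_
      · refine Eventually.of_forall fun n => ?_
        exact (((continuous_im_comp_mul_circleMap hu (hρ0 n) (hρ1 n)).const_mul _).mul
          hφc).aestronglyMeasurable
      · filter_upwards [hlarge] with n hn
        refine Eventually.of_forall fun θ => ?_
        by_cases hθ : dist θ θ₀ < δ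
        · have hmem := mul_circleMap_mem_ball (hρ0 n) (hρ1 n) θ
          have hle1 : (u (ρ n * circleMap 0 1 θ)).im ≤ 1 := by
            refine hb ⟨?_, hmem⟩
            have hd : dist ((ρ n : ℂ) * circleMap 0 1 θ) (circleMap 0 1 θ) < ε / 2 := by
              have : (ρ n : ℂ) * circleMap 0 1 θ - circleMap 0 1 θ
                  = ((ρ n - 1 : ℝ) : ℂ) * circleMap 0 1 θ := by push_cast; ring
              rw [dist_eq_norm, this, norm_mul, Complex.norm_real, norm_circleMap_zero,
                abs_one, mul_one, Real.norm_eq_abs, abs_lt]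
              constructor <;> linarith [hρ1 n]
            have := (dist_triangle _ _ _).trans_lt (add_lt_add hd (hδ' hθ).2)
            rw [add_halves] at this
            exact this
          have hge := him _ hmem
          rw [norm_mul, norm_mul, Real.norm_of_nonneg hge, Real.norm_of_nonneg (by positivity)]
          have := hφb θ
          calc (2 * Real.pi)⁻¹ * (u (ρ n * circleMap 0 1 θ)).im * ‖φ θ‖
              ≤ (2 * Real.pi)⁻¹ * 1 * δ := by gcongr
            _ = _ := by ring
        · rw [hφz θ hθ, mul_zero, norm_zero]
          positivity
      · exact integrable_const _
      · refine Eventually.of_forall fun θ => ?_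
        by_cases hθ : dist θ θ₀ < δ
        · have h5 : Tendsto (fun n => (ρ n : ℂ) * circleMap 0 1 θ) atTop
              (𝓝[Metric.ball 0 1] (circleMap 0 1 θ)) := by
            refine tendsto_nhdsWithin_iff.mpr ⟨by simpa using hρC.mul_const (circleMap 0 1 θ), ?_⟩
            exact Eventually.of_forall fun n => mul_circleMap_mem_ball (hρ0 n) (hρ1 n) θ
          have h6 := (((hδ' hθ).1.comp h5).const_mul (2 * Real.pi)⁻¹).mul_const (φ θ)
          simpa using h6
        · simp [hφz θ hθ]
    have h4 : ∫ θ, φ θ ∂(μ : Measure ℝ) = 0 := by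
      rw [integral_zero] at h2
      refine tendsto_nhds_unique h1 ((h2.mono_left hU).congr fun n => ?_)
      exact (integral_circleMeasure hu him (hρ0 n) (hρ1 n) φ).symm
    have hint : Integrable φ (μ : Measure ℝ) :=
      Integrable.of_bound hφc.aestronglyMeasurable δ (Eventually.of_forall hφb)
    have h5 := (integral_eq_zero_iff_of_nonneg hφ0 hint).mp h4
    refine measure_mono_null ?_ (ae_iff.mp h5)
    intro θ hθ
    have h6 : dist θ θ₀ < δ := hθ
    rw [Real.dist_eq] at h6
    have h7 : 0 < φ θ := lt_max_of_lt_right (by linarith)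
    exact h7.ne'

end Disc

/-! ### Cauchy transforms of finite measures -/

section CauchyTransform

variable {σ : Measure ℝ} {S : Set ℝ}

theorem one_div_sub_eq_resolvent (l : ℂ) :
    (fun t : ℝ => 1 / ((t : ℂ) - l)) = resolvent l := by
  ext t
  simp [resolvent]

theorem notMem_image_support (hS : IsClosed S) (hσ : σ Sᶜ = 0) {l : ℂ}
    (hl : l ∉ Complex.ofReal '' S) : l ∉ algebraMap ℝ ℂ '' σ.support := by
  have hsub : σ.support ⊆ S := Measure.support_subset_of_isClosed hS hσ
  rintro ⟨t, ht, rfl⟩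
  exact hl ⟨t, hsub ht, rfl⟩

theorem integrable_cauchy [IsFiniteMeasure σ] (hS : IsClosed S) (hσ : σ Sᶜ = 0) {l : ℂ}
    (hl : l ∉ Complex.ofReal '' S) : Integrable (fun t : ℝ => 1 / ((t : ℂ) - l)) σ := by
  rw [one_div_sub_eq_resolvent]
  exact integrable_resolvent (notMem_image_support hS hσ hl)

theorem differentiableAt_cauchy [IsFiniteMeasure σ] (hS : IsClosed S) (hσ : σ Sᶜ = 0) {l : ℂ}
    (hl : l ∉ Complex.ofReal '' S) :
    DifferentiableAt ℂ (fun l : ℂ => ∫ t : ℝ, 1 / ((t : ℂ) - l) ∂σ) l := by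
  have h : (fun l : ℂ => ∫ t : ℝ, 1 / ((t : ℂ) - l) ∂σ) = resolventTransform σ := by
    ext l
    rw [resolventTransform_apply, ← one_div_sub_eq_resolvent]
  rw [h]
  exact (hasDerivAt_resolventTransform l (notMem_image_support hS hσ hl)).differentiableAt

theorem notMem_image_ofReal {l : ℂ} (hl : l.im ≠ 0) (S : Set ℝ) : l ∉ Complex.ofReal '' S := by
  rintro ⟨t, -, rfl⟩
  exact hl (Complex.ofReal_im t)

theorem im_one_div_sub (t : ℝ) (l : ℂ) :
    (1 / ((t : ℂ) - l)).im = l.im / Complex.normSq (t - l) := by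
  rw [one_div, Complex.inv_im]
  simp

theorem im_cauchy [IsFiniteMeasure σ] {l : ℂ} (hl : l.im ≠ 0) :
    (∫ t : ℝ, 1 / ((t : ℂ) - l) ∂σ).im = ∫ t : ℝ, l.im / Complex.normSq (t - l) ∂σ := by
  have hi : Integrable (fun t : ℝ => 1 / ((t : ℂ) - l)) σ :=
    integrable_cauchy isClosed_univ (by simp) (notMem_image_ofReal hl univ)
  have := Complex.imCLM.integral_comp_comm hi
  simp only [Complex.imCLM_apply, im_one_div_sub] at this
  exact this.symm

end CauchyTransform

/-! ### Herglotz representation on the upper half plane -/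

/-- The open upper half plane. -/
def upper : Set ℂ := {l | 0 < l.im}

theorem isOpen_upper : IsOpen upper := isOpen_lt continuous_const Complex.continuous_im

/-- Open mapping theorem: a nonconstant holomorphic image is open and cannot lie in the real line.
-/
theorem exists_real_of_im_eq_zero {K : ℂ → ℂ} (hK : DifferentiableOn ℂ K upper)
    (him : ∀ l ∈ upper, (K l).im = 0) : ∃ A : ℝ, ∀ l ∈ upper, K l = A := by
  have hconv : Convex ℝ upper := convex_halfSpace_im_gt 0
  have hI : Complex.I ∈ upper := by simp [upper]
  rcases (hK.analyticOnNhd isOpen_upper).is_constant_or_isOpen hconv.isPreconnected with h | h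
  · obtain ⟨w, hw⟩ := h
    refine ⟨w.re, fun l hl => ?_⟩
    have := him l hl
    rw [hw l hl] at this ⊢
    exact Complex.ext (by simp) (by simpa using this)
  · exfalso
    have hop := h upper Subset.rfl isOpen_upper
    obtain ⟨ε, hε, hb⟩ := Metric.isOpen_iff.mp hop (K Complex.I) ⟨_, hI, rfl⟩
    have hmem : K Complex.I + ((ε / 2 : ℝ) : ℂ) * Complex.I ∈ Metric.ball (K Complex.I) ε := by
      simp only [Metric.mem_ball, dist_eq_norm, add_sub_cancel_left, norm_mul, Complex.norm_real,
        Complex.norm_I, mul_one, Real.norm_eq_abs, abs_of_pos (half_pos hε)]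
      exact half_lt_self hε
    obtain ⟨l, hl, he⟩ := hb hmem
    have h1 := him l hl
    rw [he] at h1
    simp [him _ hI] at h1
    exact hε.ne' h1

section HalfPlane

/-- The conformal map from the disc onto the upper half plane. -/
def toHalfPlane (w : ℂ) : ℂ := Complex.I * (1 + w) / (1 - w)

/-- The boundary values of `toHalfPlane` in terms of the angle. -/
def boundaryPoint (θ : ℝ) : ℝ := -(Real.cos (θ / 2) / Real.sin (θ / 2))

theorem im_toHalfPlane (w : ℂ) :
    (toHalfPlane w).im = (1 - ‖w‖ ^ 2) / ‖1 - w‖ ^ 2 := by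
  rw [toHalfPlane, mul_div_assoc, Complex.I_mul_im, Complex.div_re, ← Complex.normSq_eq_norm_sq,
    ← Complex.normSq_eq_norm_sq, ← add_div]
  congr 1
  simp [Complex.normSq_apply]
  ring

theorem one_sub_ne_zero_of_mem_ball {w : ℂ} (hw : w ∈ Metric.ball (0 : ℂ) 1) : 1 - w ≠ 0 := by
  intro h
  have : w = 1 := (sub_eq_zero.mp h).symm
  rw [this] at hw
  simp at hw

theorem toHalfPlane_mem_upper {w : ℂ} (hw : w ∈ Metric.ball (0 : ℂ) 1) :
    toHalfPlane w ∈ upper := by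
  have h1 : ‖w‖ < 1 := by simpa using hw
  have h2 := one_sub_ne_zero_of_mem_ball hw
  simp only [upper, mem_ofPred_eq, im_toHalfPlane]
  have : 0 < 1 - ‖w‖ ^ 2 := by nlinarith [norm_nonneg w]
  positivity

theorem exists_toHalfPlane_eq {l : ℂ} (hl : l ∈ upper) :
    ∃ w ∈ Metric.ball (0 : ℂ) 1, toHalfPlane w = l := by
  have hl' : 0 < l.im := hl
  have hne : l + Complex.I ≠ 0 := by
    intro h
    have := congrArg Complex.im h
    simp at this
    linarith
  refine ⟨(l - Complex.I) / (l + Complex.I), ?_, ?_⟩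
  · rw [Metric.mem_ball, dist_zero_right, norm_div, div_lt_one (norm_pos_iff.mpr hne)]
    rw [← sq_lt_sq₀ (norm_nonneg _) (norm_nonneg _), ← Complex.normSq_eq_norm_sq,
      ← Complex.normSq_eq_norm_sq]
    simp [Complex.normSq_apply]
    nlinarith
  · rw [toHalfPlane]
    have h1 : 1 - (l - Complex.I) / (l + Complex.I) = 2 * Complex.I / (l + Complex.I) := by
      field_simp
      ring
    have h2 : 1 + (l - Complex.I) / (l + Complex.I) = 2 * l / (l + Complex.I) := by
      field_simp
      ring
    rw [h1, h2]
    field_simp [Complex.I_ne_zero]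

theorem circleMap_eq_sq (θ : ℝ) : circleMap 0 1 θ =
    ((Real.cos (θ / 2) : ℂ) + Real.sin (θ / 2) * Complex.I) ^ 2 := by
  rw [circleMap]
  simp only [Complex.ofReal_one, one_mul, zero_add, Complex.ofReal_cos, Complex.ofReal_sin]
  rw [← Complex.exp_mul_I, ← Complex.exp_nat_mul]
  congr 1
  push_cast
  ring

theorem one_sub_circleMap (θ : ℝ) : 1 - circleMap 0 1 θ =
    -2 * Complex.I * Real.sin (θ / 2) *
      ((Real.cos (θ / 2) : ℂ) + Real.sin (θ / 2) * Complex.I) := by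
  rw [circleMap_eq_sq]
  have h : ((Real.cos (θ / 2) : ℂ)) ^ 2 + (Real.sin (θ / 2) : ℂ) ^ 2 = 1 := by
    exact_mod_cast Real.cos_sq_add_sin_sq (θ / 2)
  linear_combination -h + ((Real.sin (θ / 2) : ℂ) ^ 2) * Complex.I_sq

theorem one_add_circleMap (θ : ℝ) : 1 + circleMap 0 1 θ =
    2 * Real.cos (θ / 2) *
      ((Real.cos (θ / 2) : ℂ) + Real.sin (θ / 2) * Complex.I) := by
  rw [circleMap_eq_sq]
  have h : ((Real.cos (θ / 2) : ℂ)) ^ 2 + (Real.sin (θ / 2) : ℂ) ^ 2 = 1 := by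
    exact_mod_cast Real.cos_sq_add_sin_sq (θ / 2)
  linear_combination -h + ((Real.sin (θ / 2) : ℂ) ^ 2) * Complex.I_sq

theorem half_angle_ne_zero (θ : ℝ) :
    ((Real.cos (θ / 2) : ℂ) + Real.sin (θ / 2) * Complex.I) ≠ 0 := by
  intro h
  have := circleMap_eq_sq θ
  rw [h] at this
  have h2 : ‖circleMap 0 1 θ‖ = 1 := by simp
  rw [this] at h2
  simp at h2

theorem one_sub_circleMap_ne_zero {θ : ℝ} (h : Real.sin (θ / 2) ≠ 0) :
    1 - circleMap 0 1 θ ≠ 0 := by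
  rw [one_sub_circleMap]
  have := half_angle_ne_zero θ
  have h' : (Real.sin (θ / 2) : ℂ) ≠ 0 := by exact_mod_cast h
  exact mul_ne_zero (mul_ne_zero (mul_ne_zero (by norm_num) Complex.I_ne_zero) h') this

theorem toHalfPlane_circleMap {θ : ℝ} (h : Real.sin (θ / 2) ≠ 0) :
    toHalfPlane (circleMap 0 1 θ) = boundaryPoint θ := by
  have h1 := half_angle_ne_zero θ
  have h' : (Real.sin (θ / 2) : ℂ) ≠ 0 := by exact_mod_cast h
  rw [toHalfPlane, one_sub_circleMap, one_add_circleMap, boundaryPoint]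
  push_cast only [Complex.ofReal_neg, Complex.ofReal_div]
  have hI := Complex.I_ne_zero
  rw [div_eq_iff (mul_ne_zero (mul_ne_zero (mul_ne_zero (by norm_num) hI) h') h1)]
  field_simp

theorem norm_toHalfPlane_sub_sq {ζ w : ℂ} (hζ : 1 - ζ ≠ 0) (hw : 1 - w ≠ 0) :
    ‖toHalfPlane ζ - toHalfPlane w‖ ^ 2 = 4 * ‖ζ - w‖ ^ 2 / (‖1 - ζ‖ ^ 2 * ‖1 - w‖ ^ 2) := by
  have h : toHalfPlane ζ - toHalfPlane w = 2 * Complex.I * (ζ - w) / ((1 - ζ) * (1 - w)) := by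
    rw [toHalfPlane, toHalfPlane]
    field_simp
    ring
  rw [h, norm_div, norm_mul, norm_mul, norm_mul, Complex.norm_I]
  simp only [Complex.norm_ofNat, mul_one, div_pow, mul_pow]
  norm_num

/-- The factor 1 + t² relating the kernels of the disc and the half plane becomes the density that
turns the measure on the circle into the measure on the line. -/
theorem poissonKernel_eq_of_sin_ne_zero {θ : ℝ} (h : Real.sin (θ / 2) ≠ 0) {w : ℂ}
    (hw : w ∈ Metric.ball (0 : ℂ) 1) :
    poissonKernel 0 w (circleMap 0 1 θ) = (1 + boundaryPoint θ ^ 2) *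
      ((toHalfPlane w).im / Complex.normSq (boundaryPoint θ - toHalfPlane w)) := by
  have hw1 := one_sub_ne_zero_of_mem_ball hw
  have hζ1 := one_sub_circleMap_ne_zero h
  have hne : circleMap 0 1 θ - w ≠ 0 := by
    intro h
    have h3 : ‖w‖ < 1 := by simpa using hw
    rw [← sub_eq_zero.mp h] at h3
    simp at h3
  have e1 : 1 + boundaryPoint θ ^ 2 = 4 / ‖1 - circleMap 0 1 θ‖ ^ 2 := by
    have := norm_toHalfPlane_sub_sq hζ1 (w := 0) (by simp)
    rw [toHalfPlane_circleMap h] at this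
    have h0 : toHalfPlane 0 = Complex.I := by simp [toHalfPlane]
    rw [h0, ← Complex.normSq_eq_norm_sq] at this
    simp only [Complex.normSq_apply, Complex.sub_re, Complex.ofReal_re, Complex.I_re, sub_zero,
      Complex.sub_im, Complex.ofReal_im, Complex.I_im, zero_sub, norm_circleMap_zero, abs_one,
      one_pow, mul_one, norm_one] at this
    rw [← this]
    ring
  rw [e1, im_toHalfPlane, ← toHalfPlane_circleMap h, Complex.normSq_eq_norm_sq,
    norm_toHalfPlane_sub_sq hζ1 hw1, poissonKernel]
  simp only [sub_zero, norm_circleMap_zero, abs_one, one_pow]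
  have a1 : ‖1 - w‖ ≠ 0 := norm_ne_zero_iff.mpr hw1
  have a2 : ‖1 - circleMap 0 1 θ‖ ≠ 0 := norm_ne_zero_iff.mpr hζ1
  have a3 : ‖circleMap 0 1 θ - w‖ ≠ 0 := norm_ne_zero_iff.mpr hne
  field_simp

/-- The boundary point 1 corresponds to ∞; a mass there produces the linear term of the Herglotz
formula. -/
theorem poissonKernel_eq_of_circleMap_eq_one {θ : ℝ} (h : circleMap 0 1 θ = 1) (w : ℂ) :
    poissonKernel 0 w (circleMap 0 1 θ) = (toHalfPlane w).im := by
  rw [h, im_toHalfPlane, poissonKernel]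
  simp

/-- **Herglotz representation** of a function on the upper half plane whose imaginary part has
vanishing boundary values off a compact subset `S` of the real line. -/
theorem exists_herglotz {N : ℂ → ℂ} (hN : DifferentiableOn ℂ N upper)
    (him : ∀ l ∈ upper, 0 ≤ (N l).im) {S : Set ℝ} (hS : IsCompact S)
    (hreal : ∀ x : ℝ, x ∉ S → Tendsto (fun l => (N l).im) (𝓝[upper] (x : ℂ)) (𝓝 0)) :
    ∃ (A B : ℝ) (σ : Measure ℝ), 0 ≤ B ∧ IsFiniteMeasure σ ∧ σ Sᶜ = 0 ∧
      ∀ l ∈ upper, N l = A + B * l + ∫ t : ℝ, 1 / ((t : ℂ) - l) ∂σ := by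
  have hdiff : DifferentiableOn ℂ toHalfPlane (Metric.ball 0 1) := by
    unfold toHalfPlane
    exact DifferentiableOn.div (by fun_prop) (by fun_prop)
      fun w hw => one_sub_ne_zero_of_mem_ball hw
  obtain ⟨μ, hfin, hsupp, hpois, hnull⟩ := exists_measure_poisson
    (u := fun w => N (toHalfPlane w)) (hN.comp hdiff fun w hw => toHalfPlane_mem_upper hw)
    (fun w hw => him _ (toHalfPlane_mem_upper hw))
  -- Both removed endpoints are the boundary point 1, so what lies outside `T` is the mass at ∞,
  -- which becomes `B`.
  set T : Set ℝ := Ioo 0 (2 * Real.pi) with hT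
  have hTm : MeasurableSet T := measurableSet_Ioo
  have hsin : ∀ θ ∈ T, Real.sin (θ / 2) ≠ 0 := fun θ hθ =>
    (Real.sin_pos_of_pos_of_lt_pi (by linarith [hθ.1]) (by linarith [hθ.2])).ne'
  have hgm : Measurable boundaryPoint := by
    unfold boundaryPoint
    fun_prop
  have hgc : ContinuousOn boundaryPoint T := by
    unfold boundaryPoint
    refine ContinuousOn.neg (ContinuousOn.div (by fun_prop) (by fun_prop) hsin)
  have hnull' : μ (T ∩ boundaryPoint ⁻¹' Sᶜ) = 0 := by
    have hopen : IsOpen (T ∩ boundaryPoint ⁻¹' Sᶜ) :=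
      hgc.isOpen_inter_preimage isOpen_Ioo hS.isClosed.isOpen_compl
    refine measure_null_of_locally_null _ fun θ₀ hθ₀ => ?_
    obtain ⟨δ, hδ, h0⟩ := hnull θ₀ (by
      filter_upwards [hopen.mem_nhds hθ₀] with θ hθ
      have h1 := hreal _ hθ.2
      refine h1.comp (tendsto_nhdsWithin_iff.mpr ⟨?_, ?_⟩)
      · rw [← toHalfPlane_circleMap (hsin θ hθ.1)]
        refine tendsto_nhdsWithin_of_tendsto_nhds ?_
        unfold toHalfPlane
        exact ContinuousAt.div (by fun_prop) (by fun_prop)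
          (one_sub_circleMap_ne_zero (hsin θ hθ.1))
      · filter_upwards [self_mem_nhdsWithin] with w hw using toHalfPlane_mem_upper hw)
    exact ⟨_, mem_nhdsWithin_of_mem_nhds (Metric.ball_mem_nhds θ₀ hδ), h0⟩
  let ν : Measure ℝ := (μ.restrict T).map boundaryPoint
  have hνS : ν Sᶜ = 0 := by
    rw [Measure.map_apply hgm hS.measurableSet.compl,
      Measure.restrict_apply (hgm hS.measurableSet.compl), inter_comm]
    exact hnull'
  let d : ℝ → ℝ := fun t => 1 + t ^ 2
  have hd0 : ∀ t, 0 ≤ d t := fun t => by positivity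
  have hdm : Measurable fun t => ENNReal.ofReal (d t) := by fun_prop
  -- The density 1 + t² is unbounded on the line, but `ν` lives on the compact set `S`; this keeps
  -- `σ` finite and makes the usual regularizing term in the Herglotz kernel unnecessary.
  let σ : Measure ℝ := ν.withDensity fun t => ENNReal.ofReal (d t)
  have hσS : σ Sᶜ = 0 := withDensity_absolutelyContinuous _ _ hνS
  have hσint : ∀ h : ℝ → ℝ, Measurable h → ∫ t, h t ∂σ =
      ∫ θ in T, d (boundaryPoint θ) * h (boundaryPoint θ) ∂μ := by
    intro h hh
    rw [integral_withDensity_eq_integral_toReal_smul hdm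
      (Eventually.of_forall fun _ => ENNReal.ofReal_lt_top)]
    simp only [ENNReal.toReal_ofReal (hd0 _), smul_eq_mul]
    exact integral_map hgm.aemeasurable
      (((by fun_prop : Measurable d).mul hh).aestronglyMeasurable)
  have hσfin : IsFiniteMeasure σ := by
    refine isFiniteMeasure_withDensity_ofReal ?_
    obtain ⟨C, hC⟩ := hS.exists_bound_of_continuousOn (f := d) (by fun_prop)
    refine HasFiniteIntegral.of_bounded (C := C) ?_
    have : ∀ᵐ t ∂ν, t ∈ S := hνS
    filter_upwards [this] with t ht using hC t ht
  set B : ℝ := (μ Tᶜ).toReal with hB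
  have hBint : ∀ w, ∫ θ in Tᶜ, poissonKernel 0 w (circleMap 0 1 θ) ∂μ
      = B * (toHalfPlane w).im := by
    intro w
    have : ∫ θ in Tᶜ, poissonKernel 0 w (circleMap 0 1 θ) ∂μ
        = ∫ θ in Tᶜ, (toHalfPlane w).im ∂μ := by
      refine setIntegral_congr_ae hTm.compl ?_
      have : ∀ᵐ θ ∂μ, θ ∈ Icc 0 (2 * Real.pi) := hsupp
      filter_upwards [this] with θ hθ hθT
      apply poissonKernel_eq_of_circleMap_eq_one
      have : θ = 0 ∨ θ = 2 * Real.pi := by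
        by_contra hcon
        push Not at hcon
        exact hθT ⟨lt_of_le_of_ne hθ.1 (Ne.symm hcon.1), lt_of_le_of_ne hθ.2 hcon.2⟩
      rcases this with rfl | rfl <;> simp [circleMap]
    rw [this]
    simp [hB, Measure.real]
  have hImN : ∀ l ∈ upper, (N l).im = B * l.im + (∫ t : ℝ, 1 / ((t : ℂ) - l) ∂σ).im := by
    intro l hl
    obtain ⟨w, hw, rfl⟩ := exists_toHalfPlane_eq hl
    have hl0 : (toHalfPlane w).im ≠ 0 := ne_of_gt hl
    obtain ⟨C, hC⟩ := exists_bound_poissonKernel_circleMap hw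
    have hint : Integrable (fun θ => poissonKernel 0 w (circleMap 0 1 θ)) μ :=
      Integrable.of_bound (continuous_poissonKernel_circleMap hw).aestronglyMeasurable C
        (Eventually.of_forall hC)
    have h1 := hpois w hw
    rw [h1, ← integral_add_compl hTm hint, hBint, im_cauchy hl0, hσint, add_comm]
    · congr 1
      refine setIntegral_congr_fun hTm fun θ hθ => ?_
      exact poissonKernel_eq_of_sin_ne_zero (hsin θ hθ) hw
    · refine Measurable.div measurable_const ?_
      exact (Complex.continuous_normSq.comp (by fun_prop)).measurable
  have hcau : ∀ l ∈ upper, DifferentiableAt ℂ (fun l : ℂ => ∫ t : ℝ, 1 / ((t : ℂ) - l) ∂σ) l :=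
    fun l hl => differentiableAt_cauchy isClosed_univ (by simp)
      (notMem_image_ofReal (ne_of_gt hl) univ)
  obtain ⟨A, hA⟩ := exists_real_of_im_eq_zero
    (K := fun l => N l - B * l - ∫ t : ℝ, 1 / ((t : ℂ) - l) ∂σ)
    (by
      refine DifferentiableOn.sub (hN.sub (by fun_prop)) fun l hl => ?_
      exact (hcau l hl).differentiableWithinAt)
    (fun l hl => by
      simp only [Complex.sub_im, hImN l hl, Complex.mul_im, Complex.ofReal_re, Complex.ofReal_im]
      ring)
  refine ⟨A, B, σ, ENNReal.toReal_nonneg, hσfin, hσS, fun l hl => ?_⟩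
  have := hA l hl
  rw [← this]
  ring

/-- The map λ ↦ -λ - 1/λ has a pole at 0, so nothing is assumed about the boundary values there. The
representation is applied on `insert 0 S`, and mass outside `S` can only be an atom at 0, which is
split off as -c/λ. -/
theorem exists_herglotz_of_insert_zero {N : ℂ → ℂ} (hN : DifferentiableOn ℂ N upper)
    (him : ∀ l ∈ upper, 0 ≤ (N l).im) {S : Set ℝ} (hS : IsCompact S)
    (hreal : ∀ x : ℝ, x ∉ S → x ≠ 0 →
      Tendsto (fun l => (N l).im) (𝓝[upper] (x : ℂ)) (𝓝 0)) :
    ∃ (A B c : ℝ) (σ : Measure ℝ), 0 ≤ B ∧ IsFiniteMeasure σ ∧ σ Sᶜ = 0 ∧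
      ∀ l ∈ upper, N l = A + B * l - c / l + ∫ t : ℝ, 1 / ((t : ℂ) - l) ∂σ := by
  obtain ⟨A, B, σ, hB, hfin, hsupp, hrep⟩ := exists_herglotz hN him (hS.insert 0)
    fun x hx => hreal x (fun h => hx (mem_insert_of_mem _ h)) (fun h => hx (h ▸ mem_insert _ _))
  refine ⟨A, B, (σ Sᶜ).toReal, σ.restrict S, hB, inferInstance, ?_, fun l hl => ?_⟩
  · rw [Measure.restrict_apply hS.measurableSet.compl]
    simp
  have hl0 : l.im ≠ 0 := ne_of_gt hl
  have hi : Integrable (fun t : ℝ => 1 / ((t : ℂ) - l)) σ :=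
    integrable_cauchy isClosed_univ (by simp) (notMem_image_ofReal hl0 univ)
  rw [hrep l hl, ← integral_add_compl hS.measurableSet hi]
  have : ∫ t in Sᶜ, 1 / ((t : ℂ) - l) ∂σ = ∫ t in Sᶜ, -(1 / l) ∂σ := by
    refine setIntegral_congr_ae hS.measurableSet.compl ?_
    have hae : ∀ᵐ t ∂σ, t ∈ insert 0 S := hsupp
    filter_upwards [hae] with t ht htS
    rcases ht with rfl | h
    · simp
    · exact absurd h htS
  rw [this, setIntegral_const, Measure.real]
  simp only [Complex.real_smul]
  ring

end HalfPlane

/-! ### Holomorphic continuation across an interval from boundary values almost everywhere -/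

section Gluing

open Complex

/-- The integral of `f` along the boundary of the rectangle with opposite corners `z`, `w`. -/
def rectIntegral (f : ℂ → ℂ) (z w : ℂ) : ℂ :=
  (∫ x : ℝ in z.re..w.re, f (x + z.im * I)) - (∫ x : ℝ in z.re..w.re, f (x + w.im * I)) +
    I * (∫ y : ℝ in z.im..w.im, f (w.re + y * I)) -
    I * (∫ y : ℝ in z.im..w.im, f (z.re + y * I))

variable {a b : ℝ} {f : ℂ → ℂ}

/-- The vertical strip over `(a, b)`. -/
def strip (a b : ℝ) : Set ℂ := {z | z.re ∈ Ioo a b}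

theorem isOpen_strip : IsOpen (strip a b) := isOpen_Ioo.preimage continuous_re

/-- Every rectangle is the difference of two rectangles having a side on the real line. No rectangle
with a side on the line has the line in its interior. -/
theorem rectIntegral_eq_zero_of_real_side
    (hv : ∀ x ∈ Ioo a b, ∀ y₁ y₂ : ℝ, IntervalIntegrable (fun y : ℝ => f (x + y * I)) volume y₁ y₂)
    (h : ∀ z w : ℂ, z ∈ strip a b → w ∈ strip a b → z.im = 0 → rectIntegral f z w = 0)
    {z w : ℂ} (hz : z ∈ strip a b) (hw : w ∈ strip a b) : rectIntegral f z w = 0 := by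
  have h1 := h (z.re : ℂ) w (by simpa [strip] using hz) hw (by simp)
  have h2 := h (z.re : ℂ) (w.re + z.im * I) (by simpa [strip] using hz)
    (by simpa [strip] using hw) (by simp)
  simp only [rectIntegral, ofReal_re, ofReal_im, add_re, add_im, mul_re, mul_im, I_re, I_im,
    mul_zero, mul_one, sub_zero, add_zero, zero_add] at h1 h2 ⊢
  have e1 := intervalIntegral.integral_add_adjacent_intervals (hv w.re hw 0 z.im)
    (hv w.re hw z.im w.im)
  have e2 := intervalIntegral.integral_add_adjacent_intervals (hv z.re hz 0 z.im)
    (hv z.re hz z.im w.im)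
  linear_combination h1 - h2 + I * e1 - I * e2

theorem wedgeIntegral_sub_wedgeIntegral
    (hv : ∀ x ∈ Ioo a b, ∀ y₁ y₂ : ℝ, IntervalIntegrable (fun y : ℝ => f (x + y * I)) volume y₁ y₂)
    (hr : ∀ z w : ℂ, z ∈ strip a b → w ∈ strip a b → rectIntegral f z w = 0)
    (hh : ∀ x₁ ∈ Ioo a b, ∀ x₂ ∈ Ioo a b, IntervalIntegrable (fun x : ℝ => f x) volume x₁ x₂)
    {c z w : ℂ} (hc : c ∈ strip a b) (hc0 : c.im = 0) (hz : z ∈ strip a b) (hw : w ∈ strip a b) :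
    wedgeIntegral c w f - wedgeIntegral c z f = wedgeIntegral z w f := by
  have h := hr (z.re : ℂ) (w.re + z.im * I) (by simpa [strip] using hz)
    (by simpa [strip] using hw)
  have e1 := intervalIntegral.integral_add_adjacent_intervals (hh c.re hc z.re hz)
    (hh z.re hz w.re hw)
  have e2 := intervalIntegral.integral_add_adjacent_intervals (hv w.re hw 0 z.im)
    (hv w.re hw z.im w.im)
  simp only [rectIntegral, ofReal_re, ofReal_im, add_re, add_im, mul_re, mul_im, I_re, I_im,
    mul_zero, mul_one, sub_zero, add_zero, zero_add] at h
  simp only [wedgeIntegral, hc0, smul_eq_mul, ofReal_zero, zero_mul, add_zero] at h ⊢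
  linear_combination h - e1 - I * e2

theorem isConservativeOn_strip
    (hr : ∀ z w : ℂ, z ∈ strip a b → w ∈ strip a b → rectIntegral f z w = 0) :
    IsConservativeOn f (strip a b) := by
  intro z w hzw
  rw [← add_eq_zero_iff_eq_neg, wedgeIntegral_add_wedgeIntegral_eq]
  have hz : z ∈ Rectangle z w := by simp [Rectangle, mem_reProdIm]
  have hw : w ∈ Rectangle z w := by simp [Rectangle, mem_reProdIm]
  have := hr z w (hzw hz) (hzw hw)
  simpa [rectIntegral, smul_eq_mul] using this

theorem mem_strip_of_mem_uIcc {z w : ℂ} (hz : z ∈ strip a b) (hw : w ∈ strip a b) {x : ℝ}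
    (hx : x ∈ uIcc z.re w.re) : x ∈ Ioo a b :=
  (ordConnected_Ioo.uIcc_subset hz hw) hx

theorem continuous_line (x : ℝ) : Continuous fun y : ℝ => (x : ℂ) + y * I := by fun_prop

/-- A continuous function on a strip that is holomorphic off the real line is holomorphic. -/
theorem differentiableOn_strip_of_off_real (hc : ContinuousOn f (strip a b))
    (hd : ∀ z ∈ strip a b, z.im ≠ 0 → DifferentiableAt ℂ f z) :
    DifferentiableOn ℂ f (strip a b) := by
  refine (isConservativeOn_and_continuousOn_iff_isDifferentiableOn isOpen_strip).mp
    ⟨isConservativeOn_strip fun z w hz hw => ?_, hc⟩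
  refine rectIntegral_eq_zero_of_real_side (fun x hx y₁ y₂ => ?_) (fun z w hz hw hz0 => ?_) hz hw
  · refine (hc.comp_continuous (continuous_line x) fun y => ?_).intervalIntegrable _ _
    simpa [strip] using hx
  · have := Complex.integral_boundary_rect_eq_zero_of_continuousOn_of_differentiableOn f z w
      (hc.mono ?_) ?_
    · simpa [rectIntegral, smul_eq_mul] using this
    · intro u hu
      exact mem_strip_of_mem_uIcc hz hw hu.1
    · intro u hu
      refine (hd u ?_ ?_).differentiableWithinAt
      · refine mem_strip_of_mem_uIcc hz hw ?_
        exact Ioo_subset_Icc_self hu.1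
      · have h2 := hu.2
        simp only [hz0, mem_preimage, mem_Ioo, min_lt_iff, lt_max_iff] at h2
        intro h0
        rw [h0] at h2
        rcases h2 with ⟨h3 | h3, h4 | h4⟩ <;> linarith

theorem norm_wedgeIntegral_le {z w : ℂ} {C : ℝ}
    (h1 : ∀ᵐ x : ℝ, x ∈ uIoc z.re w.re → ‖f (x + z.im * I)‖ ≤ C)
    (h2 : ∀ᵐ y : ℝ, y ∈ uIoc z.im w.im → ‖f (w.re + y * I)‖ ≤ C) :
    ‖wedgeIntegral z w f‖ ≤ C * |w.re - z.re| + C * |w.im - z.im| := by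
  refine (norm_add_le _ _).trans (add_le_add ?_ ?_)
  · exact intervalIntegral.norm_integral_le_of_norm_le_const_ae h1
  · rw [norm_smul, norm_I, one_mul]
    exact intervalIntegral.norm_integral_le_of_norm_le_const_ae h2

/-- A bounded function that is holomorphic on both sides of an interval of the real line, with
coinciding vertical boundary values almost everywhere, extends holomorphically across. -/
theorem exists_extension_of_bounded
    (hd : ∀ z ∈ strip a b, z.im ≠ 0 → DifferentiableAt ℂ f z)
    (hb : ∀ z ∈ strip a b, z.im ≠ 0 → ‖f z‖ ≤ 1)
    (hlim : ∀ᵐ x : ℝ, x ∈ Ioo a b →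
      Tendsto (fun y : ℝ => f (x + y * I)) (𝓝[≠] 0) (𝓝 (f x))) :
    ∃ ψ : ℂ → ℂ, DifferentiableOn ℂ ψ (strip a b) ∧
      ∀ z ∈ strip a b, z.im ≠ 0 → ψ z = f z := by
  rcases le_or_gt b a with hab | hab
  · refine ⟨f, fun z hz => ?_, fun z _ _ => rfl⟩
    exact absurd (hz.1.trans hz.2) (not_lt.mpr hab)
  have hbx : ∀ᵐ x : ℝ, x ∈ Ioo a b → ‖f x‖ ≤ 1 := by
    filter_upwards [hlim] with x hx hxI
    refine le_of_tendsto (hx hxI).norm ?_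
    filter_upwards [self_mem_nhdsWithin] with y hy
    exact hb _ (by simpa [strip] using hxI) (by simpa using hy)
  have hvm : ∀ x ∈ Ioo a b, AEStronglyMeasurable (fun y : ℝ => f (x + y * I)) volume := by
    intro x hx
    have : ContinuousOn (fun y : ℝ => f (x + y * I)) {0}ᶜ := fun y hy =>
      ((hd _ (by simpa [strip] using hx) (by simpa using hy)).continuousAt.comp
        (f := fun y : ℝ => (x : ℂ) + y * I)
        (continuous_line x).continuousAt).continuousWithinAt
    have h2 := this.aestronglyMeasurable (μ := volume) (measurableSet_singleton 0).compl
    rwa [Measure.restrict_eq_self_of_ae_mem] at h2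
    exact compl_mem_ae_iff.mpr (by simp)
  have hvb : ∀ x ∈ Ioo a b, ∀ᵐ y : ℝ, ‖f (x + y * I)‖ ≤ 1 := by
    intro x hx
    filter_upwards [compl_mem_ae_iff.mpr (measure_singleton (0 : ℝ))] with y hy
    exact hb _ (by simpa [strip] using hx) (by simpa using hy)
  have hv : ∀ x ∈ Ioo a b, ∀ y₁ y₂ : ℝ,
      IntervalIntegrable (fun y : ℝ => f (x + y * I)) volume y₁ y₂ := by
    intro x hx y₁ y₂
    rw [intervalIntegrable_iff]
    exact Measure.integrableOn_of_bounded (M := 1) (by simp) (hvm x hx)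
      (ae_restrict_of_ae (hvb x hx))
  have hhc : ∀ y : ℝ, y ≠ 0 → ContinuousOn (fun x : ℝ => f (x + y * I)) (Ioo a b) := by
    intro y hy x hx
    exact ((hd _ (by simpa [strip] using hx) (by simpa using hy)).continuousAt.comp
      (f := fun x : ℝ => (x : ℂ) + y * I) (by fun_prop)).continuousWithinAt
  -- The values of `f` on the line are an almost everywhere limit of its values at height 1/(n+1),
  -- where it is continuous.
  have hhm : AEStronglyMeasurable (fun x : ℝ => f x) (volume.restrict (Ioo a b)) := by
    have hu : Tendsto (fun n : ℕ => 1 / ((n : ℝ) + 1)) atTop (𝓝[≠] 0) :=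
      tendsto_nhdsWithin_iff.mpr ⟨tendsto_one_div_add_atTop_nhds_zero_nat,
        Eventually.of_forall fun n => (by positivity : (1 / ((n : ℝ) + 1)) ≠ 0)⟩
    refine aestronglyMeasurable_of_tendsto_ae atTop
      (f := fun (n : ℕ) (x : ℝ) => f (x + ((1 / ((n : ℝ) + 1) : ℝ) : ℂ) * I)) (fun n => ?_) ?_
    · exact (hhc _ (by positivity)).aestronglyMeasurable measurableSet_Ioo
    · rw [ae_restrict_iff' measurableSet_Ioo]
      filter_upwards [hlim] with x hx hxI
      exact (hx hxI).comp hu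
  have huIoc : ∀ x₁ ∈ Ioo a b, ∀ x₂ ∈ Ioo a b, uIoc x₁ x₂ ⊆ Ioo a b := fun x₁ h₁ x₂ h₂ =>
    uIoc_subset_uIcc.trans (ordConnected_Ioo.uIcc_subset h₁ h₂)
  have hh : ∀ x₁ ∈ Ioo a b, ∀ x₂ ∈ Ioo a b,
      IntervalIntegrable (fun x : ℝ => f x) volume x₁ x₂ := by
    intro x₁ h₁ x₂ h₂
    rw [intervalIntegrable_iff]
    refine IntegrableOn.mono_set ?_ (huIoc x₁ h₁ x₂ h₂)
    exact Integrable.of_bound hhm 1 ((ae_restrict_iff' measurableSet_Ioo).mpr hbx)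
  have hr : ∀ z w : ℂ, z ∈ strip a b → w ∈ strip a b → rectIntegral f z w = 0 := by
    intro z w hz hw
    refine rectIntegral_eq_zero_of_real_side hv (fun z w hz hw hz0 => ?_) hz hw
    rcases eq_or_ne w.im 0 with hw0 | hw0
    · simp [rectIntegral, hz0, hw0]
    -- The side on the real line is moved to height ε · Im w, on the same side as `w`, where
    -- Cauchy's theorem applies. Then ε → 0 by dominated convergence with the bound 1.
    have hzero : ∀ ε : ℝ, 0 < ε → ε < 1 →
        rectIntegral f (z.re + ((ε * w.im : ℝ) : ℂ) * I) w = 0 := by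
      intro ε hε hε1
      have := Complex.integral_boundary_rect_eq_zero_of_differentiableOn f
        (z.re + ((ε * w.im : ℝ) : ℂ) * I) w ?_
      · simpa only [rectIntegral, smul_eq_mul] using this
      · intro u hu
        refine (hd u ?_ ?_).differentiableWithinAt
        · refine mem_strip_of_mem_uIcc (z := (z.re + ((ε * w.im : ℝ) : ℂ) * I))
            (by simpa [strip] using hz) hw hu.1
        · have h2 := hu.2
          simp only [add_im, ofReal_im, mul_im, ofReal_re, I_re, I_im, mul_zero, mul_one,
            zero_add, add_zero, mem_preimage] at h2
          intro h0
          rw [h0, mem_uIcc] at h2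
          rcases lt_or_gt_of_ne hw0 with h | h
          · rcases h2 with h2 | h2 <;> nlinarith
          · rcases h2 with h2 | h2 <;> nlinarith
    have hεlim : Tendsto (fun ε : ℝ => ε * w.im) (𝓝[>] 0) (𝓝[≠] 0) := by
      refine tendsto_nhdsWithin_iff.mpr ⟨?_, ?_⟩
      · have : Tendsto (fun ε : ℝ => ε * w.im) (𝓝 0) (𝓝 (0 * w.im)) :=
          (continuous_id.mul continuous_const).tendsto 0
        rw [zero_mul] at this
        exact this.mono_left nhdsWithin_le_nhds
      · filter_upwards [self_mem_nhdsWithin] with ε hε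
        exact mul_ne_zero (ne_of_gt hε) hw0
    have t1 : Tendsto (fun ε : ℝ => ∫ x : ℝ in z.re..w.re, f (x + ((ε * w.im : ℝ) : ℂ) * I))
        (𝓝[>] 0) (𝓝 (∫ x : ℝ in z.re..w.re, f x)) := by
      refine intervalIntegral.tendsto_integral_filter_of_dominated_convergence (fun _ => 1)
        ?_ ?_ (by simp) ?_
      · filter_upwards [self_mem_nhdsWithin] with ε hε
        refine ((hhc _ (mul_ne_zero (ne_of_gt hε) hw0)).mono
          (huIoc _ hz _ hw)).aestronglyMeasurable measurableSet_uIoc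
      · filter_upwards [self_mem_nhdsWithin] with ε hε
        refine Eventually.of_forall fun x hx => hb _ ?_ ?_
        · simpa [strip] using huIoc _ hz _ hw hx
        · simpa using ⟨ne_of_gt hε, hw0⟩
      · filter_upwards [hlim] with x hx hxI
        exact (hx (huIoc _ hz _ hw hxI)).comp hεlim
    have t2 : ∀ x ∈ Ioo a b, Tendsto (fun ε : ℝ => ∫ y : ℝ in (ε * w.im)..w.im, f (x + y * I))
        (𝓝[>] 0) (𝓝 (∫ y : ℝ in 0..w.im, f (x + y * I))) := by
      intro x hx
      have hc := intervalIntegral.continuous_primitive (hv x hx) w.im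
      have := (hc.neg.tendsto 0).comp (hεlim.mono_right nhdsWithin_le_nhds)
      rw [intervalIntegral.integral_symm]
      refine this.congr fun ε => ?_
      exact (intervalIntegral.integral_symm _ _).symm
    have t3 : Tendsto (fun ε : ℝ => rectIntegral f (z.re + ((ε * w.im : ℝ) : ℂ) * I) w) (𝓝[>] 0)
        (𝓝 (rectIntegral f z w)) := by
      have := (((t1.sub_const (∫ x : ℝ in z.re..w.re, f (x + w.im * I))).add
        ((t2 w.re hw).const_mul I)).sub ((t2 z.re hz).const_mul I))
      simpa [rectIntegral, hz0] using this
    refine tendsto_nhds_unique t3 (tendsto_const_nhds.congr' ?_)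
    filter_upwards [Ioo_mem_nhdsGT (zero_lt_one (α := ℝ))] with ε hε
    exact (hzero ε hε.1 hε.2).symm
  obtain ⟨c, hc⟩ : (Ioo a b).Nonempty := nonempty_Ioo.mpr hab
  have hcs : (c : ℂ) ∈ strip a b := by simpa [strip] using hc
  -- On the line `f` is controlled only almost everywhere, so continuity is not available for `f`
  -- itself. Its primitive is continuous because `f` is bounded, and holomorphic off the line, hence
  -- holomorphic; the extension is the derivative of the primitive.
  let Φ : ℂ → ℂ := fun z => wedgeIntegral (c : ℂ) z f
  have hΦ : ∀ z ∈ strip a b, ∀ w ∈ strip a b, Φ w - Φ z = wedgeIntegral z w f :=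
    fun z hz w hw => wedgeIntegral_sub_wedgeIntegral hv hr hh hcs (by simp) hz hw
  have hΦc : ContinuousOn Φ (strip a b) := by
    refine continuousOn_of_forall_continuousAt fun z hz => ?_
    have h0 : Tendsto (fun w : ℂ => 1 * |w.re - z.re| + 1 * |w.im - z.im|) (𝓝 z) (𝓝 0) := by
      have : Continuous (fun w : ℂ => 1 * |w.re - z.re| + 1 * |w.im - z.im|) := by fun_prop
      simpa using this.tendsto z
    refine tendsto_iff_norm_sub_tendsto_zero.mpr (squeeze_zero' (Eventually.of_forall
      fun w => norm_nonneg _) ?_ h0)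
    filter_upwards [isOpen_strip.mem_nhds hz] with w hw
    rw [hΦ z hz w hw]
    refine norm_wedgeIntegral_le ?_ ?_
    · rcases eq_or_ne z.im 0 with h | h
      · simp only [h, ofReal_zero, zero_mul, add_zero]
        filter_upwards [hbx] with x hx hxI using hx (huIoc _ hz _ hw hxI)
      · refine Eventually.of_forall fun x hx => hb _ ?_ (by simpa using h)
        simpa [strip] using huIoc _ hz _ hw hx
    · filter_upwards [hvb w.re hw] with y hy _ using hy
  have hΦd : ∀ z ∈ strip a b, z.im ≠ 0 → HasDerivAt Φ (f z) z := by
    intro z hz hz0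
    have hopen : IsOpen (strip a b ∩ {z | z.im ≠ 0}) :=
      isOpen_strip.inter (isOpen_ne_fun continuous_im continuous_const)
    obtain ⟨ε, hε, hball⟩ := Metric.isOpen_iff.mp hopen z ⟨hz, hz0⟩
    have hdb : DifferentiableOn ℂ f (Metric.ball z ε) := fun u hu =>
      (hd u (hball hu).1 (hball hu).2).differentiableWithinAt
    have h1 := hdb.isConservativeOn.hasDerivAt_wedgeIntegral hdb.continuousOn
      (Metric.mem_ball_self hε)
    refine (h1.add_const (Φ z)).congr_of_eventuallyEq ?_
    filter_upwards [isOpen_strip.mem_nhds hz] with w hw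
    rw [← hΦ z hz w hw]
    ring
  have hΦdiff := differentiableOn_strip_of_off_real hΦc
    fun z hz hz0 => (hΦd z hz hz0).differentiableAt
  exact ⟨deriv Φ, hΦdiff.deriv isOpen_strip, fun z hz hz0 => (hΦd z hz hz0).deriv⟩

theorem add_I_ne_zero {w : ℂ} (hw : 0 ≤ w.im) : w + I ≠ 0 := by
  intro h
  have := congrArg im h
  simp at this
  linarith

theorem norm_cayley_lt_one {w : ℂ} (hw : 0 < w.im) : ‖(w - I) / (w + I)‖ < 1 := by
  rw [norm_div, div_lt_one (norm_pos_iff.mpr (add_I_ne_zero hw.le)),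
    ← sq_lt_sq₀ (norm_nonneg _) (norm_nonneg _), ← normSq_eq_norm_sq, ← normSq_eq_norm_sq]
  simp [normSq_apply]
  nlinarith

/-- A function with positive imaginary part that is holomorphic on both sides of an interval of
the real line, with coinciding vertical boundary values almost everywhere, extends
holomorphically across. -/
theorem exists_extension_of_im_pos {N : ℂ → ℂ}
    (hd : ∀ z ∈ strip a b, z.im ≠ 0 → DifferentiableAt ℂ N z)
    (hpos : ∀ z ∈ strip a b, z.im ≠ 0 → 0 < (N z).im)
    (hlim : ∀ᵐ x : ℝ, x ∈ Ioo a b →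
      ∃ w, Tendsto (fun y : ℝ => N (x + y * I)) (𝓝[≠] 0) (𝓝 w)) :
    ∃ ψ : ℂ → ℂ, DifferentiableOn ℂ ψ (strip a b) ∧
      ∀ z ∈ strip a b, z.im ≠ 0 → ψ z = N z := by
  classical
  -- The Cayley transform maps the upper half plane into the unit disc and so reduces to the bounded
  -- case.
  let cay : ℂ → ℂ := fun w => (w - I) / (w + I)
  let g : ℝ → ℂ := fun x => limUnder (𝓝[≠] (0 : ℝ)) fun y : ℝ => N (x + y * I)
  let f : ℂ → ℂ := fun z => if z.im = 0 then cay (g z.re) else cay (N z)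
  have hopen : IsOpen {z : ℂ | z.im ≠ 0} := isOpen_ne_fun continuous_im continuous_const
  have hf : ∀ z : ℂ, z.im ≠ 0 → f z = cay (N z) := fun z hz => if_neg hz
  obtain ⟨φ, hφd, hφ⟩ := exists_extension_of_bounded (a := a) (b := b) (f := f)
    (fun z hz hz0 => by
      have h1 : DifferentiableAt ℂ (fun z => (N z - I) / (N z + I)) z :=
        ((hd z hz hz0).sub_const I).div ((hd z hz hz0).add_const I)
          (add_I_ne_zero (hpos z hz hz0).le)
      refine h1.congr_of_eventuallyEq ?_
      filter_upwards [hopen.mem_nhds hz0] with w hw using hf w hw)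
    (fun z hz hz0 => by
      rw [hf z hz0]
      exact (norm_cayley_lt_one (hpos z hz hz0)).le)
    (by
      filter_upwards [hlim] with x hx hxI
      obtain ⟨w, hw⟩ := hx hxI
      have hg : g x = w := hw.limUnder_eq
      have hw0 : 0 ≤ w.im := by
        refine ge_of_tendsto ((continuous_im.tendsto w).comp hw) ?_
        filter_upwards [self_mem_nhdsWithin] with y hy
        exact (hpos _ (by simpa [strip] using hxI) (by simpa using hy)).le
      have hfx : f x = cay w := by simp [f, hg]
      rw [hfx]
      refine ((hw.sub_const I).div (hw.add_const I) (add_I_ne_zero hw0)).congr' ?_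
      filter_upwards [self_mem_nhdsWithin] with y hy
      exact (hf _ (by simpa using hy)).symm)
  have hφ1 : ∀ z ∈ strip a b, z.im ≠ 0 → ‖φ z‖ < 1 := fun z hz hz0 => by
    rw [hφ z hz hz0, hf z hz0]
    exact norm_cayley_lt_one (hpos z hz hz0)
  have hvert : ∀ z ∈ strip a b, ∀ y : ℝ, z + y * I ∈ strip a b := fun z hz y => by
    simpa [strip] using hz
  have hφle : ∀ z ∈ strip a b, ‖φ z‖ ≤ 1 := by
    intro z hz
    rcases eq_or_ne z.im 0 with hz0 | hz0
    · have hcont : ContinuousAt φ (z + ((0 : ℝ) : ℂ) * I) := by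
        simpa using hφd.continuousOn.continuousAt (isOpen_strip.mem_nhds hz)
      have h1 : Tendsto (fun y : ℝ => ‖φ (z + y * I)‖) (𝓝[≠] 0) (𝓝 ‖φ z‖) := by
        have h2 : ContinuousAt (fun y : ℝ => φ (z + y * I)) 0 :=
          ContinuousAt.comp (f := fun y : ℝ => z + y * I) hcont (by fun_prop)
        have h3 := h2.norm.tendsto
        simp only [ofReal_zero, zero_mul, add_zero] at h3
        exact h3.mono_left nhdsWithin_le_nhds
      refine le_of_tendsto h1 ?_
      filter_upwards [self_mem_nhdsWithin] with y hy
      exact (hφ1 _ (hvert z hz y) (by simpa [hz0] using hy)).le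
    · exact (hφ1 z hz hz0).le
  have hconv : IsPreconnected (strip a b) :=
    ((convex_Ioo a b).linear_preimage Complex.reLm).isPreconnected
  -- Inverting the Cayley transform needs φ ≠ 1 on the real line too. By the maximum principle |φ| =
  -- 1 at one point would force |φ| = 1 throughout the strip, contradicting the strict bound at the
  -- point above or below with imaginary part 1.
  have hφlt : ∀ z ∈ strip a b, ‖φ z‖ < 1 := by
    intro z hz
    refine lt_of_le_of_ne (hφle z hz) fun h1 => ?_
    have hmax : IsMaxOn (norm ∘ φ) (strip a b) z := fun w hw => by
      simp only [Function.comp_apply, mem_ofPred_eq, h1]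
      exact hφle w hw
    have := Complex.norm_eqOn_of_isPreconnected_of_isMaxOn hconv isOpen_strip hφd hz hmax
    have h2 := this (hvert z hz (1 - z.im))
    have h3 := hφ1 _ (hvert z hz (1 - z.im)) (by simp)
    simp only [Function.comp_apply, Function.const_apply] at h2
    linarith
  have hne : ∀ z ∈ strip a b, 1 - φ z ≠ 0 := fun z hz h => by
    have := hφlt z hz
    rw [← sub_eq_zero.mp h] at this
    simp at this
  refine ⟨fun z => I * (1 + φ z) / (1 - φ z), ?_, fun z hz hz0 => ?_⟩
  · exact ((hφd.const_add 1).const_mul I).div (hφd.const_sub 1) hne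
  · have h1 := add_I_ne_zero (hpos z hz hz0).le
    have h2 := hne z hz
    change I * (1 + φ z) / (1 - φ z) = N z
    rw [hφ z hz hz0, hf z hz0] at h2 ⊢
    simp only [cay] at h2 ⊢
    rw [div_eq_iff h2]
    field_simp
    ring

end Gluing

/-! ### Two-sided chains -/

/-- A family of relations that is total on both sides has two-sided chains. -/
theorem exists_int_chain {X : Type*} {Rel : ℤ → X → X → Prop}
    (hr : ∀ n x, ∃ y, Rel n x y) (hl : ∀ n y, ∃ x, Rel n x y) (x₀ : X) :
    ∃ x : ℤ → X, x 0 = x₀ ∧ ∀ n, Rel n (x n) (x (n + 1)) := by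
  choose R hR using hr
  choose L hL using hl
  let pos : ℕ → X := fun k => Nat.rec x₀ (fun k x => R k x) k
  -- `neg k` is the entry at -k. Passing from -k to -(k+1) uses the relation with index `Int.negSucc
  -- k`, which is -(k+1).
  let neg : ℕ → X := fun k => Nat.rec x₀ (fun k x => L (Int.negSucc k) x) k
  let x : ℤ → X := fun n => Int.casesOn n pos fun k => neg (k + 1)
  have hx : ∀ k : ℕ, x (-(k : ℤ)) = neg k := by
    intro k
    cases k with
    | zero => rfl
    | succ j => rfl
  refine ⟨x, rfl, fun n => ?_⟩
  cases n with
  | ofNat k => exact hR k (pos k)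
  | negSucc k =>
    have h1 : Int.negSucc k + 1 = -(k : ℤ) := by omega
    rw [h1, hx]
    exact hL (Int.negSucc k) (neg k)

/-! ### Solutions of the difference equation, flux and uniqueness of Weyl solutions -/

namespace JacobiMatrix

variable {J : JacobiMatrix} {z : ℂ} {f g : ℤ → ℂ}

theorem a_ne_zero (J : JacobiMatrix) (n : ℤ) : (J.a n : ℂ) ≠ 0 :=
  Complex.ofReal_ne_zero.mpr (J.a_pos n).ne'

/-- A second order recursion is a first order chain for the pairs (f n, f (n+1)), solvable in both
directions because the `a n` do not vanish. -/
theorem exists_isSolution (J : JacobiMatrix) (z u v : ℂ) :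
    ∃ f, J.IsSolution z f ∧ f 0 = u ∧ f 1 = v := by
  obtain ⟨x, hx0, hx⟩ := exists_int_chain (X := ℂ × ℂ)
    (Rel := fun n p q => q.1 = p.2 ∧
      (J.a (n + 1) : ℂ) * q.2 + J.a n * p.1 + J.b (n + 1) * p.2 = z * p.2)
    (fun n p => ⟨(p.2, (z * p.2 - J.b (n + 1) * p.2 - J.a n * p.1) / J.a (n + 1)), rfl, by
      have := J.a_ne_zero (n + 1)
      field_simp
      ring⟩)
    (fun n q => ⟨((z * q.1 - J.b (n + 1) * q.1 - J.a (n + 1) * q.2) / J.a n, q.1), rfl, by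
      have := J.a_ne_zero n
      field_simp
      ring⟩) (u, v)
  refine ⟨fun n => (x n).1, fun n => ?_, by simp [hx0], ?_⟩
  · have h1 := hx (n - 1)
    have h2 := hx n
    rw [sub_add_cancel] at h1
    simp only
    rw [h2.1, h1.1]
    exact h1.2
  · have := (hx 0).1
    simpa [hx0] using this

theorem IsSolution.const_smul (h : J.IsSolution z f) (c : ℂ) :
    J.IsSolution z fun n => c * f n := fun n => by
  linear_combination c * h n

theorem IsSolution.sub (hf : J.IsSolution z f) (hg : J.IsSolution z g) :
    J.IsSolution z fun n => f n - g n := fun n => by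
  linear_combination hf n - hg n

theorem IsSolution.conj (h : J.IsSolution z f) :
    J.IsSolution (conj z) fun n => conj (f n) := fun n => by
  have := congrArg (starRingEnd ℂ) (h n)
  simpa using this

theorem IsSolution.eq_zero_of_consecutive (h : J.IsSolution z f) {n : ℤ} (h0 : f n = 0)
    (h1 : f (n + 1) = 0) : f = 0 := by
  have hall : ∀ m : ℤ, f m = 0 ∧ f (m + 1) = 0 := by
    intro m
    induction m using Int.inductionOn' (b := n) with
    | zero => exact ⟨h0, h1⟩
    | succ k _ ih =>
      refine ⟨ih.2, ?_⟩
      have := h (k + 1)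
      rw [add_sub_cancel_right, ih.1, ih.2] at this
      simpa [J.a_ne_zero] using this
    | pred k _ ih =>
      rw [sub_add_cancel]
      refine ⟨?_, ih.1⟩
      have := h k
      rw [ih.1, ih.2] at this
      simpa [J.a_ne_zero] using this
  exact funext fun m => (hall m).1

/-- Minus the Wronskian of `conj f` and `f`, divided by `2 i`. -/
def flux (J : JacobiMatrix) (f : ℤ → ℂ) (n : ℤ) : ℝ := -(J.a n * (conj (f n) * f (n + 1)).im)

/-- Multiply the equation by conj (f n) and take imaginary parts; the real coefficient `b n` drops
out. All sign and summability arguments for Weyl solutions rest on this balance. -/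
theorem IsSolution.flux_eq (h : J.IsSolution z f) (n : ℤ) :
    J.flux f n = J.flux f (n - 1) - z.im * ‖f n‖ ^ 2 := by
  have h1 := congrArg (fun w => (conj (f n) * w).im) (h n)
  simp only [flux, sub_add_cancel]
  rw [← Complex.normSq_eq_norm_sq, Complex.normSq_apply]
  simp only [Complex.mul_im, Complex.mul_re, Complex.add_re, Complex.add_im, Complex.conj_re,
    Complex.conj_im, Complex.ofReal_re, Complex.ofReal_im] at h1 ⊢
  linear_combination -h1

theorem tendsto_norm_zero_of_summable_sq {f : ℕ → ℂ} (h : Summable fun n => ‖f n‖ ^ 2) :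
    Tendsto (fun n => ‖f n‖) atTop (𝓝 0) := by
  have h1 := h.tendsto_atTop_zero
  have h2 := (Real.continuous_sqrt.tendsto 0).comp h1
  simpa [Function.comp_def, Real.sqrt_sq (norm_nonneg _)] using h2

theorem abs_flux_le (J : JacobiMatrix) :
    ∃ C, ∀ (f : ℤ → ℂ) (n : ℤ), |J.flux f n| ≤ C * (‖f n‖ * ‖f (n + 1)‖) := by
  obtain ⟨C, hC⟩ := J.a_bdd
  refine ⟨C, fun f n => ?_⟩
  rw [flux, abs_neg, abs_mul]
  refine mul_le_mul (hC n) ?_ (abs_nonneg _) ((abs_nonneg _).trans (hC 0))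
  refine (Complex.abs_im_le_norm _).trans ?_
  rw [norm_mul, RCLike.norm_conj]

theorem tendsto_flux_plus (J : JacobiMatrix) (h : Summable fun n : ℕ => ‖f (n : ℤ)‖ ^ 2) :
    Tendsto (fun n : ℕ => J.flux f n) atTop (𝓝 0) := by
  obtain ⟨C, hC⟩ := J.abs_flux_le
  have h1 := tendsto_norm_zero_of_summable_sq h
  have h2 : Tendsto (fun n : ℕ => ‖f ((n : ℤ) + 1)‖) atTop (𝓝 0) := by
    refine (h1.comp (tendsto_add_atTop_nat 1)).congr fun n => ?_
    simp only [Function.comp_apply, Nat.cast_add, Nat.cast_one]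
  refine squeeze_zero_norm (fun n => hC f n) ?_
  simpa using (h1.mul h2).const_mul C

theorem tendsto_flux_minus (J : JacobiMatrix) (h : Summable fun n : ℕ => ‖f (-(n : ℤ))‖ ^ 2) :
    Tendsto (fun n : ℕ => J.flux f (-(n : ℤ) - 1)) atTop (𝓝 0) := by
  obtain ⟨C, hC⟩ := J.abs_flux_le
  have h1 := tendsto_norm_zero_of_summable_sq h
  have h2 : Tendsto (fun n : ℕ => ‖f (-(n : ℤ) - 1)‖) atTop (𝓝 0) := by
    refine (h1.comp (tendsto_add_atTop_nat 1)).congr fun n => ?_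
    simp only [Function.comp_apply, Nat.cast_add, Nat.cast_one, neg_add, sub_eq_add_neg]
  refine squeeze_zero_norm (fun n => hC f (-(n : ℤ) - 1)) ?_
  simp only [sub_add_cancel]
  simpa using (h2.mul h1).const_mul C

/-- The flux decreases in n and tends to 0 at +∞ by square summability. -/
theorem IsWeylPlus.flux_nonneg (hz : 0 < z.im) (h : J.IsWeylPlus z f) (n : ℤ) :
    0 ≤ J.flux f n := by
  have hanti : Antitone (J.flux f) := antitone_int_of_succ_le fun n => by
    rw [h.1.flux_eq (n + 1), add_sub_cancel_right]
    have := mul_nonneg hz.le (sq_nonneg ‖f (n + 1)‖)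
    linarith
  refine le_of_tendsto (J.tendsto_flux_plus h.2.2) ?_
  filter_upwards [eventually_ge_atTop n.toNat] with k hk
  exact hanti (by omega)

/-- If the flux vanished at n, it could not decrease any further without becoming negative. Then f
(n+1) = f (n+2) = 0 and f would be trivial. -/
theorem IsWeylPlus.flux_pos (hz : 0 < z.im) (h : J.IsWeylPlus z f) (n : ℤ) :
    0 < J.flux f n := by
  refine lt_of_le_of_ne (h.flux_nonneg hz n) fun h0 => h.2.1 ?_
  have e1 := h.1.flux_eq (n + 1)
  have e2 := h.1.flux_eq (n + 1 + 1)
  rw [add_sub_cancel_right] at e1 e2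
  have p1 := h.flux_nonneg hz (n + 1)
  have p2 := h.flux_nonneg hz (n + 1 + 1)
  have q1 := mul_nonneg hz.le (sq_nonneg ‖f (n + 1)‖)
  have q2 := mul_nonneg hz.le (sq_nonneg ‖f (n + 1 + 1)‖)
  have z1 : z.im * ‖f (n + 1)‖ ^ 2 = 0 := by linarith
  have z2 : z.im * ‖f (n + 1 + 1)‖ ^ 2 = 0 := by linarith
  exact h.1.eq_zero_of_consecutive (by simpa [hz.ne'] using z1) (by simpa [hz.ne'] using z2)

theorem IsWeylMinus.flux_nonpos (hz : 0 < z.im) (h : J.IsWeylMinus z f) (n : ℤ) :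
    J.flux f n ≤ 0 := by
  have hanti : Antitone (J.flux f) := antitone_int_of_succ_le fun n => by
    rw [h.1.flux_eq (n + 1), add_sub_cancel_right]
    have := mul_nonneg hz.le (sq_nonneg ‖f (n + 1)‖)
    linarith
  refine ge_of_tendsto (J.tendsto_flux_minus h.2.2) ?_
  filter_upwards [eventually_ge_atTop (-n).toNat] with k hk
  exact hanti (by omega)

theorem IsWeylMinus.flux_neg (hz : 0 < z.im) (h : J.IsWeylMinus z f) (n : ℤ) :
    J.flux f n < 0 := by
  refine lt_of_le_of_ne (h.flux_nonpos hz n) fun h0 => h.2.1 ?_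
  have e1 := h.1.flux_eq n
  have e2 := h.1.flux_eq (n - 1)
  have p1 := h.flux_nonpos hz (n - 1)
  have p2 := h.flux_nonpos hz (n - 1 - 1)
  have q1 := mul_nonneg hz.le (sq_nonneg ‖f n‖)
  have q2 := mul_nonneg hz.le (sq_nonneg ‖f (n - 1)‖)
  have z1 : z.im * ‖f n‖ ^ 2 = 0 := by linarith
  have z2 : z.im * ‖f (n - 1)‖ ^ 2 = 0 := by linarith
  exact h.1.eq_zero_of_consecutive (n := n - 1) (by simpa [hz.ne'] using z2)
    (by simpa [hz.ne'] using z1)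

theorem ne_zero_of_flux_ne_zero {n : ℤ} (h : J.flux f n ≠ 0) : f n ≠ 0 ∧ f (n + 1) ≠ 0 := by
  constructor <;> intro h0 <;> simp [flux, h0] at h

/-- Links the sign of the flux with the sign of Im m; this is the source of the Herglotz property of
m₊ and m₋. -/
theorem im_neg_div_eq_flux {n : ℤ} (h : f n ≠ 0) :
    (-(f (n + 1) / (J.a n * f n))).im = J.flux f n / (J.a n ^ 2 * ‖f n‖ ^ 2) := by
  have h1 : f (n + 1) / (J.a n * f n) = ((J.a n / (J.a n ^ 2 * ‖f n‖ ^ 2) : ℝ) : ℂ) *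
      (conj (f n) * f (n + 1)) := by
    have h2 : (‖f n‖ : ℂ) ^ 2 = f n * conj (f n) := by
      rw [Complex.mul_conj, Complex.normSq_eq_norm_sq]
      norm_cast
    have h3 := J.a_ne_zero n
    have h4 : conj (f n) ≠ 0 := by simpa using h
    push_cast
    rw [h2]
    field_simp
  rw [h1, Complex.neg_im, Complex.im_ofReal_mul, flux]
  ring

theorem summable_sq_sub_mul {u v : ℕ → ℂ} (hu : Summable fun n => ‖u n‖ ^ 2)
    (hv : Summable fun n => ‖v n‖ ^ 2) (c d : ℂ) :
    Summable fun n => ‖c * u n - d * v n‖ ^ 2 := by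
  refine Summable.of_nonneg_of_le (fun n => sq_nonneg _) (fun n => ?_)
    ((hu.mul_left (2 * ‖c‖ ^ 2)).add (hv.mul_left (2 * ‖d‖ ^ 2)))
  have h1 := norm_sub_le (c * u n) (d * v n)
  rw [norm_mul, norm_mul] at h1
  have h2 := pow_le_pow_left₀ (norm_nonneg _) h1 2
  nlinarith [sq_nonneg (‖c‖ * ‖u n‖ - ‖d‖ * ‖v n‖)]

/-- The combination of f and g that vanishes at n has zero flux there, so it cannot be a nontrivial
Weyl solution. Hence m₊ does not depend on the choice made in `fPlus`. -/
theorem IsWeylPlus.ratio_unique (hz : 0 < z.im) (hf : J.IsWeylPlus z f) (hg : J.IsWeylPlus z g)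
    (n : ℤ) : f (n + 1) / (J.a n * f n) = g (n + 1) / (J.a n * g n) := by
  have hf0 := ne_zero_of_flux_ne_zero (hf.flux_pos hz n).ne'
  have hg0 := ne_zero_of_flux_ne_zero (hg.flux_pos hz n).ne'
  have hzero : (fun k => g n * f k - f n * g k) = 0 := by
    by_contra hne
    have hw : J.IsWeylPlus z fun k => g n * f k - f n * g k :=
      ⟨(hf.1.const_smul (g n)).sub (hg.1.const_smul (f n)), hne,
        summable_sq_sub_mul hf.2.2 hg.2.2 _ _⟩
    exact (ne_zero_of_flux_ne_zero (hw.flux_pos hz n).ne').1 (by ring)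
  have h1 : g n * f (n + 1) - f n * g (n + 1) = 0 := congrFun hzero (n + 1)
  have := J.a_ne_zero n
  rw [div_eq_div_iff (mul_ne_zero this hf0.1) (mul_ne_zero this hg0.1)]
  linear_combination (J.a n : ℂ) * h1

theorem IsWeylMinus.ratio_unique (hz : 0 < z.im) (hf : J.IsWeylMinus z f)
    (hg : J.IsWeylMinus z g) (n : ℤ) :
    f (n + 1) / (J.a n * f n) = g (n + 1) / (J.a n * g n) := by
  have hf0 := ne_zero_of_flux_ne_zero (hf.flux_neg hz n).ne
  have hg0 := ne_zero_of_flux_ne_zero (hg.flux_neg hz n).ne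
  have hzero : (fun k => g n * f k - f n * g k) = 0 := by
    by_contra hne
    have hw : J.IsWeylMinus z fun k => g n * f k - f n * g k :=
      ⟨(hf.1.const_smul (g n)).sub (hg.1.const_smul (f n)), hne,
        summable_sq_sub_mul hf.2.2 hg.2.2 _ _⟩
    exact (ne_zero_of_flux_ne_zero (hw.flux_neg hz n).ne).1 (by ring)
  have h1 : g n * f (n + 1) - f n * g (n + 1) = 0 := congrFun hzero (n + 1)
  have := J.a_ne_zero n
  rw [div_eq_div_iff (mul_ne_zero this hf0.1) (mul_ne_zero this hg0.1)]
  linear_combination (J.a n : ℂ) * h1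

theorem mPlus_eq_of_isWeylPlus (hz : 0 < z.im) (hf : J.IsWeylPlus z f) :
    J.mPlus z = -(f 1 / (J.a 0 * f 0)) := by
  have h : J.IsWeylPlus z (J.fPlus z) := Classical.epsilon_spec ⟨f, hf⟩
  rw [mPlus]
  congr 1
  simpa using h.ratio_unique hz hf 0

theorem mMinus_eq_of_isWeylMinus (hz : 0 < z.im) (hf : J.IsWeylMinus z f) :
    J.mMinus z = f 1 / (J.a 0 * f 0) := by
  have h : J.IsWeylMinus z (J.fMinus z) := Classical.epsilon_spec ⟨f, hf⟩
  rw [mMinus]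
  simpa using h.ratio_unique hz hf 0

end JacobiMatrix

/-! ### Symmetry of the operator, compressions and Green vectors -/

section Shift

theorem weightedShift_apply (c : ℤ → ℝ) (hc : ∃ C, ∀ n, |c n| ≤ C) (k : ℤ) (u : SeqSpace)
    (n : ℤ) : weightedShift c hc k u n = c n * u (n + k) := rfl

theorem inner_weightedShift (c d : ℤ → ℝ) (hc : ∃ C, ∀ n, |c n| ≤ C)
    (hd : ∃ C, ∀ n, |d n| ≤ C) (k : ℤ) (hcd : ∀ n, d n = c (n - k)) (u v : SeqSpace) :
    inner ℂ (weightedShift c hc k u) v = inner ℂ u (weightedShift d hd (-k) v) := by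
  rw [lp.inner_eq_tsum, lp.inner_eq_tsum, ← (Equiv.subRight k).tsum_eq]
  refine tsum_congr fun n => ?_
  simp only [Equiv.subRight_apply, weightedShift_apply, sub_add_cancel, hcd n, RCLike.inner_apply,
    map_mul, Complex.conj_ofReal, ← sub_eq_add_neg]
  ring

end Shift

namespace JacobiMatrix

variable (J : JacobiMatrix)

theorem inner_toCLM (u v : SeqSpace) : inner ℂ (J.toCLM u) v = inner ℂ u (J.toCLM v) := by
  simp only [toCLM, add_apply, inner_add_left, inner_add_right]
  rw [inner_weightedShift J.a (fun n => J.a (n - 1)) J.a_bdd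
      (J.a_bdd.imp fun _ h n => h (n - 1)) 1 (fun n => rfl),
    inner_weightedShift (fun n => J.a (n - 1)) J.a (J.a_bdd.imp fun _ h n => h (n - 1))
      J.a_bdd (-1) (fun n => by simp),
    inner_weightedShift J.b J.b J.b_bdd J.b_bdd 0 (fun n => by simp)]
  simp only [neg_neg, neg_zero]
  ring

end JacobiMatrix

/-- The orthogonal projection onto the sequences supported in `s`. -/
def proj (s : Set ℤ) : SeqSpace →L[ℂ] SeqSpace :=
  weightedShift (s.indicator 1) ⟨1, fun n => by
    by_cases h : n ∈ s <;> simp [h]⟩ 0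

theorem proj_apply_of_mem {s : Set ℤ} {n : ℤ} (h : n ∈ s) (u : SeqSpace) :
    proj s u n = u n := by
  simp [proj, weightedShift_apply, h]

theorem proj_apply_of_notMem {s : Set ℤ} {n : ℤ} (h : n ∉ s) (u : SeqSpace) :
    proj s u n = 0 := by
  simp [proj, weightedShift_apply, h]

theorem inner_proj (s : Set ℤ) (u v : SeqSpace) :
    inner ℂ (proj s u) v = inner ℂ u (proj s v) := by
  rw [proj, inner_weightedShift _ (s.indicator 1) _ ⟨1, fun n => by
    by_cases h : n ∈ s <;> simp [h]⟩ 0 (fun n => by simp)]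
  simp only [neg_zero]

theorem norm_proj_apply_le (s : Set ℤ) (u : SeqSpace) : ‖proj s u‖ ≤ ‖u‖ := by
  have h2 : (0 : ℝ) < (2 : ℝ≥0∞).toReal := by norm_num
  refine lp.norm_le_of_forall_sum_le h2 (norm_nonneg _) fun t => ?_
  refine le_trans (Finset.sum_le_sum fun n _ => ?_) (lp.sum_rpow_le_norm_rpow h2 u t)
  by_cases h : n ∈ s
  · rw [proj_apply_of_mem h]
  · rw [proj_apply_of_notMem h, norm_zero]
    rw [Real.zero_rpow h2.ne']
    positivity

namespace JacobiMatrix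

variable (J : JacobiMatrix)

/-- The compression of the Jacobi matrix to the sequences supported in `s`. -/
def compress (s : Set ℤ) : SeqSpace →L[ℂ] SeqSpace := proj s ∘L J.toCLM ∘L proj s

theorem compress_apply (s : Set ℤ) (u : SeqSpace) :
    J.compress s u = proj s (J.toCLM (proj s u)) := rfl

theorem inner_compress (s : Set ℤ) (u v : SeqSpace) :
    inner ℂ (J.compress s u) v = inner ℂ u (J.compress s v) := by
  rw [compress_apply, compress_apply, inner_proj, inner_toCLM, inner_proj]

theorem isSelfAdjoint_compress (s : Set ℤ) : IsSelfAdjoint (J.compress s) :=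
  ContinuousLinearMap.isSelfAdjoint_iff_isSymmetric.mpr fun u v => J.inner_compress s u v

theorem norm_compress_le (s : Set ℤ) : ‖J.compress s‖ ≤ ‖J.toCLM‖ := by
  refine ContinuousLinearMap.opNorm_le_bound _ (norm_nonneg _) fun u => ?_
  rw [compress_apply]
  exact (norm_proj_apply_le s _).trans ((J.toCLM.le_opNorm _).trans
    (mul_le_mul_of_nonneg_left (norm_proj_apply_le s u) (norm_nonneg _)))

/-- Spectral parameters that are not real or lie outside the disc of radius `‖J‖`. -/
def Regular (z : ℂ) : Prop := z.im ≠ 0 ∨ ‖J.toCLM‖ < ‖z‖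

variable {J} {z : ℂ}

theorem Regular.ne_zero (h : J.Regular z) : z ≠ 0 := by
  rintro rfl
  rcases h with h | h
  · simp at h
  · rw [norm_zero] at h
    exact absurd h (not_lt.mpr (norm_nonneg _))

theorem Regular.mem_resolventSet (h : J.Regular z) (s : Set ℤ) :
    z ∈ resolventSet ℂ (J.compress s) := by
  rcases h with h | h
  · by_contra hz
    exact h ((J.isSelfAdjoint_compress s).im_eq_zero_of_mem_spectrum hz)
  · have : Nontrivial SeqSpace := ⟨lp.single 2 0 (1 : ℂ), 0, fun h0 => by
      have h1 := congrArg (fun u : SeqSpace => u 0) h0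
      simp at h1⟩
    exact spectrum.mem_resolventSet_of_norm_lt ((J.norm_compress_le s).trans_lt h)

variable (J)

/-- The vector `(z - J_s)⁻¹ δ_k`, where `J_s` is the compression of `J` to `s`. -/
def green (s : Set ℤ) (k : ℤ) (z : ℂ) : SeqSpace :=
  resolvent (J.compress s) z (lp.single 2 k (1 : ℂ))

variable {J}

theorem green_eq (h : J.Regular z) (s : Set ℤ) (k : ℤ) :
    z • J.green s k z - J.compress s (J.green s k z) = lp.single 2 k (1 : ℂ) := by
  have h1 : (algebraMap ℂ (SeqSpace →L[ℂ] SeqSpace) z - J.compress s) *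
      resolvent (J.compress s) z = 1 := by
    rw [resolvent]
    exact Ring.mul_inverse_cancel _ (h.mem_resolventSet s)
  have h2 := congrArg (fun T : SeqSpace →L[ℂ] SeqSpace => T (lp.single 2 k (1 : ℂ))) h1
  simpa [green, Algebra.algebraMap_eq_smul_one] using h2

theorem green_apply_eq (h : J.Regular z) (s : Set ℤ) (k n : ℤ) :
    z * J.green s k z n - J.compress s (J.green s k z) n = if n = k then 1 else 0 := by
  have := congrArg (fun u : SeqSpace => u n) (green_eq h s k)
  simp only [lp.coeFn_sub, lp.coeFn_smul, Pi.sub_apply, Pi.smul_apply, smul_eq_mul,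
    lp.single_apply] at this
  rw [this, Pi.single_apply]

/-- The compression acts on the whole space and is zero off `s`, so there the resolvent equation
reads z · (value) = 0. This is why `Regular` must exclude z = 0. -/
theorem green_apply_of_notMem (h : J.Regular z) {s : Set ℤ} {k n : ℤ} (hk : k ∈ s) (hn : n ∉ s) :
    J.green s k z n = 0 := by
  have h1 := green_apply_eq h s k n
  have hne : n ≠ k := fun e => hn (e ▸ hk)
  rw [compress_apply, proj_apply_of_notMem hn, if_neg hne, sub_zero] at h1
  exact (mul_eq_zero.mp h1).resolve_left h.ne_zero

theorem proj_green (h : J.Regular z) {s : Set ℤ} {k : ℤ} (hk : k ∈ s) :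
    proj s (J.green s k z) = J.green s k z := by
  ext n
  by_cases hn : n ∈ s
  · rw [proj_apply_of_mem hn]
  · rw [proj_apply_of_notMem hn, green_apply_of_notMem h hk hn]

theorem green_apply_of_mem (h : J.Regular z) {s : Set ℤ} {k n : ℤ} (hk : k ∈ s) (hn : n ∈ s) :
    z * J.green s k z n = J.a n * J.green s k z (n + 1) + J.a (n - 1) * J.green s k z (n - 1)
      + J.b n * J.green s k z n + if n = k then 1 else 0 := by
  rw [← green_apply_eq h s k n, compress_apply, proj_apply_of_mem hn, proj_green h hk,
    toCLM_apply]
  ring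

theorem differentiableAt_green (h : J.Regular z) (s : Set ℤ) (k n : ℤ) :
    DifferentiableAt ℂ (fun z => J.green s k z n) z := by
  have h1 := (spectrum.hasDerivAt_resolvent_const_left (h.mem_resolventSet s)).differentiableAt
  have h2 : DifferentiableAt ℂ (fun z => resolvent (J.compress s) z (lp.single 2 k (1 : ℂ))) z :=
    h1.clm_apply (differentiableAt_const _)
  exact ((lp.evalCLM ℂ (fun _ : ℤ => ℂ) 2 n).differentiableAt).comp z h2

theorem inner_green (s : Set ℤ) (k : ℤ) :
    inner ℂ (J.green s k z) (lp.single 2 k (1 : ℂ)) = conj (J.green s k z k) := by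
  rw [lp.inner_single_right]
  simp

theorem im_green_real {E : ℝ} (h : J.Regular E) (s : Set ℤ) (k : ℤ) :
    (J.green s k E k).im = 0 := by
  have h1 := J.inner_green (z := (E : ℂ)) s k
  rw [← green_eq h s k, inner_sub_right, inner_smul_right] at h1
  have h2 := congrArg Complex.im h1
  have h3 : (inner ℂ (J.green s k E) (J.compress s (J.green s k E))).im = 0 := by
    have := (ContinuousLinearMap.isSelfAdjoint_iff_isSymmetric.mp
      (J.isSelfAdjoint_compress s)).im_inner_self_apply (J.green s k E)
    simpa using this
  have h4 : (inner ℂ (J.green s k E) (J.green s k E)).im = 0 := inner_self_im (𝕜 := ℂ) _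
  simp only [Complex.sub_im, Complex.mul_im, h3, h4, Complex.conj_im, Complex.ofReal_im] at h2
  simp only [mul_zero, zero_mul, add_zero, sub_zero] at h2
  linarith

theorem abs_re_inner_le (T : SeqSpace →L[ℂ] SeqSpace) (u : SeqSpace) :
    |(inner ℂ u (T u)).re| ≤ ‖T‖ * ‖u‖ ^ 2 := by
  refine (Complex.abs_re_le_norm _).trans ((norm_inner_le_norm _ _).trans ?_)
  have := mul_le_mul_of_nonneg_left (T.le_opNorm u) (norm_nonneg u)
  linarith [this]

theorem re_inner_sub {E : ℝ} (T : SeqSpace →L[ℂ] SeqSpace) (u : SeqSpace) :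
    (inner ℂ u ((E : ℂ) • u - T u)).re = E * ‖u‖ ^ 2 - (inner ℂ u (T u)).re := by
  rw [inner_sub_right, inner_smul_right, inner_self_eq_norm_sq_to_K]
  simp [← Complex.ofReal_pow]

/-- The quadratic form of `E - T` is definite, with the sign of `E`, if `‖T‖ < |E|`. -/
theorem mul_re_inner_sub_pos {E : ℝ} {T : SeqSpace →L[ℂ] SeqSpace} (hE : ‖T‖ < |E|)
    {u : SeqSpace} (hu : u ≠ 0) : 0 < E * (inner ℂ u ((E : ℂ) • u - T u)).re := by
  rw [re_inner_sub]
  have h1 := abs_le.mp (abs_re_inner_le T u)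
  have h2 : 0 < ‖u‖ ^ 2 := by positivity
  have h3 : ‖T‖ * ‖u‖ ^ 2 < |E| * ‖u‖ ^ 2 := mul_lt_mul_of_pos_right hE h2
  have h0 := norm_nonneg T
  rcases abs_cases E with ⟨h, h'⟩ | ⟨h, h'⟩ <;> rw [h] at h3 hE
  · exact mul_pos (h0.trans_lt hE) (by linarith [h1.2])
  · exact mul_pos_of_neg_of_neg h' (by linarith [h1.1])

theorem green_ne_zero (h : J.Regular z) (s : Set ℤ) (k : ℤ) : J.green s k z ≠ 0 := by
  intro h0
  have := green_apply_eq h s k k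
  rw [h0] at this
  simp at this

/-- Up to conjugation the diagonal Green entry is the quadratic form of E minus the compression at
the Green vector, and that form is definite. -/
theorem green_real_ne_zero {E : ℝ} (h : ‖J.toCLM‖ < |E|) (s : Set ℤ) (k : ℤ) :
    J.green s k E k ≠ 0 := by
  have hreg : J.Regular E := Or.inr (by simpa using h)
  have h1 := mul_re_inner_sub_pos ((J.norm_compress_le s).trans_lt h) (green_ne_zero hreg s k)
  rw [green_eq hreg, inner_green] at h1
  intro h0
  rw [h0] at h1
  simp at h1

end JacobiMatrix

theorem summable_sq_seqSpace (u : SeqSpace) : Summable fun n : ℤ => ‖u n‖ ^ 2 := by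
  have h2 : (0 : ℝ) < (2 : ℝ≥0∞).toReal := by norm_num
  simpa using (lp.memℓp u).summable h2

/-! ### Existence of Weyl solutions, Riccati equations and bounds for the m functions -/

namespace JacobiMatrix

variable {J J' : JacobiMatrix} {z : ℂ} {f g : ℤ → ℂ}

/-- The recursion for g is required only at n > 0, so that g may be a half line Green vector with an
altered value at 0. -/
theorem IsSolution.eq_on_nonneg (hf : J.IsSolution z f) (h0 : f 0 = g 0) (h1 : f 1 = g 1)
    (hg : ∀ n : ℤ, 0 < n → (J.a n : ℂ) * g (n + 1) + J.a (n - 1) * g (n - 1) + J.b n * g n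
      = z * g n) (n : ℕ) : f n = g n ∧ f (n + 1) = g (n + 1) := by
  induction n with
  | zero => exact ⟨by simpa using h0, by simpa using h1⟩
  | succ k ih =>
    push_cast
    refine ⟨ih.2, ?_⟩
    have e1 := hf (k + 1)
    have e2 := hg (k + 1) (by omega)
    rw [add_sub_cancel_right] at e1 e2
    rw [ih.1, ih.2] at e1
    refine mul_left_cancel₀ (J.a_ne_zero (k + 1)) ?_
    linear_combination e1 - e2

theorem IsSolution.eq_on_nonpos (hf : J.IsSolution z f) (h0 : f 0 = g 0) (h1 : f 1 = g 1)
    (hg : ∀ n : ℤ, n ≤ 0 → (J.a n : ℂ) * g (n + 1) + J.a (n - 1) * g (n - 1) + J.b n * g n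
      = z * g n) (n : ℕ) : f (-n) = g (-n) ∧ f (-n + 1) = g (-n + 1) := by
  induction n with
  | zero => exact ⟨by simpa using h0, by simpa using h1⟩
  | succ k ih =>
    have e : -((k + 1 : ℕ) : ℤ) = -(k : ℤ) - 1 := by push_cast; ring
    rw [e, sub_add_cancel]
    refine ⟨?_, ih.1⟩
    have e1 := hf (-k)
    have e2 := hg (-k) (by omega)
    rw [ih.1, ih.2] at e1
    refine mul_left_cancel₀ (J.a_ne_zero (-k - 1)) ?_
    linear_combination e1 - e2

theorem Regular.of_im_pos (hz : 0 < z.im) : J.Regular z := Or.inl hz.ne'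

/-- Multiply the Green vector of the right half line by a₀ and put the value 1 at site 0. The source
term at site 1 then plays the role of a₀ f(0), so the equation holds at every n > 0, and square
summability is inherited. -/
theorem exists_isWeylPlus (J : JacobiMatrix) (hz : 0 < z.im) :
    ∃ f, J.IsWeylPlus z f ∧ f 0 = 1 ∧ f 1 = J.a 0 * J.green (Ioi 0) 1 z 1 := by
  obtain ⟨f, hf, hf0, hf1⟩ := J.exists_isSolution z 1 (J.a 0 * J.green (Ioi 0) 1 z 1)
  have hreg : J.Regular z := Regular.of_im_pos hz
  have h1s : (1 : ℤ) ∈ Ioi (0 : ℤ) := by simp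
  let g : ℤ → ℂ := fun n => if n = 0 then 1 else J.a 0 * J.green (Ioi 0) 1 z n
  have hg : ∀ n : ℤ, n ≠ 0 → g n = J.a 0 * J.green (Ioi 0) 1 z n := fun n hn => if_neg hn
  have hg0 : g 0 = 1 := if_pos rfl
  have hfg := hf.eq_on_nonneg (g := g) (by rw [hf0, hg0]) (by rw [hf1, hg 1 one_ne_zero])
    (fun n hn => by
      have e := green_apply_of_mem hreg h1s (n := n) hn
      rw [hg (n + 1) (by omega), hg n (by omega)]
      by_cases h1 : n = 1
      · subst h1
        have e0 := green_apply_of_notMem hreg h1s (n := 0) (by simp)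
        simp only [sub_self, hg0, e0, if_true] at e ⊢
        linear_combination -(J.a 0 : ℂ) * e
      · rw [hg (n - 1) (by omega)]
        rw [if_neg h1] at e
        linear_combination -(J.a 0 : ℂ) * e)
  refine ⟨f, ⟨hf, fun h => by simp [h] at hf0, ?_⟩, hf0, hf1⟩
  have hs := ((summable_sq_seqSpace (J.green (Ioi 0) 1 z)).comp_injective
    Nat.cast_injective).mul_left (‖(J.a 0 : ℂ)‖ ^ 2)
  refine (summable_nat_add_iff 1).mp (((summable_nat_add_iff 1).mpr hs).congr fun n => ?_)
  rw [(hfg (n + 1)).1, hg _ (by omega), norm_mul, mul_pow]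
  rfl

/-- Mirror image of `exists_isWeylPlus`: the source term at site 0 plays the role of a₀ f(1) with
f(1) = 1. -/
theorem exists_isWeylMinus (J : JacobiMatrix) (hz : 0 < z.im) :
    ∃ f, J.IsWeylMinus z f ∧ f 0 = J.a 0 * J.green (Iic 0) 0 z 0 ∧ f 1 = 1 := by
  obtain ⟨f, hf, hf0, hf1⟩ := J.exists_isSolution z (J.a 0 * J.green (Iic 0) 0 z 0) 1
  have hreg : J.Regular z := Regular.of_im_pos hz
  have h0s : (0 : ℤ) ∈ Iic (0 : ℤ) := by simp
  let g : ℤ → ℂ := fun n => if n = 1 then 1 else J.a 0 * J.green (Iic 0) 0 z n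
  have hg : ∀ n : ℤ, n ≠ 1 → g n = J.a 0 * J.green (Iic 0) 0 z n := fun n hn => if_neg hn
  have hg1 : g 1 = 1 := if_pos rfl
  have hfg := hf.eq_on_nonpos (g := g) (by rw [hf0, hg 0 (by omega)]) (by rw [hf1, hg1])
    (fun n hn => by
      have e := green_apply_of_mem hreg h0s (n := n) hn
      rw [hg (n - 1) (by omega), hg n (by omega)]
      by_cases h1 : n = 0
      · subst h1
        have e0 := green_apply_of_notMem hreg h0s (n := 1) (by simp)
        simp only [zero_add, hg1, e0, if_true] at e ⊢
        linear_combination -(J.a 0 : ℂ) * e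
      · rw [hg (n + 1) (by omega)]
        rw [if_neg h1] at e
        linear_combination -(J.a 0 : ℂ) * e)
  refine ⟨f, ⟨hf, fun h => by simp [h] at hf1, ?_⟩, hf0, hf1⟩
  have hs := ((summable_sq_seqSpace (J.green (Iic 0) 0 z)).comp_injective
    (neg_injective.comp Nat.cast_injective)).mul_left (‖(J.a 0 : ℂ)‖ ^ 2)
  refine hs.congr fun n => ?_
  rw [(hfg n).1, hg _ (by omega), norm_mul, mul_pow]
  rfl

theorem mPlus_eq_green (J : JacobiMatrix) (hz : 0 < z.im) :
    J.mPlus z = -J.green (Ioi 0) 1 z 1 := by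
  obtain ⟨f, hf, h0, h1⟩ := J.exists_isWeylPlus hz
  rw [mPlus_eq_of_isWeylPlus hz hf, h0, h1, mul_one, mul_div_cancel_left₀ _ (J.a_ne_zero 0)]

theorem mMinus_eq_green (J : JacobiMatrix) (hz : 0 < z.im) :
    J.mMinus z = 1 / ((J.a 0 : ℂ) ^ 2 * J.green (Iic 0) 0 z 0) := by
  obtain ⟨f, hf, h0, h1⟩ := J.exists_isWeylMinus hz
  rw [mMinus_eq_of_isWeylMinus hz hf, h0, h1]
  ring

theorem isWeylPlus_fPlus (J : JacobiMatrix) (hz : 0 < z.im) : J.IsWeylPlus z (J.fPlus z) :=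
  Classical.epsilon_spec ((J.exists_isWeylPlus hz).imp fun _ h => h.1)

theorem isWeylMinus_fMinus (J : JacobiMatrix) (hz : 0 < z.im) : J.IsWeylMinus z (J.fMinus z) :=
  Classical.epsilon_spec ((J.exists_isWeylMinus hz).imp fun _ h => h.1)

theorem green_minus_ne_zero (J : JacobiMatrix) (hz : 0 < z.im) :
    J.green (Iic 0) 0 z 0 ≠ 0 := by
  obtain ⟨f, hf, h0, -⟩ := J.exists_isWeylMinus hz
  have := (ne_zero_of_flux_ne_zero (hf.flux_neg hz 0).ne).1
  rw [h0] at this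
  exact right_ne_zero_of_mul this

/-- The `m` function `m₊` of the half line to the right of `n`. -/
def mPlusAt (J : JacobiMatrix) (n : ℤ) (z : ℂ) : ℂ :=
  -(J.fPlus z (n + 1) / (J.a n * J.fPlus z n))

/-- The `m` function `m₋` at the site `n`. -/
def mMinusAt (J : JacobiMatrix) (n : ℤ) (z : ℂ) : ℂ :=
  J.fMinus z (n + 1) / (J.a n * J.fMinus z n)

theorem mPlusAt_zero (J : JacobiMatrix) : J.mPlusAt 0 = J.mPlus := rfl

theorem mMinusAt_zero (J : JacobiMatrix) : J.mMinusAt 0 = J.mMinus := rfl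

theorem im_mPlusAt_pos (J : JacobiMatrix) (n : ℤ) (hz : 0 < z.im) : 0 < (J.mPlusAt n z).im := by
  have hw := (J.isWeylPlus_fPlus hz).flux_pos hz n
  have hne := (ne_zero_of_flux_ne_zero hw.ne').1
  rw [mPlusAt, im_neg_div_eq_flux hne]
  have := J.a_pos n
  positivity

theorem im_mMinusAt_pos (J : JacobiMatrix) (n : ℤ) (hz : 0 < z.im) :
    0 < (J.mMinusAt n z).im := by
  have hw := (J.isWeylMinus_fMinus hz).flux_neg hz n
  have hne := (ne_zero_of_flux_ne_zero hw.ne).1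
  have h1 := im_neg_div_eq_flux (J := J) hne
  rw [Complex.neg_im] at h1
  have := J.a_pos n
  have h2 : J.flux (J.fMinus z) n / (J.a n ^ 2 * ‖J.fMinus z n‖ ^ 2) < 0 :=
    div_neg_of_neg_of_pos hw (by positivity)
  rw [mMinusAt]
  linarith

theorem IsSolution.riccati (hf : J.IsSolution z f) {n : ℤ} (h0 : f (n - 1) ≠ 0) (h1 : f n ≠ 0) :
    -(f n / (J.a (n - 1) * f (n - 1))) *
      (z - J.b n + (J.a n : ℂ) ^ 2 * -(f (n + 1) / (J.a n * f n))) = -1 := by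
  have h2 := J.a_ne_zero n
  have h3 := J.a_ne_zero (n - 1)
  have := hf n
  field_simp
  linear_combination this

theorem mPlusAt_riccati (J : JacobiMatrix) (n : ℤ) (hz : 0 < z.im) :
    J.mPlusAt (n - 1) z * (z - J.b n + (J.a n : ℂ) ^ 2 * J.mPlusAt n z) = -1 := by
  have hw := J.isWeylPlus_fPlus hz
  have := hw.1.riccati (ne_zero_of_flux_ne_zero (hw.flux_pos hz (n - 1)).ne').1
    (ne_zero_of_flux_ne_zero (hw.flux_pos hz n).ne').1
  simpa [mPlusAt] using this

theorem mMinusAt_riccati (J : JacobiMatrix) (n : ℤ) (hz : 0 < z.im) :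
    J.mMinusAt (n - 1) z * (z - J.b n - (J.a n : ℂ) ^ 2 * J.mMinusAt n z) = 1 := by
  have hw := J.isWeylMinus_fMinus hz
  have := hw.1.riccati (ne_zero_of_flux_ne_zero (hw.flux_neg hz (n - 1)).ne).1
    (ne_zero_of_flux_ne_zero (hw.flux_neg hz n).ne).1
  simp only [mMinusAt, sub_add_cancel]
  linear_combination -this

theorem norm_mul_im_le_one {u v : ℂ} {y : ℝ} (huv : u * v = -1) (hv : y ≤ v.im) :
    ‖u‖ * y ≤ 1 := by
  have h1 : ‖u‖ * ‖v‖ = 1 := by rw [← norm_mul, huv]; simp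
  have h2 : y ≤ ‖v‖ := hv.trans ((le_abs_self _).trans (Complex.abs_im_le_norm v))
  rw [← h1]
  gcongr

/-- In the Riccati equation at n + 1 the second factor has imaginary part at least Im z. -/
theorem norm_mPlusAt_le (J : JacobiMatrix) (n : ℤ) (hz : 0 < z.im) :
    ‖J.mPlusAt n z‖ * z.im ≤ 1 := by
  have h := J.mPlusAt_riccati (n + 1) hz
  rw [add_sub_cancel_right] at h
  refine norm_mul_im_le_one h ?_
  have := mul_nonneg (sq_nonneg (J.a (n + 1))) (J.im_mPlusAt_pos (n + 1) hz).le
  rw [Complex.add_im, Complex.sub_im, ← Complex.ofReal_pow, Complex.im_ofReal_mul,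
    Complex.ofReal_im]
  linarith

/-- The quantity z - b - a² m₋ at site n - 1 is the reciprocal of m₋ at n - 2, so its imaginary part
is not positive and a² m₋ at n - 1 has imaginary part at least Im z. The Riccati equation at n turns
this into the bound. -/
theorem norm_sub_mMinusAt_le (J : JacobiMatrix) (n : ℤ) (hz : 0 < z.im) :
    ‖z - J.b n - (J.a n : ℂ) ^ 2 * J.mMinusAt n z‖ * z.im ≤ (J.a (n - 1)) ^ 2 := by
  have h := J.mMinusAt_riccati n hz
  have h' := J.mMinusAt_riccati (n - 1) hz
  have hw : 0 ≤ ((1 / J.mMinusAt (n - 1 - 1) z) : ℂ).im * (-1) := by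
    rw [one_div, Complex.inv_im]
    have := J.im_mMinusAt_pos (n - 1 - 1) hz
    have h3 : 0 ≤ (J.mMinusAt (n - 1 - 1) z).im / Complex.normSq (J.mMinusAt (n - 1 - 1) z) :=
      div_nonneg this.le (Complex.normSq_nonneg _)
    rw [neg_div]
    linarith
  have hne : J.mMinusAt (n - 1 - 1) z ≠ 0 := left_ne_zero_of_mul (h' ▸ one_ne_zero)
  have h4 : 1 / J.mMinusAt (n - 1 - 1) z = z - J.b (n - 1) -
      (J.a (n - 1) : ℂ) ^ 2 * J.mMinusAt (n - 1) z := by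
    rw [div_eq_iff hne, ← h']
    ring
  have h5 : z.im ≤ ((J.a (n - 1) : ℂ) ^ 2 * J.mMinusAt (n - 1) z).im := by
    rw [h4] at hw
    simp only [Complex.sub_im, Complex.ofReal_im] at hw
    linarith
  have hapos := J.a_pos (n - 1)
  have h6 := norm_mul_im_le_one (u := -(z - J.b n - (J.a n : ℂ) ^ 2 * J.mMinusAt n z) /
    (J.a (n - 1) : ℂ) ^ 2) (v := (J.a (n - 1) : ℂ) ^ 2 * J.mMinusAt (n - 1) z) (by
      have := J.a_ne_zero (n - 1)
      field_simp
      linear_combination -h) h5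
  rw [norm_div, norm_neg, norm_pow, Complex.norm_real, Real.norm_of_nonneg hapos.le, div_mul_eq_mul_div,
    div_le_one (by positivity)] at h6
  exact h6

end JacobiMatrix

/-! ### The substitution z = -λ - 1/λ, and recovery of J from F -/

theorem im_joukowsky (l : ℂ) : (-l - 1 / l).im = l.im * (1 / Complex.normSq l - 1) := by
  simp only [Complex.sub_im, Complex.neg_im, one_div, Complex.inv_im]
  ring

/-- The two roots are l and 1/l, whose imaginary parts have opposite signs; a real root would make z
real. -/
theorem exists_joukowsky_eq {z : ℂ} (hz : z.im ≠ 0) : ∃ l : ℂ, 0 < l.im ∧ -l - 1 / l = z := by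
  obtain ⟨s, hs⟩ := IsAlgClosed.exists_pow_nat_eq (z ^ 2 - 4) (n := 2) (by norm_num)
  have hprod : (-z + s) / 2 * ((-z - s) / 2) = 1 := by linear_combination -hs / 4
  set l : ℂ := (-z + s) / 2 with hl
  have hl0 : l ≠ 0 := left_ne_zero_of_mul (hprod ▸ one_ne_zero)
  have hinv : 1 / l = (-z - s) / 2 := by
    rw [div_eq_iff hl0, ← hprod]
    ring
  have hjl : -l - 1 / l = z := by
    rw [hinv, hl]
    ring
  have him := im_joukowsky l
  rw [hjl] at him
  rcases lt_trichotomy l.im 0 with h | h | h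
  · refine ⟨1 / l, ?_, ?_⟩
    · rw [one_div, Complex.inv_im]
      exact div_pos (by linarith) (Complex.normSq_pos.mpr hl0)
    · rw [one_div_one_div, ← hjl]
      ring
  · rw [h, zero_mul] at him
    exact absurd him hz
  · exact ⟨l, h, hjl⟩

namespace JacobiMatrix

variable {J J' : JacobiMatrix} {z : ℂ}

theorem M_of_im_pos (J : JacobiMatrix) (hz : 0 < z.im) : J.M z = J.mPlus z := if_pos hz

theorem M_of_im_neg (J : JacobiMatrix) (hz : z.im < 0) :
    J.M z = -conj (J.mMinus (conj z)) := by
  rw [M, if_neg (not_lt.mpr hz.le), if_pos hz]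

theorem mPlus_eq_of_F_eq (h : ∀ l : ℂ, 0 < l.im → J.F l = J'.F l) (hz : 0 < z.im) :
    J.mPlus z = J'.mPlus z := by
  obtain ⟨l, hl, rfl⟩ := exists_joukowsky_eq hz.ne'
  rw [← M_of_im_pos J hz, ← M_of_im_pos J' hz]
  exact h l hl

theorem mMinus_eq_of_F_eq (h : ∀ l : ℂ, 0 < l.im → J.F l = J'.F l) (hz : 0 < z.im) :
    J.mMinus z = J'.mMinus z := by
  have hz' : (conj z).im < 0 := by simpa using hz
  obtain ⟨l, hl, he⟩ := exists_joukowsky_eq hz'.ne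
  have h1 := h l hl
  rw [F, F, he, M_of_im_neg J hz', M_of_im_neg J' hz', Complex.conj_conj] at h1
  exact (starRingEnd ℂ).injective (neg_injective h1)

section Asymptotics

theorem im_ofReal_mul_I (y : ℝ) : ((y : ℂ) * Complex.I).im = y := by simp

theorem tendsto_mPlusAt (J : JacobiMatrix) (n : ℤ) :
    Tendsto (fun y : ℝ => J.mPlusAt n (y * Complex.I)) atTop (𝓝 0) := by
  refine squeeze_zero_norm' ?_ tendsto_inv_atTop_zero
  filter_upwards [eventually_gt_atTop 0] with y hy
  have := J.norm_mPlusAt_le n (z := y * Complex.I) (by simpa using hy)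
  rw [im_ofReal_mul_I] at this
  rwa [← one_div, le_div_iff₀ hy]

theorem tendsto_mul_mPlusAt (J : JacobiMatrix) (n : ℤ) :
    Tendsto (fun y : ℝ => y * Complex.I * J.mPlusAt n (y * Complex.I)) atTop (𝓝 (-1)) := by
  have h1 := J.tendsto_mPlusAt n
  have h2 := J.tendsto_mPlusAt (n + 1)
  have h3 : Tendsto (fun y : ℝ => -1 + J.b (n + 1) * J.mPlusAt n (y * Complex.I) -
      (J.a (n + 1) : ℂ) ^ 2 * (J.mPlusAt n (y * Complex.I) * J.mPlusAt (n + 1) (y * Complex.I)))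
      atTop (𝓝 (-1)) := by
    simpa using ((h1.const_mul (J.b (n + 1) : ℂ)).const_add (-1)).sub
      ((h1.mul h2).const_mul ((J.a (n + 1) : ℂ) ^ 2))
  refine h3.congr' ?_
  filter_upwards [eventually_gt_atTop 0] with y hy
  have := J.mPlusAt_riccati (n + 1) (z := y * Complex.I) (by simpa using hy)
  rw [add_sub_cancel_right] at this
  linear_combination -this

theorem tendsto_sub_mMinusAt (J : JacobiMatrix) (n : ℤ) :
    Tendsto (fun y : ℝ => y * Complex.I - J.b n - (J.a n : ℂ) ^ 2 * J.mMinusAt n (y * Complex.I))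
      atTop (𝓝 0) := by
  have h0 : Tendsto (fun y : ℝ => J.a (n - 1) ^ 2 * y⁻¹) atTop (𝓝 0) := by
    simpa using tendsto_inv_atTop_zero.const_mul (J.a (n - 1) ^ 2)
  refine squeeze_zero_norm' ?_ h0
  filter_upwards [eventually_gt_atTop 0] with y hy
  have := J.norm_sub_mMinusAt_le n (z := y * Complex.I) (by simpa using hy)
  rw [im_ofReal_mul_I] at this
  rwa [← div_eq_mul_inv, le_div_iff₀ hy]

theorem tendsto_inv_mul_I :
    Tendsto (fun y : ℝ => ((y : ℂ) * Complex.I)⁻¹) atTop (𝓝 0) := by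
  have h1 : Tendsto (fun y : ℝ => ((y⁻¹ : ℝ) : ℂ)) atTop (𝓝 0) := by
    have := (Complex.continuous_ofReal.tendsto 0).comp (tendsto_inv_atTop_zero (𝕜 := ℝ))
    rwa [Complex.ofReal_zero] at this
  have h2 := h1.mul_const (Complex.I⁻¹)
  rw [zero_mul] at h2
  refine h2.congr fun y => ?_
  rw [mul_inv]
  push_cast
  rfl

theorem tendsto_mMinusAt_div (J : JacobiMatrix) (n : ℤ) :
    Tendsto (fun y : ℝ => J.mMinusAt n (y * Complex.I) * ((y : ℂ) * Complex.I)⁻¹)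
      atTop (𝓝 (1 / (J.a n : ℂ) ^ 2)) := by
  have ha := J.a_ne_zero n
  have h3 := (((J.tendsto_sub_mMinusAt n).add_const (J.b n : ℂ)).mul
    tendsto_inv_mul_I).const_sub 1
  rw [mul_zero, sub_zero] at h3
  refine (h3.const_mul (1 / (J.a n : ℂ) ^ 2)).congr' ?_ |>.trans (by rw [mul_one])
  filter_upwards [eventually_gt_atTop 0] with y hy
  have hy' : (y : ℂ) ≠ 0 := by exact_mod_cast hy.ne'
  have hI := Complex.I_ne_zero
  field_simp
  ring

end Asymptotics

theorem a_eq_of_sq_eq {n : ℤ} (h : (J.a n : ℂ) ^ 2 = (J'.a n : ℂ) ^ 2) : J.a n = J'.a n := by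
  have h1 : J.a n ^ 2 = J'.a n ^ 2 := by exact_mod_cast h
  exact (pow_left_inj₀ (J.a_pos n).le (J'.a_pos n).le two_ne_zero).mp h1

/-- The Riccati equation determines -b n + (a n)² m₊ at site n. Along z = iy → i∞, m₊ → 0 isolates
`b n`, and z m₊ → -1 isolates (a n)². -/
theorem right_step {n : ℤ} (h : ∀ z : ℂ, 0 < z.im → J.mPlusAt (n - 1) z = J'.mPlusAt (n - 1) z) :
    J.a n = J'.a n ∧ J.b n = J'.b n ∧
      ∀ z : ℂ, 0 < z.im → J.mPlusAt n z = J'.mPlusAt n z := by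
  have h1 : ∀ z : ℂ, 0 < z.im → z - J.b n + (J.a n : ℂ) ^ 2 * J.mPlusAt n z =
      z - J'.b n + (J'.a n : ℂ) ^ 2 * J'.mPlusAt n z := by
    intro z hz
    have e1 := J.mPlusAt_riccati n hz
    have e2 := J'.mPlusAt_riccati n hz
    rw [← h z hz] at e2
    have hne : J.mPlusAt (n - 1) z ≠ 0 := left_ne_zero_of_mul (e1 ▸ neg_ne_zero.mpr one_ne_zero)
    exact mul_left_cancel₀ hne (e1.trans e2.symm)
  have hb : (J.b n : ℂ) = J'.b n := by
    have t1 := ((J.tendsto_mPlusAt n).const_mul ((J.a n : ℂ) ^ 2)).sub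
      ((J'.tendsto_mPlusAt n).const_mul ((J'.a n : ℂ) ^ 2))
    rw [mul_zero, mul_zero, sub_zero] at t1
    have t2 : Tendsto (fun _ : ℝ => (J.b n : ℂ) - J'.b n) atTop (𝓝 0) := by
      refine t1.congr' ?_
      filter_upwards [eventually_gt_atTop 0] with y hy
      linear_combination h1 (y * Complex.I) (by simpa using hy)
    exact sub_eq_zero.mp (tendsto_nhds_unique tendsto_const_nhds t2)
  have h2 : ∀ z : ℂ, 0 < z.im → (J.a n : ℂ) ^ 2 * J.mPlusAt n z =
      (J'.a n : ℂ) ^ 2 * J'.mPlusAt n z := fun z hz => by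
    linear_combination h1 z hz + hb
  have ha : (J.a n : ℂ) ^ 2 = (J'.a n : ℂ) ^ 2 := by
    have t1 := (J.tendsto_mul_mPlusAt n).const_mul ((J.a n : ℂ) ^ 2)
    have t2 := (J'.tendsto_mul_mPlusAt n).const_mul ((J'.a n : ℂ) ^ 2)
    have t3 := tendsto_nhds_unique (t1.congr' ?_) t2
    · simpa using t3
    · filter_upwards [eventually_gt_atTop 0] with y hy
      linear_combination y * Complex.I * h2 (y * Complex.I) (by simpa using hy)
  refine ⟨a_eq_of_sq_eq ha, by exact_mod_cast hb, fun z hz => ?_⟩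
  have := h2 z hz
  rw [← ha] at this
  exact mul_left_cancel₀ (pow_ne_zero 2 (J.a_ne_zero n)) this

/-- Here m₋ ~ z/(a n)² gives `a n`, the limit of z - (a n)² m₋ gives `b n`, and the Riccati equation
then gives m₋ at n - 1. -/
theorem left_step {n : ℤ} (h : ∀ z : ℂ, 0 < z.im → J.mMinusAt n z = J'.mMinusAt n z) :
    J.a n = J'.a n ∧ J.b n = J'.b n ∧
      ∀ z : ℂ, 0 < z.im → J.mMinusAt (n - 1) z = J'.mMinusAt (n - 1) z := by
  have ha : (J.a n : ℂ) ^ 2 = (J'.a n : ℂ) ^ 2 := by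
    have t := tendsto_nhds_unique ((J.tendsto_mMinusAt_div n).congr' ?_)
      (J'.tendsto_mMinusAt_div n)
    · rwa [one_div, one_div, inv_inj] at t
    · filter_upwards [eventually_gt_atTop 0] with y hy
      rw [h (y * Complex.I) (by simpa using hy)]
  have hb : (J.b n : ℂ) = J'.b n := by
    have t1 := (J'.tendsto_sub_mMinusAt n).sub (J.tendsto_sub_mMinusAt n)
    rw [sub_zero] at t1
    have t2 : Tendsto (fun _ : ℝ => (J.b n : ℂ) - J'.b n) atTop (𝓝 0) := by
      refine t1.congr' ?_
      filter_upwards [eventually_gt_atTop 0] with y hy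
      rw [h (y * Complex.I) (by simpa using hy), ha]
      ring
    exact sub_eq_zero.mp (tendsto_nhds_unique tendsto_const_nhds t2)
  refine ⟨a_eq_of_sq_eq ha, by exact_mod_cast hb, fun z hz => ?_⟩
  have e1 := J.mMinusAt_riccati n hz
  have e2 := J'.mMinusAt_riccati n hz
  rw [← h z hz, ← ha, ← hb] at e2
  have hne := right_ne_zero_of_mul (e1 ▸ one_ne_zero)
  exact mul_right_cancel₀ hne (e1.trans e2.symm)

/-- A bounded Jacobi matrix is determined by its function `F`. -/
theorem eq_of_F_eq (h : ∀ l : ℂ, 0 < l.im → J.F l = J'.F l) : J = J' := by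
  have hp : ∀ k : ℕ, ∀ z : ℂ, 0 < z.im → J.mPlusAt k z = J'.mPlusAt k z := by
    intro k
    induction k with
    | zero => exact fun z hz => mPlus_eq_of_F_eq h hz
    | succ k ih =>
      have := right_step (J := J) (J' := J') (n := k + 1) (by simpa using ih)
      exact_mod_cast this.2.2
  have hm : ∀ k : ℕ, ∀ z : ℂ, 0 < z.im → J.mMinusAt (-k) z = J'.mMinusAt (-k) z := by
    intro k
    induction k with
    | zero => exact fun z hz => mMinus_eq_of_F_eq h hz
    | succ k ih =>
      have := (left_step ih).2.2
      have e : -((k + 1 : ℕ) : ℤ) = -(k : ℤ) - 1 := by push_cast; ring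
      rwa [e]
  -- The function m₋ at site 0 encodes the coefficients with n ≤ 0, and m₊ at site 0 those with n ≥
  -- 1.
  have hab : ∀ n : ℤ, J.a n = J'.a n ∧ J.b n = J'.b n := by
    intro n
    rcases le_or_gt n 0 with hn | hn
    · obtain ⟨k, rfl⟩ := Int.exists_eq_neg_ofNat hn
      exact ⟨(left_step (hm k)).1, (left_step (hm k)).2.1⟩
    · obtain ⟨k, hk⟩ := Int.eq_ofNat_of_zero_le (show 0 ≤ n - 1 by omega)
      have := right_step (J := J) (J' := J') (n := n) (by rw [hk]; exact hp k)
      exact ⟨this.1, this.2.1⟩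
  exact JacobiMatrix.ext (funext fun n => (hab n).1) (funext fun n => (hab n).2)

end JacobiMatrix

/-! ### Real points: admissibility as an inequality between F(x) and F(1/x) -/

/-- The closed set `[-1/r, -r] ∪ [r, 1/r]`. -/
def bands (r : ℝ) : Set ℝ := {t | r ≤ |t| ∧ |t| ≤ 1 / r}

theorem isCompact_bands (r : ℝ) : IsCompact (bands r) := by
  refine Metric.isCompact_of_isClosed_isBounded ?_ ?_
  · exact (isClosed_le continuous_const continuous_abs).inter
      (isClosed_le continuous_abs continuous_const)
  · refine (Metric.isBounded_closedBall (x := (0 : ℝ)) (r := 1 / r)).subset fun t ht => ?_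
    simpa using ht.2

/-- The restriction of `marchenkoF` to the real line. -/
def marchenkoR (σ : Measure ℝ) (x : ℝ) : ℝ :=
  -moment σ (-1) + (1 - moment σ (-2)) * x + ∫ t, 1 / (t - x) ∂σ

theorem marchenkoF_ofReal (σ : Measure ℝ) (x : ℝ) : marchenkoF σ x = marchenkoR σ x := by
  rw [marchenkoF, marchenkoR]
  have : ∫ t : ℝ, 1 / ((t : ℂ) - x) ∂σ = ((∫ t : ℝ, 1 / (t - x) ∂σ : ℝ) : ℂ) := by
    rw [← integral_complex_ofReal]
    refine integral_congr_ae (Eventually.of_forall fun t => ?_)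
    push_cast
    rfl
  rw [this]
  push_cast
  rfl

/-- Finite measures on the closed set `bands r` with
`x * (F(1/x) - F(x)) > 0` for `0 < |x| < r`. -/
structure IsMarchenko (r : ℝ) (σ : Measure ℝ) : Prop where
  finite : IsFiniteMeasure σ
  support : σ (bands r)ᶜ = 0
  pos : ∀ x : ℝ, x ≠ 0 → |x| < r → 0 < x * (marchenkoR σ (1 / x) - marchenkoR σ x)

section Basic

variable {σ : Measure ℝ} {r : ℝ}

theorem integrable_of_continuousOn_bands {E : Type*} [NormedAddCommGroup E] [IsFiniteMeasure σ]
    (hσ : σ (bands r)ᶜ = 0) {f : ℝ → E} (hf : ContinuousOn f (bands r)) : Integrable f σ := by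
  have h1 : IntegrableOn f (bands r) σ := hf.integrableOn_compact (isCompact_bands r)
  rwa [IntegrableOn, Measure.restrict_eq_self_of_ae_mem (show ∀ᵐ t ∂σ, t ∈ bands r from hσ)]
    at h1

theorem ne_zero_of_mem_bands (hr : 0 < r) {t : ℝ} (ht : t ∈ bands r) : t ≠ 0 :=
  abs_pos.mp (hr.trans_le ht.1)

theorem moment_eq_integral_inv (σ : Measure ℝ) : moment σ (-1) = ∫ t, 1 / t ∂σ := by
  simp [moment]

theorem moment_eq_integral_inv_sq (σ : Measure ℝ) : moment σ (-2) = ∫ t, 1 / t ^ 2 ∂σ := by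
  rw [moment]
  refine integral_congr_ae (Eventually.of_forall fun t => ?_)
  simp only
  rw [zpow_neg, one_div]
  rfl

theorem integrable_inv_bands [IsFiniteMeasure σ] (hr : 0 < r) (hσ : σ (bands r)ᶜ = 0) :
    Integrable (fun t : ℝ => 1 / t) σ :=
  integrable_of_continuousOn_bands hσ
    (continuousOn_const.div continuousOn_id fun _ ht => ne_zero_of_mem_bands hr ht)

theorem integrable_inv_sq_bands [IsFiniteMeasure σ] (hr : 0 < r) (hσ : σ (bands r)ᶜ = 0) :
    Integrable (fun t : ℝ => 1 / t ^ 2) σ :=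
  integrable_of_continuousOn_bands hσ
    (continuousOn_const.div (by fun_prop) fun _ ht => pow_ne_zero 2 (ne_zero_of_mem_bands hr ht))

theorem integrable_inv_sub_bands [IsFiniteMeasure σ] (hσ : σ (bands r)ᶜ = 0) {x : ℝ}
    (hx : x ∉ bands r) : Integrable (fun t : ℝ => 1 / (t - x)) σ :=
  integrable_of_continuousOn_bands hσ
    (continuousOn_const.div (by fun_prop) fun t ht => sub_ne_zero.mpr fun h => hx (h ▸ ht))

theorem marchenkoR_eq_mul [IsFiniteMeasure σ] (hr : 0 < r) (hσ : σ (bands r)ᶜ = 0) {x : ℝ}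
    (hx : x ∉ bands r) :
    marchenkoR σ x = x * (1 - moment σ (-2) + ∫ t, 1 / (t * (t - x)) ∂σ) := by
  have h1 : ∫ t, 1 / (t - x) ∂σ - ∫ t, 1 / t ∂σ = x * ∫ t, 1 / (t * (t - x)) ∂σ := by
    rw [← integral_sub (integrable_inv_sub_bands hσ hx) (integrable_inv_bands hr hσ),
      ← integral_const_mul]
    refine integral_congr_ae ?_
    filter_upwards [show ∀ᵐ t ∂σ, t ∈ bands r from hσ] with t ht
    have h1 := ne_zero_of_mem_bands hr ht
    have h2 : t - x ≠ 0 := sub_ne_zero.mpr fun h => hx (h ▸ ht)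
    field_simp
    ring
  rw [marchenkoR, moment_eq_integral_inv]
  linear_combination h1

theorem notMem_bands_of_abs_lt {x : ℝ} (hx : |x| < r) : x ∉ bands r := fun h =>
  absurd h.1 (not_le.mpr hx)

theorem notMem_bands_one_div {x : ℝ} (hx0 : x ≠ 0) (hx : |x| < r) :
    1 / x ∉ bands r := fun h => by
  have h2 := h.2
  rw [abs_div, abs_one] at h2
  exact absurd h2 (not_le.mpr (one_div_lt_one_div_of_lt (abs_pos.mpr hx0) hx))

/-- With E = -x - 1/x one has t² + Et + 1 = (t - x)(t - 1/x). Partial fractions turn the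
admissibility integral into a difference of values of F. -/
theorem marchenkoR_sub [IsFiniteMeasure σ] (hσ : σ (bands r)ᶜ = 0) {x : ℝ}
    (hx0 : x ≠ 0) (hx : |x| < r) :
    marchenkoR σ x - marchenkoR σ (1 / x) = (x - 1 / x) *
      (1 - moment σ (-2) + ∫ t, 1 / (t ^ 2 + (-x - 1 / x) * t + 1) ∂σ) := by
  have hm1 := notMem_bands_of_abs_lt hx
  have hm2 := notMem_bands_one_div hx0 hx
  have h1 : ∫ t, 1 / (t - x) ∂σ - ∫ t, 1 / (t - 1 / x) ∂σ =
      (x - 1 / x) * ∫ t, 1 / (t ^ 2 + (-x - 1 / x) * t + 1) ∂σ := by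
    rw [← integral_sub (integrable_inv_sub_bands hσ hm1) (integrable_inv_sub_bands hσ hm2),
      ← integral_const_mul]
    refine integral_congr_ae ?_
    filter_upwards [show ∀ᵐ t ∂σ, t ∈ bands r from hσ] with t ht
    have h1 : t - x ≠ 0 := sub_ne_zero.mpr fun h => hm1 (h ▸ ht)
    have h2 : t - 1 / x ≠ 0 := sub_ne_zero.mpr fun h => hm2 (h ▸ ht)
    have h3 : t ^ 2 + (-x - 1 / x) * t + 1 = (t - x) * (t - 1 / x) := by
      field_simp
      ring
    rw [h3, div_sub_div _ _ h1 h2]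
    ring
  rw [marchenkoR, marchenkoR]
  linear_combination h1

theorem exists_real_joukowsky {R : ℝ} (hr0 : 0 < r) (hr1 : r ≤ 1) (hrR : r + 1 / r = R) {E : ℝ}
    (hE : R < |E|) : ∃ x : ℝ, x ≠ 0 ∧ |x| < r ∧ -x - 1 / x = E := by
  have hR : 2 ≤ R := by
    rw [← hrR, ← sub_nonneg]
    have : r + 1 / r - 2 = (1 - r) ^ 2 / r := by
      field_simp
      ring
    rw [this]
    positivity
  set e := |E| with he
  have he2 : 2 < e := hR.trans_lt hE
  have hs : Real.sqrt (e ^ 2 - 4) ^ 2 = e ^ 2 - 4 := Real.sq_sqrt (by nlinarith)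
  have hs0 := Real.sqrt_nonneg (e ^ 2 - 4)
  set s := Real.sqrt (e ^ 2 - 4)
  have hse : s < e := by nlinarith
  -- The smaller root of y + 1/y = |E|. It lies below r because y + 1/y decreases on (0, 1] and |E|
  -- > R. The sign of x is opposite to that of E.
  set y := (e - s) / 2 with hy
  have hy0 : 0 < y := by linarith
  have hyq : y * (e - y) = 1 := by
    rw [hy]
    nlinarith
  have hyinv : 1 / y = e - y := by
    rw [div_eq_iff hy0.ne', ← hyq]
    ring
  have hye : y + 1 / y = e := by rw [hyinv]; ring
  have hy1 : y ≤ 1 := by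
    by_contra h
    push Not at h
    have : y ≤ e - y := by linarith
    nlinarith
  have hyr : y < r := by
    by_contra h
    push Not at h
    have h1 : 1 / y - 1 / r = (r - y) / (y * r) := by field_simp
    have h2 : (r + 1 / r) - (y + 1 / y) = (y - r) * (1 - y * r) / (y * r) := by
      field_simp
      ring
    have h3 : 0 ≤ (y - r) * (1 - y * r) / (y * r) := by
      have : y * r ≤ 1 := by nlinarith
      apply div_nonneg (mul_nonneg (by linarith) (by linarith)) (by positivity)
    rw [hrR, hye] at h2
    linarith
  rcases abs_cases E with ⟨h, -⟩ | ⟨h, -⟩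
  · refine ⟨-y, by linarith [hy0], by rwa [abs_neg, abs_of_pos hy0], ?_⟩
    rw [div_neg]
    linarith [hye]
  · refine ⟨y, hy0.ne', by rwa [abs_of_pos hy0], ?_⟩
    linarith [hye]

theorem lt_abs_joukowsky {R : ℝ} (hr1 : r ≤ 1) (hrR : r + 1 / r = R)
    {x : ℝ} (hx0 : x ≠ 0) (hx : |x| < r) : R < |-x - 1 / x| := by
  have hpos := abs_pos.mpr hx0
  have hr0 : 0 < r := hpos.trans hx
  have h1 : |-x - 1 / x| = |x| + 1 / |x| := by
    have : -x - 1 / x = -(x * (1 + 1 / x ^ 2)) := by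
      field_simp
      ring
    rw [this, abs_neg, abs_mul, abs_of_pos (by positivity : 0 < 1 + 1 / x ^ 2), ← sq_abs x]
    field_simp
  have h2 : (|x| + 1 / |x|) - (r + 1 / r) = (r - |x|) * (1 - |x| * r) / (|x| * r) := by
    field_simp
    ring
  have h3 : 0 < (r - |x|) * (1 - |x| * r) / (|x| * r) := by
    have : |x| * r < 1 := by nlinarith
    exact div_pos (mul_pos (by linarith) (by linarith)) (by positivity)
  rw [h1, ← hrR]
  linarith

theorem pos_iff_pos [IsFiniteMeasure σ] (hσ : σ (bands r)ᶜ = 0) (hr1 : r ≤ 1) {x : ℝ}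
    (hx0 : x ≠ 0) (hx : |x| < r) :
    0 < x * (marchenkoR σ (1 / x) - marchenkoR σ x) ↔
      0 < 1 - moment σ (-2) + ∫ t, 1 / (t ^ 2 + (-x - 1 / x) * t + 1) ∂σ := by
  have h1 := marchenkoR_sub hσ hx0 hx
  have h2 : x * (marchenkoR σ (1 / x) - marchenkoR σ x) = (1 - x ^ 2) *
      (1 - moment σ (-2) + ∫ t, 1 / (t ^ 2 + (-x - 1 / x) * t + 1) ∂σ) := by
    have h3 : x * (x - 1 / x) = x ^ 2 - 1 := by field_simp
    linear_combination (-x) * h1 - (1 - moment σ (-2) +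
      ∫ t, 1 / (t ^ 2 + (-x - 1 / x) * t + 1) ∂σ) * h3
  have h4 : 0 < 1 - x ^ 2 := by
    have := abs_nonneg x
    rw [← sq_abs]
    nlinarith
  rw [h2, mul_pos_iff_of_pos_left h4]

theorem sq_add_one_le {R : ℝ} (hr0 : 0 < r) (hrR : r + 1 / r = R) {t : ℝ} (ht : t ∈ bands r) :
    t ^ 2 + 1 ≤ R * |t| := by
  have h1 : (|t| - r) * (|t| - 1 / r) ≤ 0 :=
    mul_nonpos_of_nonneg_of_nonpos (by linarith [ht.1]) (by linarith [ht.2])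
  have h2 : (|t| - r) * (|t| - 1 / r) = |t| ^ 2 + 1 - (r + 1 / r) * |t| := by
    field_simp
    ring
  rw [h2, hrR, sq_abs] at h1
  linarith

theorem quadratic_neg {R : ℝ} (hr0 : 0 < r) (hrR : r + 1 / r = R) {t E : ℝ} (ht : t ∈ bands r)
    (hE : R < |E|) (h : E * t ≤ 0) : t ^ 2 + E * t + 1 < 0 := by
  have h1 := sq_add_one_le hr0 hrR ht
  have h2 : 0 < |t| := hr0.trans_le ht.1
  have h3 : E * t = -(|E| * |t|) := by rw [← abs_mul, abs_of_nonpos h, neg_neg]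
  rw [h3]
  nlinarith

theorem quadratic_ne_zero {R : ℝ} (hr0 : 0 < r) (hrR : r + 1 / r = R) {t E : ℝ}
    (ht : t ∈ bands r) (hE : R < |E|) : t ^ 2 + E * t + 1 ≠ 0 := by
  rcases le_or_gt (E * t) 0 with h | h
  · exact (quadratic_neg hr0 hrR ht hE h).ne
  · positivity

theorem integrable_quadratic [IsFiniteMeasure σ] (hσ : σ (bands r)ᶜ = 0) {R : ℝ} (hr0 : 0 < r)
    (hrR : r + 1 / r = R) {E : ℝ} (hE : R < |E|) :
    Integrable (fun t : ℝ => 1 / (t ^ 2 + E * t + 1)) σ :=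
  integrable_of_continuousOn_bands hσ
    (continuousOn_const.div (by fun_prop) fun _ ht => quadratic_ne_zero hr0 hrR ht hE)

theorem IsMarchenko.quadratic_pos (h : IsMarchenko r σ) {R : ℝ} (hr0 : 0 < r) (hr1 : r ≤ 1)
    (hrR : r + 1 / r = R) {E : ℝ} (hE : R < |E|) :
    0 < 1 - moment σ (-2) + ∫ t, 1 / (t ^ 2 + E * t + 1) ∂σ := by
  have := h.finite
  obtain ⟨x, hx0, hx, rfl⟩ := exists_real_joukowsky hr0 hr1 hrR hE
  exact (pos_iff_pos h.support hr1 hx0 hx).mp (h.pos x hx0 hx)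

/-- Add the inequalities for E and -E. On the bands the two quadratics have opposite signs and the
sum of the integrands is 2(t² + 1)/((t² + 1)² - E²t²) ≤ 0, so 1 - σ₋₂ alone must be positive. Any E
> R serves; R + 1 is taken. -/
theorem IsMarchenko.one_sub_moment_pos (h : IsMarchenko r σ) (hr0 : 0 < r) (hr1 : r ≤ 1) :
    0 < 1 - moment σ (-2) := by
  have := h.finite
  obtain ⟨R, hrR⟩ : ∃ R, r + 1 / r = R := ⟨_, rfl⟩
  have hR0 : 0 < R := by rw [← hrR]; positivity
  have hE1 : R < |R + 1| := by rw [abs_of_pos (by linarith)]; linarith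
  have hE2 : R < |-(R + 1)| := by rwa [abs_neg]
  have h1 := h.quadratic_pos hr0 hr1 hrR hE1
  have h2 := h.quadratic_pos hr0 hr1 hrR hE2
  have h3 : ∫ t, 1 / (t ^ 2 + (R + 1) * t + 1) ∂σ + ∫ t, 1 / (t ^ 2 + -(R + 1) * t + 1) ∂σ ≤ 0 := by
    rw [← integral_add (integrable_quadratic h.support hr0 hrR hE1)
      (integrable_quadratic h.support hr0 hrR hE2)]
    refine integral_nonpos_of_ae ?_
    filter_upwards [show ∀ᵐ t ∂σ, t ∈ bands r from h.support] with t ht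
    have n1 := quadratic_ne_zero hr0 hrR ht hE1
    have n2 := quadratic_ne_zero hr0 hrR ht hE2
    have hprod : (t ^ 2 + (R + 1) * t + 1) * (t ^ 2 + -(R + 1) * t + 1) ≤ 0 := by
      rcases le_total t 0 with h0 | h0
      · have := quadratic_neg hr0 hrR ht hE1 (by nlinarith)
        exact mul_nonpos_of_nonpos_of_nonneg this.le (by nlinarith [sq_nonneg t])
      · have := quadratic_neg hr0 hrR ht hE2 (by nlinarith)
        exact mul_nonpos_of_nonneg_of_nonpos (by nlinarith [sq_nonneg t]) this.le
    simp only [Pi.zero_apply]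
    rw [div_add_div _ _ n1 n2]
    exact div_nonpos_of_nonneg_of_nonpos (by nlinarith [sq_nonneg t]) hprod
  linarith

/-- At a band edge t₀ the quadratic tends to 0 from below as |E| ↓ R with E t₀ < 0. An atom there
would drive the integral to -∞, since the integrand is at most 1 everywhere else on the bands. -/
theorem measure_singleton_eq_zero [IsFiniteMeasure σ] (hσ : σ (bands r)ᶜ = 0) {R : ℝ}
    (hr0 : 0 < r) (hrR : r + 1 / r = R)
    (hpos : ∀ E : ℝ, R < |E| → 0 < 1 - moment σ (-2) + ∫ t, 1 / (t ^ 2 + E * t + 1) ∂σ)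
    {t₀ : ℝ} (ht₀ : t₀ ∈ bands r) (h : t₀ ^ 2 + 1 = R * |t₀|) : σ {t₀} = 0 := by
  have hR0 : 0 < R := by rw [← hrR]; positivity
  have ht0 : 0 < |t₀| := hr0.trans_le ht₀.1
  set C := 1 - moment σ (-2) + σ.real univ with hC
  have hbound : ∀ ε : ℝ, 0 < ε → σ.real {t₀} ≤ ε * (|t₀| * C) := by
    intro ε hε
    -- The sign of E is opposite to that of t₀, which makes the quadratic at t₀ equal to -ε|t₀|.
    obtain ⟨E, hEabs, hEt⟩ : ∃ E : ℝ, |E| = R + ε ∧ E * t₀ = -((R + ε) * |t₀|) := by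
      rcases abs_cases t₀ with ⟨e, -⟩ | ⟨e, -⟩
      · exact ⟨-(R + ε), by rw [abs_neg, abs_of_pos (by linarith)], by rw [e]; ring⟩
      · exact ⟨R + ε, abs_of_pos (by linarith), by rw [e]; ring⟩
    have hE : R < |E| := by linarith
    have hval : t₀ ^ 2 + E * t₀ + 1 = -(ε * |t₀|) := by rw [hEt]; linarith
    have hle : ∫ t, 1 / (t ^ 2 + E * t + 1) ∂σ ≤
        ∫ t, (1 - ({t₀} : Set ℝ).indicator (fun _ => 1 / (ε * |t₀|)) t) ∂σ := by
      refine integral_mono_ae (integrable_quadratic hσ hr0 hrR hE) ?_ ?_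
      · exact (integrable_const 1).sub ((integrable_const _).indicator (measurableSet_singleton _))
      · filter_upwards [show ∀ᵐ t ∂σ, t ∈ bands r from hσ] with t ht
        by_cases htt : t = t₀
        · subst htt
          rw [hval, indicator_of_mem (mem_singleton _), div_neg]
          linarith
        · rw [indicator_of_notMem (by simpa using htt), sub_zero]
          rcases le_or_gt (E * t) 0 with h0 | h0
          · exact (div_nonpos_of_nonneg_of_nonpos zero_le_one
              (quadratic_neg hr0 hrR ht hE h0).le).trans zero_le_one
          · rw [div_le_one (by positivity)]
            nlinarith [sq_nonneg t]
    rw [integral_sub (integrable_const 1)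
      ((integrable_const _).indicator (measurableSet_singleton _)),
      integral_indicator_const _ (measurableSet_singleton _)] at hle
    simp only [integral_const, smul_eq_mul, mul_one] at hle
    have h1 := hpos E hE
    have h2 : σ.real {t₀} * (1 / (ε * |t₀|)) ≤ C := by linarith
    rw [mul_one_div, div_le_iff₀ (by positivity)] at h2
    linarith
  have hzero : σ.real {t₀} ≤ 0 := by
    have hlim : Tendsto (fun ε : ℝ => ε * (|t₀| * C)) (𝓝[>] 0) (𝓝 0) := by
      have : Tendsto (fun ε : ℝ => ε * (|t₀| * C)) (𝓝 0) (𝓝 (0 * (|t₀| * C))) :=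
        (continuous_id.mul continuous_const).tendsto 0
      rw [zero_mul] at this
      exact this.mono_left nhdsWithin_le_nhds
    refine ge_of_tendsto hlim ?_
    filter_upwards [self_mem_nhdsWithin] with ε hε using hbound ε hε
  exact (measureReal_eq_zero_iff).mp (le_antisymm hzero measureReal_nonneg)

/-- Closed bands suit the compactness and limit arguments. Nothing is lost, because the positivity
condition excludes mass at the four edges ±r, ±1/r; for r = 1 this leaves only the zero measure. -/
theorem isAdmissible_iff_isMarchenko {R : ℝ} (hr0 : 0 < r) (hr1 : r ≤ 1) (hrR : r + 1 / r = R) :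
    IsAdmissible R r σ ↔ IsMarchenko r σ := by
  constructor
  · rintro ⟨hfin, hsupp, hpos⟩
    have hσ : σ (bands r)ᶜ = 0 := by
      refine measure_mono_null (compl_subset_compl.mpr ?_) hsupp
      rintro t (ht | ht)
      · have : t < 0 := by linarith [ht.2]
        exact ⟨by rw [abs_of_neg this]; linarith [ht.2], by rw [abs_of_neg this]; linarith [ht.1]⟩
      · have : 0 < t := hr0.trans ht.1
        exact ⟨by rw [abs_of_pos this]; exact ht.1.le, by rw [abs_of_pos this]; exact ht.2.le⟩
    refine ⟨hfin, hσ, fun x hx0 hx => ?_⟩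
    exact (pos_iff_pos hσ hr1 hx0 hx).mpr (hpos _ (lt_abs_joukowsky hr1 hrR hx0 hx))
  · intro h
    have hfin := h.finite
    have hpos := fun (E : ℝ) (hE : R < |E|) => h.quadratic_pos hr0 hr1 hrR hE
    refine ⟨hfin, ?_, hpos⟩
    have hr2 : r ≤ 1 / r := by rw [le_div_iff₀ hr0]; nlinarith
    have hq : ∀ t : ℝ, (|t| = r ∨ |t| = 1 / r) → σ {t} = 0 := by
      intro t ht
      refine measure_singleton_eq_zero h.support hr0 hrR hpos ?_ ?_
      · rcases ht with e | e
        · exact ⟨e.ge, by rw [e]; exact hr2⟩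
        · exact ⟨by rw [e]; exact hr2, e.le⟩
      · rw [← sq_abs, ← hrR]
        rcases ht with e | e <;> rw [e] <;> field_simp
        ring
    have hr' : 0 < 1 / r := by positivity
    have hnull : σ ((bands r)ᶜ ∪ ({r} ∪ {-r} ∪ {1 / r} ∪ {-(1 / r)})) = 0 := by
      refine measure_union_null h.support (measure_union_null (measure_union_null
        (measure_union_null ?_ ?_) ?_) ?_) <;> apply hq
      · left; exact abs_of_pos hr0
      · left; rw [abs_neg, abs_of_pos hr0]
      · right; exact abs_of_pos hr'
      · right; rw [abs_neg, abs_of_pos hr']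
    refine measure_mono_null (fun t ht => ?_) hnull
    by_contra hcon
    simp only [mem_union, mem_compl_iff, mem_singleton_iff, not_or, not_not] at hcon
    obtain ⟨hb, ⟨⟨h1, h2⟩, h3⟩, h4⟩ := hcon
    apply ht
    rcases abs_cases t with ⟨e, -⟩ | ⟨e, -⟩
    · right
      exact ⟨lt_of_le_of_ne (e ▸ hb.1) (Ne.symm h1), lt_of_le_of_ne (e ▸ hb.2) h3⟩
    · left
      have hb1 : t ≤ -r := by linarith [hb.1]
      have hb2 : -(1 / r) ≤ t := by linarith [hb.2]
      exact ⟨lt_of_le_of_ne hb2 (Ne.symm h4), lt_of_le_of_ne hb1 h2⟩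

/-- Since 0 < t(t - x) ≤ 2t² on the bands, F(x)/x is at least 1 - σ₋₂ + σ₋₂/2 ≥ 1/2. Only 1 - σ₋₂ ≥
0 is assumed, as strict positivity is not yet known in the step to the left. -/
theorem mul_marchenkoR_pos [IsFiniteMeasure σ] (hσ : σ (bands r)ᶜ = 0)
    (hB : 0 ≤ 1 - moment σ (-2)) {x : ℝ} (hx0 : x ≠ 0) (hx : |x| < r) :
    0 < x * marchenkoR σ x := by
  have hr : 0 < r := (abs_nonneg x).trans_lt hx
  have hm := notMem_bands_of_abs_lt hx
  rw [marchenkoR_eq_mul hr hσ hm]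
  have hkey : ∀ t ∈ bands r, 0 < t * (t - x) ∧ t * (t - x) ≤ 2 * t ^ 2 := by
    intro t ht
    have h1 : |t * x| < t ^ 2 := by
      rw [abs_mul, ← sq_abs t]
      have := ht.1
      nlinarith
    have := abs_lt.mp h1
    constructor <;> nlinarith
  have hle : ∫ t, 1 / 2 * (1 / t ^ 2) ∂σ ≤ ∫ t, 1 / (t * (t - x)) ∂σ := by
    refine integral_mono_ae ((integrable_inv_sq_bands hr hσ).const_mul _) ?_ ?_
    · exact integrable_of_continuousOn_bands hσ
        (continuousOn_const.div (by fun_prop) fun t ht => (hkey t ht).1.ne')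
    · filter_upwards [show ∀ᵐ t ∂σ, t ∈ bands r from hσ] with t ht
      have h0 := ne_zero_of_mem_bands hr ht
      have : 1 / 2 * (1 / t ^ 2) = 1 / (2 * t ^ 2) := by field_simp
      rw [this]
      exact one_div_le_one_div_of_le (hkey t ht).1 (hkey t ht).2
  rw [integral_const_mul, ← moment_eq_integral_inv_sq] at hle
  have : 0 < x ^ 2 := by positivity
  nlinarith

end Basic

/-! ### The function F off the bands and its normalization at 0 -/

section Complex

variable {σ : Measure ℝ} {r : ℝ}

theorem differentiableAt_marchenkoF [IsFiniteMeasure σ] (hσ : σ (bands r)ᶜ = 0) {l : ℂ}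
    (hl : l ∉ Complex.ofReal '' bands r) : DifferentiableAt ℂ (marchenkoF σ) l := by
  unfold marchenkoF
  exact ((differentiableAt_id.const_mul _).const_add _).add
    (differentiableAt_cauchy (isCompact_bands r).isClosed hσ hl)

theorem continuousAt_marchenkoF_ofReal [IsFiniteMeasure σ] (hσ : σ (bands r)ᶜ = 0) {x : ℝ}
    (hx : x ∉ bands r) : ContinuousAt (marchenkoF σ) x := by
  refine (differentiableAt_marchenkoF hσ ?_).continuousAt
  rintro ⟨t, ht, h⟩
  exact hx (Complex.ofReal_injective h ▸ ht)

theorem im_cauchy_nonneg [IsFiniteMeasure σ] {l : ℂ} (hl : 0 < l.im) :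
    0 ≤ (∫ t : ℝ, 1 / ((t : ℂ) - l) ∂σ).im := by
  rw [im_cauchy hl.ne']
  exact integral_nonneg fun t => div_nonneg hl.le (Complex.normSq_nonneg _)

theorem im_marchenkoF_pos [IsFiniteMeasure σ] (hB : 0 < 1 - moment σ (-2)) {l : ℂ}
    (hl : 0 < l.im) : 0 < (marchenkoF σ l).im := by
  have h1 := im_cauchy_nonneg (σ := σ) hl
  have h2 : (1 - (moment σ (-2) : ℂ)) = ((1 - moment σ (-2) : ℝ) : ℂ) := by push_cast; rfl
  rw [marchenkoF, h2, Complex.add_im, Complex.add_im, Complex.im_ofReal_mul, Complex.neg_im,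
    Complex.ofReal_im]
  have := mul_pos hB hl
  linarith

theorem zero_notMem_image_bands (hr : 0 < r) : (0 : ℂ) ∉ Complex.ofReal '' bands r := by
  rintro ⟨t, ht, h⟩
  exact ne_zero_of_mem_bands hr ht (by exact_mod_cast h)

theorem cauchy_zero (σ : Measure ℝ) :
    ∫ t : ℝ, 1 / ((t : ℂ) - 0) ∂σ = (moment σ (-1) : ℂ) := by
  rw [moment_eq_integral_inv, ← integral_complex_ofReal]
  simp

theorem hasDerivAt_cauchy_zero [IsFiniteMeasure σ] (hr : 0 < r) (hσ : σ (bands r)ᶜ = 0) :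
    HasDerivAt (fun l : ℂ => ∫ t : ℝ, 1 / ((t : ℂ) - l) ∂σ) (moment σ (-2) : ℂ) 0 := by
  have h : (fun l : ℂ => ∫ t : ℝ, 1 / ((t : ℂ) - l) ∂σ) = resolventTransform σ := by
    ext l
    rw [resolventTransform_apply, ← one_div_sub_eq_resolvent]
  rw [h]
  have h1 := hasDerivAt_resolventTransform (0 : ℂ)
    (notMem_image_support (isCompact_bands r).isClosed hσ (zero_notMem_image_bands hr))
  have h2 : (moment σ (-2) : ℂ) = ∫ t : ℝ, resolvent (0 : ℂ) t ^ 2 ∂σ := by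
    rw [moment_eq_integral_inv_sq, ← integral_complex_ofReal]
    refine integral_congr_ae (Eventually.of_forall fun t => ?_)
    simp only
    rw [← one_div_sub_eq_resolvent]
    simp
  rw [h2]
  exact h1

theorem marchenkoF_zero (σ : Measure ℝ) : marchenkoF σ 0 = 0 := by
  rw [marchenkoF, cauchy_zero]
  ring

/-- The coefficients -σ₋₁ and 1 - σ₋₂ are exactly those for which F(0) = 0 and F'(0) = 1. -/
theorem hasDerivAt_marchenkoF_zero [IsFiniteMeasure σ] (hr : 0 < r) (hσ : σ (bands r)ᶜ = 0) :
    HasDerivAt (marchenkoF σ) 1 0 := by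
  have h := (((hasDerivAt_id (0 : ℂ)).const_mul (1 - (moment σ (-2) : ℂ))).const_add
    (-(moment σ (-1) : ℂ))).add (hasDerivAt_cauchy_zero hr hσ)
  exact h.congr_deriv (by ring)

/-- The filter of positive imaginary numbers tending to `0`. -/
def imagZero : Filter ℂ := map (fun y : ℝ => (y : ℂ) * Complex.I) (𝓝[>] 0)

instance : NeBot imagZero := by
  unfold imagZero
  infer_instance

theorem imagZero_le : imagZero ≤ 𝓝[upper] 0 := by
  refine tendsto_nhdsWithin_iff.mpr ⟨?_, ?_⟩
  · have h : Continuous fun y : ℝ => (y : ℂ) * Complex.I := by fun_prop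
    have := h.tendsto 0
    simp only [Complex.ofReal_zero, zero_mul] at this
    exact this.mono_left nhdsWithin_le_nhds
  · filter_upwards [self_mem_nhdsWithin] with y hy
    simpa [upper] using hy

theorem eventually_imagZero_upper : ∀ᶠ l in imagZero, l ∈ upper :=
  (self_mem_nhdsWithin : upper ∈ 𝓝[upper] (0 : ℂ)) |> fun h => imagZero_le h

theorem tendsto_id_imagZero : Tendsto (fun l : ℂ => l) imagZero (𝓝 0) :=
  imagZero_le.trans nhdsWithin_le_nhds

theorem ne_zero_of_mem_upper {l : ℂ} (hl : l ∈ upper) : l ≠ 0 := by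
  rintro rfl
  simp [upper] at hl

theorem imagZero_le_ne : imagZero ≤ 𝓝[≠] 0 :=
  imagZero_le.trans (nhdsWithin_mono 0 fun _ hl => ne_zero_of_mem_upper hl)

theorem tendsto_cauchy_imagZero [IsFiniteMeasure σ] (hr : 0 < r) (hσ : σ (bands r)ᶜ = 0) :
    Tendsto (fun l : ℂ => ∫ t : ℝ, 1 / ((t : ℂ) - l) ∂σ) imagZero (𝓝 (moment σ (-1) : ℂ)) := by
  have h := (hasDerivAt_cauchy_zero hr hσ).continuousAt.tendsto
  rw [cauchy_zero] at h
  exact h.mono_left (imagZero_le.trans nhdsWithin_le_nhds)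

theorem tendsto_mul_herglotz [IsFiniteMeasure σ] (hr : 0 < r) (hσ : σ (bands r)ᶜ = 0)
    (A B c : ℂ) {N : ℂ → ℂ}
    (hN : ∀ l ∈ upper, N l = A + B * l - c / l + ∫ t : ℝ, 1 / ((t : ℂ) - l) ∂σ) :
    Tendsto (fun l => l * N l) imagZero (𝓝 (-c)) := by
  have h1 : Tendsto (fun l : ℂ => l * (A + B * l + ∫ t : ℝ, 1 / ((t : ℂ) - l) ∂σ) - c) imagZero
      (𝓝 (0 * (A + B * 0 + (moment σ (-1) : ℂ)) - c)) :=
    (tendsto_id_imagZero.mul (((tendsto_id_imagZero.const_mul B).const_add A).add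
      (tendsto_cauchy_imagZero hr hσ))).sub_const c
  rw [zero_mul, zero_sub] at h1
  refine h1.congr' ?_
  filter_upwards [eventually_imagZero_upper] with l hl
  have := ne_zero_of_mem_upper hl
  rw [hN l hl]
  field_simp
  ring

/-- The limit 0 removes the pole and fixes A, since the Cauchy integral tends to σ₋₁; the slope 1
fixes B, since the derivative of that integral at 0 is σ₋₂. -/
theorem eq_marchenkoF_of_normalized [IsFiniteMeasure σ] (hr : 0 < r) (hσ : σ (bands r)ᶜ = 0)
    {A B c : ℝ} {N : ℂ → ℂ}
    (hN : ∀ l ∈ upper, N l = A + B * l - c / l + ∫ t : ℝ, 1 / ((t : ℂ) - l) ∂σ)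
    (h0 : Tendsto N imagZero (𝓝 0)) (h1 : Tendsto (fun l => N l / l) imagZero (𝓝 1)) :
    B = 1 - moment σ (-2) ∧ ∀ l ∈ upper, N l = marchenkoF σ l := by
  have hc : (c : ℂ) = 0 := by
    have t1 := tendsto_mul_herglotz hr hσ A B c hN
    have t2 := tendsto_id_imagZero.mul h0
    rw [mul_zero] at t2
    simpa using tendsto_nhds_unique t1 t2
  have hA : (A : ℂ) = -(moment σ (-1) : ℂ) := by
    have t1 : Tendsto N imagZero (𝓝 ((A : ℂ) + B * 0 + (moment σ (-1) : ℂ))) := by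
      refine (((tendsto_id_imagZero.const_mul (B : ℂ)).const_add (A : ℂ)).add
        (tendsto_cauchy_imagZero hr hσ)).congr' ?_
      filter_upwards [eventually_imagZero_upper] with l hl
      rw [hN l hl, hc]
      ring
    have := tendsto_nhds_unique t1 h0
    linear_combination this
  have hB : (B : ℂ) = 1 - (moment σ (-2) : ℂ) := by
    have hd := (hasDerivAt_iff_tendsto_slope_zero.mp (hasDerivAt_cauchy_zero hr hσ)).mono_left
      imagZero_le_ne
    have t1 : Tendsto (fun l => N l / l) imagZero (𝓝 ((B : ℂ) + (moment σ (-2) : ℂ))) := by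
      refine (hd.const_add (B : ℂ)).congr' ?_
      filter_upwards [eventually_imagZero_upper] with l hl
      have hl0 := ne_zero_of_mem_upper hl
      rw [hN l hl, hc, cauchy_zero, hA, zero_add, smul_eq_mul]
      field_simp
      ring
    have := tendsto_nhds_unique t1 h1
    linear_combination this
  refine ⟨by exact_mod_cast hB, fun l hl => ?_⟩
  rw [hN l hl, hc, hA, hB, marchenkoF]
  ring

theorem tendsto_marchenkoF_div [IsFiniteMeasure σ] (hr : 0 < r) (hσ : σ (bands r)ᶜ = 0) :
    Tendsto (fun l => marchenkoF σ l / l) imagZero (𝓝 1) := by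
  have hd := (hasDerivAt_iff_tendsto_slope_zero.mp (hasDerivAt_marchenkoF_zero hr hσ)).mono_left
    imagZero_le_ne
  refine hd.congr' (Eventually.of_forall fun l => ?_)
  rw [zero_add, marchenkoF_zero, sub_zero, smul_eq_mul]
  ring

theorem im_neg_inv_nonneg {w : ℂ} (hw : 0 < w.im) : 0 ≤ (-(1 / w)).im := by
  rw [Complex.neg_im, one_div, Complex.inv_im, neg_div, neg_neg]
  exact div_nonneg hw.le (Complex.normSq_nonneg _)

theorem tendsto_im_neg_inv {G : ℂ → ℂ} {x v : ℝ} (hG : Tendsto G (𝓝[upper] (x : ℂ)) (𝓝 (v : ℂ)))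
    (hv : v ≠ 0) : Tendsto (fun l => (-(1 / G l)).im) (𝓝[upper] (x : ℂ)) (𝓝 0) := by
  have h1 : Tendsto (fun l => -(1 / G l)) (𝓝[upper] (x : ℂ)) (𝓝 (-(1 / (v : ℂ)))) :=
    (tendsto_const_nhds.div hG (by exact_mod_cast hv)).neg
  have h2 := (Complex.continuous_im.tendsto _).comp h1
  have h3 : (-(1 / (v : ℂ))).im = 0 := by
    rw [← Complex.ofReal_one, ← Complex.ofReal_div, ← Complex.ofReal_neg, Complex.ofReal_im]
  rwa [h3] at h2

theorem neBot_nhdsWithin_upper (x : ℝ) : NeBot (𝓝[upper] (x : ℂ)) := by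
  refine mem_closure_iff_nhdsWithin_neBot.mp ?_
  rw [upper, Complex.closure_setOfPred_lt_im]
  simp

theorem cases_notMem_bands (hr : 0 < r) {x : ℝ} (hx : x ∉ bands r) (hx0 : x ≠ 0) :
    |x| < r ∨ ∃ y : ℝ, y ≠ 0 ∧ |y| < r ∧ x = 1 / y := by
  by_cases h : |x| < r
  · exact Or.inl h
  · right
    have h2 : 1 / r < |x| := by
      by_contra hcon
      exact hx ⟨not_lt.mp h, not_lt.mp hcon⟩
    refine ⟨1 / x, one_div_ne_zero hx0, ?_, (one_div_one_div x).symm⟩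
    rw [abs_div, abs_one]
    exact (one_div_lt hr (abs_pos.mpr hx0)).mp h2

end Complex

/-! ### Inverse Riccati step to the right -/

/-- The measures `σ` and `σ'` belong to consecutive sites, with coefficients `a` and `b`. -/
def IsStep (a b : ℝ) (σ σ' : Measure ℝ) : Prop :=
  ∀ l ∈ upper, marchenkoF σ l * (-l - 1 / l - b + (a : ℂ) ^ 2 * marchenkoF σ' l) = -1

section Step

variable {σ σ' : Measure ℝ} {r a b : ℝ}

theorem IsStep.real (h : IsStep a b σ σ') [IsFiniteMeasure σ] [IsFiniteMeasure σ']
    (hσ : σ (bands r)ᶜ = 0) (hσ' : σ' (bands r)ᶜ = 0) {x : ℝ} (hx : x ∉ bands r) (hx0 : x ≠ 0) :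
    marchenkoR σ x * (-x - 1 / x - b + a ^ 2 * marchenkoR σ' x) = -1 := by
  have hx0' : (x : ℂ) ≠ 0 := by exact_mod_cast hx0
  have hc : ContinuousAt (fun l : ℂ => marchenkoF σ l *
      (-l - 1 / l - b + (a : ℂ) ^ 2 * marchenkoF σ' l)) x := by
    have h1 := continuousAt_marchenkoF_ofReal hσ hx
    have h2 := continuousAt_marchenkoF_ofReal hσ' hx
    have h3 : ContinuousAt (fun l : ℂ => 1 / l) x := continuousAt_const.div continuousAt_id hx0'
    exact h1.mul (((continuousAt_id.neg.sub h3).sub continuousAt_const).add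
      (continuousAt_const.mul h2))
  have hne := neBot_nhdsWithin_upper x
  have h1 := tendsto_nhds_unique (hc.tendsto.mono_left nhdsWithin_le_nhds)
    (tendsto_const_nhds.congr' (by
      filter_upwards [self_mem_nhdsWithin] with l hl using (h l hl).symm))
  rw [marchenkoF_ofReal, marchenkoF_ofReal] at h1
  exact_mod_cast h1

theorem marchenkoR_ne_zero (h : IsMarchenko r σ) (hr0 : 0 < r) (hr1 : r ≤ 1) {x : ℝ}
    (hx : x ∉ bands r) (hx0 : x ≠ 0) : marchenkoR σ x ≠ 0 := by
  have := h.finite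
  have hB := (h.one_sub_moment_pos hr0 hr1).le
  rcases cases_notMem_bands hr0 hx hx0 with h1 | ⟨y, hy0, hy, rfl⟩
  · exact right_ne_zero_of_mul (mul_marchenkoR_pos h.support hB hx0 h1).ne'
  · have h1 := mul_marchenkoR_pos h.support hB hy0 hy
    have h2 := h.pos y hy0 hy
    intro h3
    rw [h3] at h2
    linarith

/-- The step to the right. -/
theorem IsMarchenko.exists_right (h : IsMarchenko r σ) (hr0 : 0 < r) (hr1 : r ≤ 1) :
    ∃ σ', IsMarchenko r σ' ∧ ∃ a b : ℝ, 0 < a ∧ IsStep a b σ σ' := by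
  have hfin := h.finite
  have hσ := h.support
  have hB := h.one_sub_moment_pos hr0 hr1
  have hFpos : ∀ l ∈ upper, 0 < (marchenkoF σ l).im := fun l hl => im_marchenkoF_pos hB hl
  have hFne : ∀ l ∈ upper, marchenkoF σ l ≠ 0 := fun l hl h0 => by
    have := hFpos l hl
    rw [h0] at this
    simp at this
  obtain ⟨A, B, c, ν, hB0, hνfin, hν, hrep⟩ := exists_herglotz_of_insert_zero
    (N := fun l => -(1 / marchenkoF σ l)) (S := bands r)
    (fun l hl => (((differentiableAt_const _).div (differentiableAt_marchenkoF hσ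
      (notMem_image_ofReal (ne_of_gt hl) _)) (hFne l hl)).neg).differentiableWithinAt)
    (fun l hl => im_neg_inv_nonneg (hFpos l hl)) (isCompact_bands r)
    (fun x hx hx0 => by
      have h1 := (continuousAt_marchenkoF_ofReal hσ hx).tendsto
      rw [marchenkoF_ofReal] at h1
      exact tendsto_im_neg_inv (h1.mono_left nhdsWithin_le_nhds)
        (marchenkoR_ne_zero h hr0 hr1 hx hx0))
  -- F(l) ~ l at 0, so -1/F has the pole -1/l there. It matches the pole of -l - 1/l in the Riccati
  -- equation.
  have hc : (c : ℂ) = 1 := by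
    have t1 := tendsto_mul_herglotz hr0 hν A B c hrep
    have t2 := (tendsto_marchenkoF_div hr0 hσ).inv₀ one_ne_zero |>.neg
    have t3 := tendsto_nhds_unique t1 (t2.congr' (Eventually.of_forall fun l => by
      rw [inv_div]; ring))
    rw [inv_one] at t3
    exact neg_injective t3
  have hν2 : 0 ≤ moment ν (-2) := by
    rw [moment_eq_integral_inv_sq]
    exact integral_nonneg fun t => by positivity
  -- q is a². With σ' = ν/q the linear coefficient q(1 - σ'₋₂) is 1 + B, as required after -l is
  -- removed from the linear term of -1/F.
  set q : ℝ := 1 + B + moment ν (-2) with hq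
  have hq0 : 0 < q := by linarith
  have ha2 : (Real.sqrt q) ^ 2 = q := Real.sq_sqrt hq0.le
  let σ' : Measure ℝ := ENNReal.ofReal (1 / q) • ν
  have hσ'fin : IsFiniteMeasure σ' := Measure.smul_finite ν ENNReal.ofReal_ne_top
  have hσ' : σ' (bands r)ᶜ = 0 := by
    simp [σ', hν]
  have hq1 : (ENNReal.ofReal (1 / q)).toReal = 1 / q := ENNReal.toReal_ofReal (by positivity)
  have hm : ∀ n : ℤ, moment σ' n = 1 / q * moment ν n := fun n => by
    rw [moment, moment, integral_smul_measure, hq1, smul_eq_mul]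
  have hqC : (q : ℂ) ≠ 0 := by exact_mod_cast hq0.ne'
  have hF' : ∀ l, (q : ℂ) * marchenkoF σ' l = -(moment ν (-1) : ℂ) + (1 + B) * l +
      ∫ t : ℝ, 1 / ((t : ℂ) - l) ∂ν := by
    intro l
    rw [marchenkoF, hm, hm, integral_smul_measure, hq1, Complex.real_smul]
    have hq' : (q : ℂ) = 1 + B + (moment ν (-2) : ℂ) := by rw [hq]; push_cast; rfl
    push_cast
    field_simp
    rw [hq']
    ring
  have hstep : IsStep (Real.sqrt q) (-A - moment ν (-1)) σ σ' := by
    intro l hl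
    have h1 := hrep l hl
    rw [hc] at h1
    have h2 := hF' l
    have h3 : (Real.sqrt q : ℂ) ^ 2 = q := by exact_mod_cast ha2
    rw [h3, h2]
    have h4 : (-l - 1 / l - ((-A - moment ν (-1) : ℝ) : ℂ) + (-(moment ν (-1) : ℂ) + (1 + B) * l +
        ∫ t : ℝ, 1 / ((t : ℂ) - l) ∂ν)) = -(1 / marchenkoF σ l) := by
      rw [h1]
      push_cast
      ring
    rw [h4]
    have := hFne l hl
    field_simp
  refine ⟨σ', ⟨hσ'fin, hσ', fun x hx0 hx => ?_⟩, _, _, Real.sqrt_pos.mpr hq0, hstep⟩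
  have e1 := hstep.real hσ hσ' (notMem_bands_of_abs_lt hx) hx0
  have e2 := hstep.real hσ hσ' (notMem_bands_one_div hx0 hx) (one_div_ne_zero hx0)
  rw [one_div_one_div] at e2
  rw [ha2] at e1 e2
  have p1 := mul_marchenkoR_pos hσ hB.le hx0 hx
  have p2 := h.pos x hx0 hx
  have p3 : 0 < x * marchenkoR σ (1 / x) := by linarith
  have hx2 : 0 < x ^ 2 := by positivity
  have hpq : 0 < marchenkoR σ x * marchenkoR σ (1 / x) := by
    have h5 := mul_pos p1 p3
    have h6 : x * marchenkoR σ x * (x * marchenkoR σ (1 / x)) =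
      x ^ 2 * (marchenkoR σ x * marchenkoR σ (1 / x)) := by ring
    rw [h6] at h5
    exact (mul_pos_iff_of_pos_left hx2).mp h5
  -- The points x and 1/x give the same E, so subtracting the two Riccati equations gives q(F'(1/x)
  -- - F'(x)) = 1/F(x) - 1/F(1/x), where F' belongs to σ'. As F(x)F(1/x) > 0, the inequality passes
  -- to σ'.
  have key : marchenkoR σ x * marchenkoR σ (1 / x) * q *
      (x * (marchenkoR σ' (1 / x) - marchenkoR σ' x)) =
      x * (marchenkoR σ (1 / x) - marchenkoR σ x) := by
    linear_combination x * marchenkoR σ x * e2 - x * marchenkoR σ (1 / x) * e1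
  rw [← key] at p2
  exact (mul_pos_iff_of_pos_left (mul_pos hpq hq0)).mp p2

end Step

/-! ### Inverse Riccati step to the left -/

section LeftStep

variable {σ σ' : Measure ℝ} {r a b : ℝ}

theorem mul_cauchy_one_div_nonpos [IsFiniteMeasure σ] (hr0 : 0 < r) (hσ : σ (bands r)ᶜ = 0) {x : ℝ}
    (hx0 : x ≠ 0) (hx : |x| < r) : x * ∫ t, 1 / (t - 1 / x) ∂σ ≤ 0 := by
  rw [← integral_const_mul]
  refine integral_nonpos_of_ae ?_
  filter_upwards [show ∀ᵐ t ∂σ, t ∈ bands r from hσ] with t ht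
  have h1 : |x * t| < 1 := by
    rw [abs_mul]
    have h2 : |x| * |t| < r * (1 / r) :=
      mul_lt_mul hx ht.2 (hr0.trans_le ht.1) hr0.le
    rwa [mul_one_div_cancel hr0.ne'] at h2
  have h3 := (abs_lt.mp h1).2
  have h4 : x * (1 / (t - 1 / x)) = x ^ 2 / (x * t - 1) := by
    have h5 : x * t - 1 ≠ 0 := by linarith
    have h6 : t - 1 / x ≠ 0 := by
      intro h
      apply h5
      field_simp at h
      linarith
    field_simp
  simp only [Pi.zero_apply]
  rw [h4]
  exact div_nonpos_of_nonneg_of_nonpos (sq_nonneg x) (by linarith)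

/-- The step to the left. -/
theorem IsMarchenko.exists_left (h : IsMarchenko r σ') (hr0 : 0 < r) (hr1 : r ≤ 1) :
    ∃ σ, IsMarchenko r σ ∧ ∃ a b : ℝ, 0 < a ∧ IsStep a b σ σ' := by
  have hfin := h.finite
  have hσ := h.support
  have hB := h.one_sub_moment_pos hr0 hr1
  -- This q, together with b below, cancels the linear and constant terms of G, leaving -1/l plus a
  -- Cauchy integral. Then -1/G ~ l at 0, as the normalization demands.
  set q : ℝ := 1 / (1 - moment σ' (-2)) with hq
  have hq0 : 0 < q := by positivity
  have hqB : q * (1 - moment σ' (-2)) = 1 := one_div_mul_cancel hB.ne'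
  set b : ℝ := -q * moment σ' (-1) with hb
  set G : ℂ → ℂ := fun l => -l - 1 / l - b + q * marchenkoF σ' l with hG
  set g : ℝ → ℝ := fun x => -x - 1 / x - b + q * marchenkoR σ' x with hg
  have hqB' : (q : ℂ) * (1 - (moment σ' (-2) : ℂ)) = 1 := by exact_mod_cast hqB
  have hGeq : ∀ l, G l = -(1 / l) + q * ∫ t : ℝ, 1 / ((t : ℂ) - l) ∂σ' := fun l => by
    simp only [hG, hb, marchenkoF]
    push_cast
    linear_combination l * hqB'
  have hgeq : ∀ x, g x = -(1 / x) + q * ∫ t : ℝ, 1 / (t - x) ∂σ' := fun x => by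
    simp only [hg, hb, marchenkoR]
    linear_combination x * hqB
  have hGpos : ∀ l ∈ upper, 0 < (G l).im := fun l hl => by
    have h1 := im_cauchy_nonneg (σ := σ') hl
    have hl' : 0 < l.im := hl
    have h2 : 0 < Complex.normSq l := Complex.normSq_pos.mpr (ne_zero_of_mem_upper hl)
    rw [hGeq, Complex.add_im, Complex.im_ofReal_mul, Complex.neg_im, one_div, Complex.inv_im,
      neg_div, neg_neg]
    have h3 := div_pos hl' h2
    have h4 := mul_nonneg hq0.le h1
    linarith
  have hGne : ∀ l ∈ upper, G l ≠ 0 := fun l hl h0 => by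
    have := hGpos l hl
    rw [h0] at this
    simp at this
  have hg1 : ∀ x : ℝ, x ≠ 0 → |x| < r → x * g (1 / x) < 0 := fun x hx0 hx => by
    have h1 := mul_cauchy_one_div_nonpos hr0 hσ hx0 hx
    rw [hgeq, one_div_one_div]
    have h2 : 0 < x ^ 2 := by positivity
    nlinarith
  -- Outside the outer band edges the sign of g comes from the Cauchy integral; inside the gap
  -- around 0 it follows by comparing g(x) with g(1/x), which is where the inequality for σ' enters.
  -- Together they show that g has no zeros off the bands.
  have hg0 : ∀ x : ℝ, x ≠ 0 → |x| < r → x * g x < 0 := fun x hx0 hx => by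
    have h1 := hg1 x hx0 hx
    have h2 := mul_pos hq0 (h.pos x hx0 hx)
    have h3 : x * g x = x * g (1 / x) - q * (x * (marchenkoR σ' (1 / x) - marchenkoR σ' x)) := by
      simp only [hg, one_div_one_div]
      ring
    linarith
  have hgne : ∀ x : ℝ, x ∉ bands r → x ≠ 0 → g x ≠ 0 := fun x hx hx0 => by
    rcases cases_notMem_bands hr0 hx hx0 with h1 | ⟨y, hy0, hy, rfl⟩
    · exact right_ne_zero_of_mul (hg0 x hx0 h1).ne
    · exact right_ne_zero_of_mul (hg1 y hy0 hy).ne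
  obtain ⟨A, B, c, σ, hB0, hσfin, hσs, hrep⟩ := exists_herglotz_of_insert_zero
    (N := fun l => -(1 / G l)) (S := bands r)
    (fun l hl => by
      have hl0 := ne_zero_of_mem_upper hl
      have h1 := differentiableAt_marchenkoF hσ (notMem_image_ofReal (ne_of_gt hl) (bands r))
      have h2 : DifferentiableAt ℂ G l :=
        ((differentiableAt_id.neg.sub ((differentiableAt_const _).div differentiableAt_id
          hl0)).sub (differentiableAt_const _)).add (h1.const_mul _)
      exact (((differentiableAt_const _).div h2 (hGne l hl)).neg).differentiableWithinAt)
    (fun l hl => im_neg_inv_nonneg (hGpos l hl)) (isCompact_bands r)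
    (fun x hx hx0 => by
      have hx0' : (x : ℂ) ≠ 0 := by exact_mod_cast hx0
      have h3 : ContinuousAt (fun l : ℂ => 1 / l) x := continuousAt_const.div continuousAt_id hx0'
      have h2 : ContinuousAt G x := ((continuousAt_id.neg.sub h3).sub continuousAt_const).add
        (continuousAt_const.mul (continuousAt_marchenkoF_ofReal hσ hx))
      have h4 : G x = g x := by
        simp only [hG, hg, marchenkoF_ofReal]
        push_cast
        rfl
      have h1 := h2.tendsto
      rw [h4] at h1
      exact tendsto_im_neg_inv (h1.mono_left nhdsWithin_le_nhds) (hgne x hx hx0))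
  have t1 : Tendsto (fun l => -(1 / G l) / l) imagZero (𝓝 1) := by
    have t2 : Tendsto (fun l : ℂ => -1 + q * (l * ∫ t : ℝ, 1 / ((t : ℂ) - l) ∂σ')) imagZero
        (𝓝 (-1 + q * (0 * (moment σ' (-1) : ℂ)))) :=
      ((tendsto_id_imagZero.mul (tendsto_cauchy_imagZero hr0 hσ)).const_mul _).const_add _
    rw [zero_mul, mul_zero, add_zero] at t2
    have t3 := (t2.inv₀ (by norm_num)).neg
    have e1 : -(-1 : ℂ)⁻¹ = 1 := by norm_num
    rw [e1] at t3
    refine t3.congr' ?_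
    filter_upwards [eventually_imagZero_upper] with l hl
    have hl0 := ne_zero_of_mem_upper hl
    have e2 : -1 + q * (l * ∫ t : ℝ, 1 / ((t : ℂ) - l) ∂σ') = G l * l := by
      rw [hGeq]
      field_simp
    rw [e2, mul_inv]
    ring
  have t0 : Tendsto (fun l => -(1 / G l)) imagZero (𝓝 0) := by
    have := t1.mul tendsto_id_imagZero
    rw [mul_zero] at this
    refine this.congr' ?_
    filter_upwards [eventually_imagZero_upper] with l hl
    have hl0 := ne_zero_of_mem_upper hl
    field_simp
  obtain ⟨hBm, hF⟩ := eq_marchenkoF_of_normalized hr0 hσs hrep t0 t1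
  have ha2 : (Real.sqrt q) ^ 2 = q := Real.sq_sqrt hq0.le
  have hstep : IsStep (Real.sqrt q) b σ σ' := by
    intro l hl
    have h3 : (Real.sqrt q : ℂ) ^ 2 = q := by exact_mod_cast ha2
    have h4 := hGne l hl
    rw [h3, ← hF l hl]
    change -(1 / G l) * G l = -1
    field_simp
  refine ⟨σ, ⟨hσfin, hσs, fun x hx0 hx => ?_⟩, _, _, Real.sqrt_pos.mpr hq0, hstep⟩
  have e1 := hstep.real hσs hσ (notMem_bands_of_abs_lt hx) hx0
  have e2 := hstep.real hσs hσ (notMem_bands_one_div hx0 hx) (one_div_ne_zero hx0)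
  rw [ha2] at e1 e2
  have e2' : marchenkoR σ (1 / x) * g (1 / x) = -1 := e2
  rw [one_div_one_div] at e2
  have p1 := mul_marchenkoR_pos hσs (hBm ▸ hB0) hx0 hx
  have p3 : 0 < x * marchenkoR σ (1 / x) := by
    have h5 := hg1 x hx0 hx
    have h6 : (x * marchenkoR σ (1 / x)) * (x * g (1 / x)) = -x ^ 2 := by
      linear_combination x ^ 2 * e2'
    have h7 : 0 < x ^ 2 := by positivity
    by_contra hcon
    nlinarith
  -- The subtraction of the Riccati equations at x and 1/x used in the step to the right, now solved
  -- for the values of σ.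
  have key : x ^ 2 * (x * (marchenkoR σ (1 / x) - marchenkoR σ x)) =
      q * (x * (marchenkoR σ' (1 / x) - marchenkoR σ' x)) *
        ((x * marchenkoR σ x) * (x * marchenkoR σ (1 / x))) := by
    linear_combination x ^ 3 * marchenkoR σ (1 / x) * e1 - x ^ 3 * marchenkoR σ x * e2
  have p4 := mul_pos (mul_pos hq0 (h.pos x hx0 hx)) (mul_pos p1 p3)
  rw [← key] at p4
  exact (mul_pos_iff_of_pos_left (by positivity)).mp p4

end LeftStep

/-! ### The measure is determined by F -/

section Uniqueness

variable {σ τ : Measure ℝ} {r : ℝ}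

theorem continuousOn_inv_pow_bands (hr : 0 < r) (k : ℕ) :
    ContinuousOn (fun t : ℝ => (1 / (t : ℂ)) ^ k) (bands r) :=
  (continuousOn_const.div Complex.continuous_ofReal.continuousOn fun _ ht =>
    by exact_mod_cast ne_zero_of_mem_bands hr ht).pow k

theorem ofReal_sub_ne_zero {l : ℂ} (hl : l ∈ upper) (t : ℝ) : (t : ℂ) - l ≠ 0 := by
  intro h
  have h1 := congrArg Complex.im h
  have h2 : 0 < l.im := hl
  simp at h1
  linarith

theorem continuousOn_pow_cauchy_bands (hr : 0 < r) (k : ℕ) {l : ℂ} (hl : l ∈ upper) :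
    ContinuousOn (fun t : ℝ => (1 / (t : ℂ)) ^ k * (1 / ((t : ℂ) - l))) (bands r) :=
  (continuousOn_inv_pow_bands hr k).mul (continuousOn_const.div
    (Complex.continuous_ofReal.continuousOn.sub continuousOn_const)
    fun t _ => ofReal_sub_ne_zero hl t)

/-- One step of the geometric expansion 1/(t - l) = 1/t + l/(t(t - l)); iterated, it exhibits
inverse moments as Taylor coefficients at 0. -/
theorem pow_cauchy_succ [IsFiniteMeasure σ] (hr : 0 < r) (hσ : σ (bands r)ᶜ = 0) (k : ℕ) {l : ℂ}
    (hl : l ∈ upper) :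
    ∫ t : ℝ, (1 / (t : ℂ)) ^ k * (1 / ((t : ℂ) - l)) ∂σ = ∫ t : ℝ, (1 / (t : ℂ)) ^ (k + 1) ∂σ +
      l * ∫ t : ℝ, (1 / (t : ℂ)) ^ (k + 1) * (1 / ((t : ℂ) - l)) ∂σ := by
  rw [← integral_const_mul, ← integral_add
    (integrable_of_continuousOn_bands hσ (continuousOn_inv_pow_bands hr _))
    ((integrable_of_continuousOn_bands hσ (continuousOn_pow_cauchy_bands hr _ hl)).const_mul l)]
  refine integral_congr_ae ?_
  filter_upwards [show ∀ᵐ t ∂σ, t ∈ bands r from hσ] with t ht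
  have h1 : (t : ℂ) ≠ 0 := by exact_mod_cast ne_zero_of_mem_bands hr ht
  have h2 := ofReal_sub_ne_zero hl t
  rw [pow_succ]
  field_simp
  ring

instance : IsCountablyGenerated imagZero := by
  unfold imagZero
  infer_instance

theorem tendsto_pow_cauchy [IsFiniteMeasure σ] (hr : 0 < r) (hσ : σ (bands r)ᶜ = 0) (k : ℕ) :
    Tendsto (fun l : ℂ => ∫ t : ℝ, (1 / (t : ℂ)) ^ k * (1 / ((t : ℂ) - l)) ∂σ) imagZero
      (𝓝 (∫ t : ℝ, (1 / (t : ℂ)) ^ (k + 1) ∂σ)) := by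
  refine tendsto_integral_filter_of_dominated_convergence (fun _ => (1 / r) ^ (k + 1)) ?_ ?_
    (integrable_const _) ?_
  · filter_upwards [eventually_imagZero_upper] with l hl
    exact (integrable_of_continuousOn_bands hσ
      (continuousOn_pow_cauchy_bands hr k hl)).aestronglyMeasurable
  · have hre : ∀ᶠ l in imagZero, l.re = 0 := by
      refine eventually_map.mpr (Eventually.of_forall fun y => by simp)
    filter_upwards [hre] with l hl
    filter_upwards [show ∀ᵐ t ∂σ, t ∈ bands r from hσ] with t ht
    have h1 : ‖1 / (t : ℂ)‖ ≤ 1 / r := by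
      rw [norm_div, norm_one, Complex.norm_real, Real.norm_eq_abs]
      exact one_div_le_one_div_of_le hr ht.1
    have h2 : ‖1 / ((t : ℂ) - l)‖ ≤ 1 / r := by
      rw [norm_div, norm_one]
      refine one_div_le_one_div_of_le hr (ht.1.trans ?_)
      have := Complex.abs_re_le_norm ((t : ℂ) - l)
      rwa [Complex.sub_re, hl, sub_zero, Complex.ofReal_re] at this
    rw [norm_mul, norm_pow, pow_succ]
    gcongr
  · filter_upwards [show ∀ᵐ t ∂σ, t ∈ bands r from hσ] with t ht
    have h1 : (t : ℂ) ≠ 0 := by exact_mod_cast ne_zero_of_mem_bands hr ht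
    have h2 : Tendsto (fun l : ℂ => (1 / (t : ℂ)) ^ k * (1 / ((t : ℂ) - l))) imagZero
        (𝓝 ((1 / (t : ℂ)) ^ k * (1 / ((t : ℂ) - 0)))) :=
      (tendsto_const_nhds.div (tendsto_const_nhds.sub tendsto_id_imagZero)
        (by simpa using h1)).const_mul _
    rwa [sub_zero, ← pow_succ] at h2

/-- Two expansion steps cancel the moments σ₋₁ and σ₋₂ in F, so the comparison can start from the
integrals with weight 1/t². -/
theorem marchenkoF_eq_pow_cauchy [IsFiniteMeasure σ] (hr : 0 < r) (hσ : σ (bands r)ᶜ = 0) {l : ℂ}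
    (hl : l ∈ upper) :
    marchenkoF σ l = l + l ^ 2 * ∫ t : ℝ, (1 / (t : ℂ)) ^ 2 * (1 / ((t : ℂ) - l)) ∂σ := by
  have h0 := pow_cauchy_succ hr hσ 0 hl
  have h1 := pow_cauchy_succ hr hσ 1 hl
  have m1 : (moment σ (-1) : ℂ) = ∫ t : ℝ, (1 / (t : ℂ)) ^ (0 + 1) ∂σ := by
    rw [moment_eq_integral_inv, ← integral_complex_ofReal]
    simp
  have m2 : (moment σ (-2) : ℂ) = ∫ t : ℝ, (1 / (t : ℂ)) ^ (1 + 1) ∂σ := by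
    rw [moment_eq_integral_inv_sq, ← integral_complex_ofReal]
    simp
  simp only [pow_zero, one_mul] at h0
  rw [marchenkoF, m1, m2]
  linear_combination h0 + l * h1

/-- Induction: the limit at 0 identifies the next inverse moment, which is then subtracted before
dividing by l. -/
theorem pow_cauchy_eq_of_marchenkoF_eq [IsFiniteMeasure σ] [IsFiniteMeasure τ] (hr : 0 < r)
    (hσ : σ (bands r)ᶜ = 0) (hτ : τ (bands r)ᶜ = 0)
    (h : ∀ l ∈ upper, marchenkoF σ l = marchenkoF τ l) (k : ℕ) :
    ∀ l ∈ upper, ∫ t : ℝ, (1 / (t : ℂ)) ^ (k + 2) * (1 / ((t : ℂ) - l)) ∂σ =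
      ∫ t : ℝ, (1 / (t : ℂ)) ^ (k + 2) * (1 / ((t : ℂ) - l)) ∂τ := by
  induction k with
  | zero =>
    intro l hl
    have h1 := h l hl
    rw [marchenkoF_eq_pow_cauchy hr hσ hl, marchenkoF_eq_pow_cauchy hr hτ hl] at h1
    exact mul_left_cancel₀ (pow_ne_zero 2 (ne_zero_of_mem_upper hl)) (add_left_cancel h1)
  | succ k ih =>
    intro l hl
    have h1 : ∫ t : ℝ, (1 / (t : ℂ)) ^ (k + 2 + 1) ∂σ = ∫ t : ℝ, (1 / (t : ℂ)) ^ (k + 2 + 1) ∂τ := by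
      refine tendsto_nhds_unique ((tendsto_pow_cauchy hr hσ (k + 2)).congr' ?_)
        (tendsto_pow_cauchy hr hτ (k + 2))
      filter_upwards [eventually_imagZero_upper] with l hl using ih l hl
    have h2 := ih l hl
    rw [pow_cauchy_succ hr hσ _ hl, pow_cauchy_succ hr hτ _ hl, h1] at h2
    have h3 := mul_left_cancel₀ (ne_zero_of_mem_upper hl) (add_left_cancel h2)
    convert h3 using 4

theorem integral_inv_pow_eq_of_marchenkoF_eq [IsFiniteMeasure σ] [IsFiniteMeasure τ] (hr : 0 < r)
    (hσ : σ (bands r)ᶜ = 0) (hτ : τ (bands r)ᶜ = 0)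
    (h : ∀ l ∈ upper, marchenkoF σ l = marchenkoF τ l) (k : ℕ) :
    ∫ t : ℝ, (1 / t) ^ (k + 4) ∂σ = ∫ t : ℝ, (1 / t) ^ (k + 4) ∂τ := by
  have h1 : ∫ t : ℝ, (1 / (t : ℂ)) ^ (k + 1 + 2 + 1) ∂σ =
      ∫ t : ℝ, (1 / (t : ℂ)) ^ (k + 1 + 2 + 1) ∂τ := by
    refine tendsto_nhds_unique ((tendsto_pow_cauchy hr hσ (k + 1 + 2)).congr' ?_)
      (tendsto_pow_cauchy hr hτ (k + 1 + 2))
    filter_upwards [eventually_imagZero_upper] with l hl using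
      pow_cauchy_eq_of_marchenkoF_eq hr hσ hτ h (k + 1) l hl
  have h2 : ∀ ρ : Measure ℝ, ∫ t : ℝ, (1 / (t : ℂ)) ^ (k + 1 + 2 + 1) ∂ρ =
      ((∫ t : ℝ, (1 / t) ^ (k + 4) ∂ρ : ℝ) : ℂ) := fun ρ => by
    rw [← integral_complex_ofReal]
    refine integral_congr_ae (Eventually.of_forall fun t => ?_)
    push_cast
    rfl
  rw [h2, h2] at h1
  exact_mod_cast h1

theorem continuousOn_inv_pow_bands_real (hr : 0 < r) (k : ℕ) :
    ContinuousOn (fun t : ℝ => (1 / t) ^ k) (bands r) :=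
  (continuousOn_const.div continuousOn_id fun _ ht => ne_zero_of_mem_bands hr ht).pow k

theorem integrable_polynomial_inv [IsFiniteMeasure σ] (hr : 0 < r) (hσ : σ (bands r)ᶜ = 0)
    (p : Polynomial ℝ) : Integrable (fun t : ℝ => p.eval (1 / t) * (1 / t) ^ 4) σ :=
  integrable_of_continuousOn_bands hσ ((p.continuous.comp_continuousOn
    (continuousOn_const.div continuousOn_id fun _ ht => ne_zero_of_mem_bands hr ht)).mul
    (continuousOn_inv_pow_bands_real hr 4))

theorem integral_polynomial_inv_eq [IsFiniteMeasure σ] [IsFiniteMeasure τ] (hr : 0 < r)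
    (hσ : σ (bands r)ᶜ = 0) (hτ : τ (bands r)ᶜ = 0)
    (h : ∀ k : ℕ, ∫ t : ℝ, (1 / t) ^ (k + 4) ∂σ = ∫ t : ℝ, (1 / t) ^ (k + 4) ∂τ)
    (p : Polynomial ℝ) :
    ∫ t : ℝ, p.eval (1 / t) * (1 / t) ^ 4 ∂σ = ∫ t : ℝ, p.eval (1 / t) * (1 / t) ^ 4 ∂τ := by
  induction p using Polynomial.induction_on' with
  | add p q hp hq =>
    simp only [Polynomial.eval_add, add_mul]
    rw [integral_add (integrable_polynomial_inv hr hσ p) (integrable_polynomial_inv hr hσ q),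
      integral_add (integrable_polynomial_inv hr hτ p) (integrable_polynomial_inv hr hτ q), hp, hq]
  | monomial n c =>
    simp only [Polynomial.eval_monomial, mul_assoc, ← pow_add]
    rw [integral_const_mul, integral_const_mul, h]

/-- The function 1/t separates the points of the compact bands, so polynomials in 1/t are uniformly
dense there. The missing low inverse moments do no harm: the weight (1/t)⁴ has no zeros on the
bands. -/
theorem eq_of_integral_inv_pow_eq [IsFiniteMeasure σ] [IsFiniteMeasure τ] (hr : 0 < r)
    (hσ : σ (bands r)ᶜ = 0) (hτ : τ (bands r)ᶜ = 0)
    (h : ∀ k : ℕ, ∫ t : ℝ, (1 / t) ^ (k + 4) ∂σ = ∫ t : ℝ, (1 / t) ^ (k + 4) ∂τ) : σ = τ := by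
  refine ext_of_forall_integral_eq_of_IsFiniteMeasure fun f => ?_
  have hcpt : CompactSpace (bands r) := isCompact_iff_compactSpace.mp (isCompact_bands r)
  let w : C(bands r, ℝ) := ⟨fun t => 1 / (t : ℝ), continuous_const.div continuous_subtype_val
    fun t => ne_zero_of_mem_bands hr t.2⟩
  let A : Subalgebra ℝ C(bands r, ℝ) := (Polynomial.aeval w).range
  have hA : A.SeparatesPoints := by
    intro s t hst
    refine ⟨w, ⟨w, ⟨Polynomial.X, by simp⟩, rfl⟩, fun hw => hst (Subtype.ext ?_)⟩
    have : 1 / (s : ℝ) = 1 / (t : ℝ) := hw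
    simpa using this
  have hbound : ∀ ε : ℝ, 0 < ε → ∃ p : Polynomial ℝ, ∀ t ∈ bands r,
      |f t - p.eval (1 / t) * (1 / t) ^ 4| ≤ ε := by
    intro ε hε
    -- The approximated function is f(t)t⁴; the tolerance ε r⁴ becomes ε after division by t⁴, as
    -- |t| ≥ r.
    obtain ⟨⟨g, p, rfl⟩, hg⟩ := ContinuousMap.exists_mem_subalgebra_near_continuous_of_separatesPoints
      A hA (fun t : bands r => f t * (t : ℝ) ^ 4) (by fun_prop) (ε * r ^ 4) (by positivity)
    refine ⟨p, fun t ht => ?_⟩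
    have h1 := hg ⟨t, ht⟩
    have ht0 := ne_zero_of_mem_bands hr ht
    have h2 : (Polynomial.aeval w p : C(bands r, ℝ)) ⟨t, ht⟩ = p.eval (1 / t) := by
      rw [Polynomial.aeval_continuousMap_apply]
      rfl
    have h3 : f t - p.eval (1 / t) * (1 / t) ^ 4 =
        -(p.eval (1 / t) - f t * t ^ 4) * (1 / t) ^ 4 := by
      field_simp
      ring
    have h4 : ‖p.eval (1 / t) - f t * t ^ 4‖ < ε * r ^ 4 := by
      rw [← h2]
      exact h1
    rw [h3, abs_mul, abs_neg, abs_pow, abs_div, abs_one, div_pow, one_pow, mul_one_div,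
      div_le_iff₀ (pow_pos (abs_pos.mpr ht0) 4)]
    rw [Real.norm_eq_abs] at h4
    refine h4.le.trans ?_
    have := ht.1
    gcongr
  have hdiff : ∀ (ρ : Measure ℝ) [IsFiniteMeasure ρ], ρ (bands r)ᶜ = 0 → ∀ ε : ℝ,
      ∀ p : Polynomial ℝ, (∀ t ∈ bands r, |f t - p.eval (1 / t) * (1 / t) ^ 4| ≤ ε) →
      |∫ t, f t ∂ρ - ∫ t : ℝ, p.eval (1 / t) * (1 / t) ^ 4 ∂ρ| ≤ ε * ρ.real univ := by
    intro ρ _ hρ ε p hp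
    rw [← integral_sub (f.integrable ρ) (integrable_polynomial_inv hr hρ p)]
    exact norm_integral_le_of_norm_le_const (μ := ρ)
      (f := fun t => f t - p.eval (1 / t) * (1 / t) ^ 4) (by
        filter_upwards [show ∀ᵐ t ∂ρ, t ∈ bands r from hρ] with t ht using hp t ht)
  have hle : ∀ ε : ℝ, 0 < ε →
      |∫ t, f t ∂σ - ∫ t, f t ∂τ| ≤ ε * (σ.real univ + τ.real univ) := by
    intro ε hε
    obtain ⟨p, hp⟩ := hbound ε hε
    have h1 := abs_le.mp (hdiff σ hσ ε p hp)
    have h2 := abs_le.mp (hdiff τ hτ ε p hp)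
    have h3 := integral_polynomial_inv_eq hr hσ hτ h p
    rw [abs_le]
    constructor <;> linarith [h1.1, h1.2, h2.1, h2.2]
  have hlim : Tendsto (fun ε : ℝ => ε * (σ.real univ + τ.real univ)) (𝓝[>] 0) (𝓝 0) := by
    have : Tendsto (fun ε : ℝ => ε * (σ.real univ + τ.real univ)) (𝓝 0)
        (𝓝 (0 * (σ.real univ + τ.real univ))) := (continuous_id.mul continuous_const).tendsto 0
    rw [zero_mul] at this
    exact this.mono_left nhdsWithin_le_nhds
  have h0 : |∫ t, f t ∂σ - ∫ t, f t ∂τ| ≤ 0 := by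
    refine ge_of_tendsto hlim ?_
    filter_upwards [self_mem_nhdsWithin] with ε hε using hle ε hε
  exact sub_eq_zero.mp (abs_nonpos_iff.mp h0)

theorem IsMarchenko.eq_of_marchenkoF_eq (hσ : IsMarchenko r σ) (hτ : IsMarchenko r τ) (hr : 0 < r)
    (h : ∀ l ∈ upper, marchenkoF σ l = marchenkoF τ l) : σ = τ := by
  have := hσ.finite
  have := hτ.finite
  exact eq_of_integral_inv_pow_eq hr hσ.support hτ.support
    (integral_inv_pow_eq_of_marchenkoF_eq hr hσ.support hτ.support h)

end Uniqueness

/-! ### Norm bounds from a splitting of the quadratic form -/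

namespace JacobiMatrix

theorem hasSum_re_inner_weightedShift {c : ℤ → ℝ} (hc : ∃ C, ∀ n, |c n| ≤ C) (k : ℤ) (u : SeqSpace) :
    HasSum (fun n : ℤ => c n * (conj (u n) * u (n + k)).re)
      (inner ℂ u (weightedShift c hc k u)).re := by
  have h := Complex.hasSum_re (lp.hasSum_inner u (weightedShift c hc k u))
  refine h.congr_fun fun n => ?_
  rw [weightedShift_apply, RCLike.inner_apply, mul_assoc, Complex.re_ofReal_mul,
    mul_comm (u (n + k))]

theorem hasSum_re_inner_toCLM (J : JacobiMatrix) (u : SeqSpace) :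
    HasSum (fun n : ℤ => 2 * (J.a n * (conj (u n) * u (n + 1)).re) + J.b n * ‖u n‖ ^ 2)
      (inner ℂ u (J.toCLM u)).re := by
  have h1 := hasSum_re_inner_weightedShift J.a_bdd 1 u
  have h2 := hasSum_re_inner_weightedShift J.b_bdd 0 u
  have h3 : (inner ℂ u (J.toCLM u)).re = 2 * (inner ℂ u (weightedShift J.a J.a_bdd 1 u)).re +
      (inner ℂ u (weightedShift J.b J.b_bdd 0 u)).re := by
    have h4 := inner_weightedShift J.a (fun n => J.a (n - 1)) J.a_bdd
      (J.a_bdd.imp fun _ h n => h (n - 1)) 1 (fun n => rfl) u u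
    have h5 := congrArg Complex.re h4
    rw [← inner_conj_symm, Complex.conj_re] at h5
    simp only [toCLM, add_apply, inner_add_right, Complex.add_re]
    rw [← h5]
    ring
  rw [h3]
  refine ((h1.mul_left 2).add h2).congr_fun fun n => ?_
  rw [add_zero, ← Complex.normSq_eq_conj_mul_self, Complex.ofReal_re, Complex.normSq_eq_norm_sq]

/-- The form of e - sJ is a sum over the bonds (n, n+1) of binary forms with diagonal p n, q n and
off-diagonal entry -s a n. Since p n · q n = (a n)², completing the square shows each to be
nonnegative. -/
theorem mul_re_inner_le {J : JacobiMatrix} {p q : ℤ → ℝ} {s e : ℝ} (hs : |s| = 1)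
    (hp : ∀ n, 0 < p n) (hq : ∀ n, 0 < q n) (hpq : ∀ n, p n * q n = J.a n ^ 2)
    (h : ∀ n, p n + q (n - 1) = e - s * J.b n) (u : SeqSpace) :
    s * (inner ℂ u (J.toCLM u)).re ≤ e * ‖u‖ ^ 2 := by
  obtain ⟨C, hC⟩ := J.b_bdd
  have hsum := summable_sq_seqSpace u
  have hqC : ∀ n, q (n - 1) ≤ e + C := fun n => by
    have h1 := h n
    have h2 : |s * J.b n| ≤ C := by rw [abs_mul, hs, one_mul]; exact hC n
    linarith [hp n, (abs_le.mp h2).1]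
  have hpC : ∀ n, p n ≤ e + C := fun n => by
    have h1 := h n
    have h2 : |s * J.b n| ≤ C := by rw [abs_mul, hs, one_mul]; exact hC n
    linarith [hq (n - 1), (abs_le.mp h2).1]
  have sp : Summable fun n => p n * ‖u n‖ ^ 2 :=
    (hsum.mul_left (e + C)).of_nonneg_of_le (fun n => mul_nonneg (hp n).le (sq_nonneg _))
      fun n => mul_le_mul_of_nonneg_right (hpC n) (sq_nonneg _)
  have sq : Summable fun n => q (n - 1) * ‖u n‖ ^ 2 :=
    (hsum.mul_left (e + C)).of_nonneg_of_le (fun n => mul_nonneg (hq _).le (sq_nonneg _))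
      fun n => mul_le_mul_of_nonneg_right (hqC n) (sq_nonneg _)
  have sq' : HasSum (fun n => q n * ‖u (n + 1)‖ ^ 2) (∑' n, q (n - 1) * ‖u n‖ ^ 2) := by
    have := (Equiv.addRight (1 : ℤ)).hasSum_iff.mpr sq.hasSum
    simpa [Function.comp_def] using this
  have hn : HasSum (fun n => ‖u n‖ ^ 2) (‖u‖ ^ 2) := by
    have := lp.hasSum_norm (p := 2) (by norm_num) u
    simpa using this
  have hb : HasSum (fun n => s * (J.b n * ‖u n‖ ^ 2)) (e * ‖u‖ ^ 2 - (∑' n, p n * ‖u n‖ ^ 2) -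
      ∑' n, q (n - 1) * ‖u n‖ ^ 2) := by
    refine (((hn.mul_left e).sub sp.hasSum).sub sq.hasSum).congr_fun fun n => ?_
    have := h n
    linear_combination ‖u n‖ ^ 2 * this
  have htot := (sp.hasSum.add sq').add hb
  have hle := hasSum_le (fun n => ?_) ((J.hasSum_re_inner_toCLM u).mul_left s) htot
  · linarith
  · have h1 : |s * (J.a n * (conj (u n) * u (n + 1)).re)| ≤ J.a n * (‖u n‖ * ‖u (n + 1)‖) := by
      rw [abs_mul, hs, one_mul, abs_mul, abs_of_pos (J.a_pos n)]
      refine mul_le_mul_of_nonneg_left ((Complex.abs_re_le_norm _).trans ?_) (J.a_pos n).le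
      rw [norm_mul, RCLike.norm_conj]
    have h2 : 2 * (J.a n * (‖u n‖ * ‖u (n + 1)‖)) ≤ p n * ‖u n‖ ^ 2 + q n * ‖u (n + 1)‖ ^ 2 := by
      have h3 : 0 ≤ (p n * ‖u n‖ - J.a n * ‖u (n + 1)‖) ^ 2 := sq_nonneg _
      have h4 : p n * (p n * ‖u n‖ ^ 2 + q n * ‖u (n + 1)‖ ^ 2 -
          2 * (J.a n * (‖u n‖ * ‖u (n + 1)‖))) = (p n * ‖u n‖ - J.a n * ‖u (n + 1)‖) ^ 2 := by
        linear_combination ‖u (n + 1)‖ ^ 2 * hpq n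
      rw [← h4] at h3
      have := nonneg_of_mul_nonneg_right h3 (hp n)
      linarith
    linarith [(abs_le.mp h1).2]

/-- The norm of a symmetric operator is the supremum of its absolute Rayleigh quotients. -/
theorem norm_toCLM_le {J : JacobiMatrix} {R : ℝ}
    (h : ∀ E > R, ∀ u : SeqSpace, |(inner ℂ u (J.toCLM u)).re| ≤ E * ‖u‖ ^ 2) (hR : 0 ≤ R) :
    ‖J.toCLM‖ ≤ R := by
  refine le_of_forall_gt_imp_ge_of_dense fun E hE => ?_
  rw [ContinuousLinearMap.norm_eq_iSup_rayleighQuotient _ fun u v => J.inner_toCLM u v]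
  refine ciSup_le fun u => ?_
  rw [ContinuousLinearMap.rayleighQuotient, ContinuousLinearMap.reApplyInnerSelf_apply, inner_toCLM,
    abs_div, abs_of_nonneg (sq_nonneg ‖u‖)]
  refine div_le_of_le_mul₀ (sq_nonneg _) (hR.trans hE.le) ?_
  exact h E hE u

end JacobiMatrix

/-! ### From a chain of measures to a reflectionless Jacobi matrix -/

/-- The measures `σ n` belong to the sites of `J`. -/
structure IsChain (r : ℝ) (J : JacobiMatrix) (σ : ℤ → Measure ℝ) : Prop where
  marchenko : ∀ n, IsMarchenko r (σ n)
  step : ∀ n, IsStep (J.a n) (J.b n) (σ (n - 1)) (σ n)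

section Chain

variable {r R : ℝ}

/-- At a point `x` inside the gap around `0`, the quadratic form of `E - J`, `E = -x - 1/x`, splits
into a sum of `2 × 2` blocks with positive diagonals `p n`, `q n` and determinant zero. -/
theorem exists_splitting {a b : ℤ → ℝ} {σ : ℤ → Measure ℝ} (ha : ∀ n, 0 < a n)
    (hσ : ∀ n, IsMarchenko r (σ n)) (hstep : ∀ n, IsStep (a n) (b n) (σ (n - 1)) (σ n))
    (hr0 : 0 < r) (hr1 : r ≤ 1) (hrR : r + 1 / r = R) {s e : ℝ} (hs : s = 1 ∨ s = -1)
    (he : R < e) : ∃ p q : ℤ → ℝ, (∀ n, 0 < p n) ∧ (∀ n, 0 < q n) ∧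
      (∀ n, p n * q n = a n ^ 2) ∧ ∀ n, p n + q (n - 1) = e - s * b n := by
  have hR0 : 0 < R := by rw [← hrR]; positivity
  have hs2 : s * s = 1 := by rcases hs with rfl | rfl <;> norm_num
  have hE : R < |s * e| := by
    rw [abs_mul, abs_of_pos (hR0.trans he)]
    rcases hs with rfl | rfl <;> simpa using he
  obtain ⟨x, hx0, hx, hxe⟩ := exists_real_joukowsky hr0 hr1 hrR hE
  have hpos : ∀ n, 0 < -s * marchenkoR (σ n) x := fun n => by
    have := (hσ n).finite
    have h1 := mul_marchenkoR_pos (hσ n).support ((hσ n).one_sub_moment_pos hr0 hr1).le hx0 hx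
    have h2 : 0 < -s * x := by
      have h3 : x * x + 1 = -s * x * e := by
        have h4 : x * (-x - 1 / x) = -(x * x) - 1 := by field_simp
        rw [hxe] at h4
        linarith
      have h5 : 0 < -s * x * e := by rw [← h3]; linarith [mul_self_nonneg x]
      exact pos_of_mul_pos_left h5 (hR0.trans he).le
    have h3 : 0 < (-s * marchenkoR (σ n) x) * x ^ 2 := by
      have := mul_pos h1 h2
      linarith
    exact pos_of_mul_pos_left h3 (sq_nonneg x)
  -- The sign of x is opposite to s, and Fₙ(x) has the sign of x, so both sequences are positive.
  -- The sum condition is the Riccati equation at x with -x - 1/x = s e.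
  refine ⟨fun n => a n ^ 2 * (-s * marchenkoR (σ n) x), fun n => 1 / (-s * marchenkoR (σ n) x),
    fun n => mul_pos (pow_pos (ha n) 2) (hpos n), fun n => one_div_pos.mpr (hpos n), fun n => ?_,
    fun n => ?_⟩
  · rw [mul_assoc, mul_one_div_cancel (hpos n).ne', mul_one]
  · have := (hσ n).finite
    have := (hσ (n - 1)).finite
    have h1 := (hstep n).real (hσ (n - 1)).support (hσ n).support (notMem_bands_of_abs_lt hx) hx0
    rw [hxe] at h1
    have h2 := (hpos (n - 1)).ne'
    have h3 : 1 / (-s * marchenkoR (σ (n - 1)) x) = s * (s * e - b n +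
        a n ^ 2 * marchenkoR (σ n) x) := by
      rw [div_eq_iff h2]
      linear_combination (s * s) * h1 - hs2
    simp only
    rw [h3]
    linear_combination e * hs2

/-- Positivity of p and q for both signs s gives |b n| ≤ e; then p, q ≤ 2e and (a n)² = p n · q n.
It is stated for bare sequences because boundedness is needed before a `JacobiMatrix` can be formed.
-/
theorem bounded_of_splitting {a b : ℤ → ℝ} {e : ℝ} (ha : ∀ n, 0 < a n)
    (h : ∀ s : ℝ, s = 1 ∨ s = -1 → ∃ p q : ℤ → ℝ, (∀ n, 0 < p n) ∧ (∀ n, 0 < q n) ∧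
      (∀ n, p n * q n = a n ^ 2) ∧ ∀ n, p n + q (n - 1) = e - s * b n) (n : ℤ) :
    |a n| ≤ 2 * e ∧ |b n| ≤ e := by
  have hb : ∀ n, |b n| ≤ e := fun n => by
    obtain ⟨p, q, hp, hq, -, h1⟩ := h 1 (Or.inl rfl)
    obtain ⟨p', q', hp', hq', -, h2⟩ := h (-1) (Or.inr rfl)
    rw [abs_le]
    have e1 := h1 n
    have e2 := h2 n
    constructor
    · linarith [hp' n, hq' (n - 1)]
    · linarith [hp n, hq (n - 1)]
  refine ⟨?_, hb n⟩
  obtain ⟨p, q, hp, hq, hpq, h1⟩ := h 1 (Or.inl rfl)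
  have e1 := h1 n
  have e2 := h1 (n + 1)
  rw [add_sub_cancel_right] at e2
  have p1 : p n ≤ 2 * e := by linarith [hq (n - 1), (abs_le.mp (hb n)).1]
  have p2 : q n ≤ 2 * e := by linarith [hp (n + 1), (abs_le.mp (hb (n + 1))).1]
  have he : 0 ≤ 2 * e := (hp n).le.trans p1
  rw [abs_of_pos (ha n)]
  refine le_of_sq_le_sq ?_ he
  rw [← hpq n, pow_two]
  exact mul_le_mul p1 p2 (hq n).le he

theorem IsMarchenko.exists_isChain {σ₀ : Measure ℝ} (h : IsMarchenko r σ₀) (hr0 : 0 < r)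
    (hr1 : r ≤ 1) : ∃ (J : JacobiMatrix) (σ : ℤ → Measure ℝ), σ 0 = σ₀ ∧ IsChain r J σ := by
  obtain ⟨x, hx0, hx⟩ := exists_int_chain (X := {σ : Measure ℝ // IsMarchenko r σ})
    (Rel := fun _ σ σ' => ∃ p : ℝ × ℝ, 0 < p.1 ∧ IsStep p.1 p.2 σ.1 σ'.1)
    (fun _ σ => by
      obtain ⟨σ', h', a, b, ha, hab⟩ := σ.2.exists_right hr0 hr1
      exact ⟨⟨σ', h'⟩, (a, b), ha, hab⟩)
    (fun _ σ' => by
      obtain ⟨σ, h', a, b, ha, hab⟩ := σ'.2.exists_left hr0 hr1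
      exact ⟨⟨σ, h'⟩, (a, b), ha, hab⟩)
    ⟨σ₀, h⟩
  choose p hp hstep using hx
  -- The coefficients attached to the link from site n - 1 to site n are those with index n, hence
  -- the shift.
  have hstep' : ∀ n, IsStep (p (n - 1)).1 (p (n - 1)).2 (x (n - 1)).1 (x n).1 := fun n => by
    have := hstep (n - 1)
    rwa [sub_add_cancel] at this
  have hR : r + 1 / r < r + 1 / r + 1 := by linarith
  have hbdd := bounded_of_splitting (a := fun n => (p (n - 1)).1) (b := fun n => (p (n - 1)).2)
    (fun n => hp _) fun s hs => exists_splitting (fun n => hp _) (fun n => (x n).2) hstep' hr0 hr1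
      rfl hs hR
  refine ⟨⟨fun n => (p (n - 1)).1, fun n => (p (n - 1)).2, fun n => hp _, ⟨_, fun n => (hbdd n).1⟩,
    ⟨_, fun n => (hbdd n).2⟩⟩, fun n => (x n).1, by simp only [hx0], fun n => (x n).2, hstep'⟩

variable {J : JacobiMatrix} {σ : ℤ → Measure ℝ}

theorem IsChain.norm_toCLM_le (h : IsChain r J σ) (hr0 : 0 < r) (hr1 : r ≤ 1)
    (hrR : r + 1 / r = R) : ‖J.toCLM‖ ≤ R := by
  refine JacobiMatrix.norm_toCLM_le (fun E hE u => ?_) (by rw [← hrR]; positivity)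
  obtain ⟨p, q, hp, hq, hpq, h1⟩ := exists_splitting J.a_pos h.marchenko h.step hr0 hr1 hrR
    (Or.inl rfl : (1 : ℝ) = 1 ∨ _) hE
  obtain ⟨p', q', hp', hq', hpq', h2⟩ := exists_splitting J.a_pos h.marchenko h.step hr0 hr1 hrR
    (Or.inr rfl : (-1 : ℝ) = 1 ∨ _) hE
  have e1 := JacobiMatrix.mul_re_inner_le (by simp) hp hq hpq h1 u
  have e2 := JacobiMatrix.mul_re_inner_le (by simp) hp' hq' hpq' h2 u
  rw [abs_le]
  constructor <;> linarith

theorem IsChain.im_pos (h : IsChain r J σ) (hr0 : 0 < r) (hr1 : r ≤ 1) (n : ℤ) {l : ℂ}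
    (hl : l ∈ upper) : 0 < (marchenkoF (σ n) l).im := by
  have := (h.marchenko n).finite
  exact im_marchenkoF_pos ((h.marchenko n).one_sub_moment_pos hr0 hr1) hl

/-- Prescribe the ratios f(n+1)/f(n) = -a n · Fₙ(l): the Riccati relation becomes the difference
equation, and the flux is (a n)²|f n|² Im Fₙ(l). Its sign does not depend on that of Im z. -/
theorem IsChain.exists_solution (h : IsChain r J σ) (hr0 : 0 < r) (hr1 : r ≤ 1) {l : ℂ}
    (hl : l ∈ upper) : ∃ f : ℤ → ℂ, J.IsSolution (-l - 1 / l) f ∧ f 0 = 1 ∧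
      f 1 = -(J.a 0 * marchenkoF (σ 0) l) ∧ ∀ n, 0 ≤ J.flux f n := by
  have hne : ∀ n, marchenkoF (σ n) l ≠ 0 := fun n h0 => by
    have := h.im_pos hr0 hr1 n hl
    rw [h0] at this
    simp at this
  obtain ⟨f, hf0, hf⟩ := exists_int_chain (X := ℂ)
    (Rel := fun n u v => v = -(J.a n * marchenkoF (σ n) l) * u) (fun n u => ⟨_, rfl⟩)
    (fun n v => ⟨-(v / (J.a n * marchenkoF (σ n) l)), by
      have := J.a_ne_zero n
      have := hne n
      field_simp⟩) 1
  refine ⟨f, fun n => ?_, hf0, by simpa [hf0] using hf 0, fun n => ?_⟩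
  · have e1 := hf (n - 1)
    rw [sub_add_cancel] at e1
    have e2 := h.step n l hl
    linear_combination (J.a n) * hf n - (-l - 1 / l - J.b n + J.a n ^ 2 * marchenkoF (σ n) l) * e1
      + J.a (n - 1) * f (n - 1) * e2
  · have e1 : conj (f n) * f (n + 1) = ((-(J.a n * ‖f n‖ ^ 2) : ℝ) : ℂ) * marchenkoF (σ n) l := by
      have h2 : (‖f n‖ : ℂ) ^ 2 = f n * conj (f n) := by
        rw [Complex.mul_conj, Complex.normSq_eq_norm_sq]
        norm_cast
      rw [hf n]
      push_cast
      rw [h2]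
      ring
    rw [JacobiMatrix.flux, e1, Complex.im_ofReal_mul]
    have := (h.im_pos hr0 hr1 n hl).le
    have := (J.a_pos n).le
    have : 0 ≤ J.a n * (J.a n * ‖f n‖ ^ 2 * (marchenkoF (σ n) l).im) := by positivity
    linarith

/-- The sums telescope into differences of the flux, and nonnegativity of the flux bounds them. -/
theorem JacobiMatrix.IsSolution.summable_plus {z : ℂ} {f : ℤ → ℂ} (hz : 0 < z.im)
    (hf : J.IsSolution z f) (h : ∀ n, 0 ≤ J.flux f n) : Summable fun n : ℕ => ‖f (n : ℤ)‖ ^ 2 := by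
  have h1 : ∀ N : ℕ, ∑ k ∈ Finset.range N, z.im * ‖f (k : ℤ)‖ ^ 2 =
      J.flux f (-1) - J.flux f (N - 1) := by
    intro N
    induction N with
    | zero => simp
    | succ N ih =>
      rw [Finset.sum_range_succ, ih]
      have := hf.flux_eq N
      push_cast
      rw [add_sub_cancel_right]
      linarith
  have h2 : Summable fun k : ℕ => z.im * ‖f (k : ℤ)‖ ^ 2 :=
    summable_of_sum_range_le (c := J.flux f (-1)) (fun k => by positivity) fun N => by
      rw [h1]
      linarith [h (N - 1)]
  exact (summable_mul_left_iff hz.ne').mp h2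

theorem JacobiMatrix.IsSolution.summable_minus {z : ℂ} {f : ℤ → ℂ} (hz : z.im < 0)
    (hf : J.IsSolution z f) (h : ∀ n, 0 ≤ J.flux f n) :
    Summable fun n : ℕ => ‖f (-(n : ℤ))‖ ^ 2 := by
  have h1 : ∀ N : ℕ, ∑ k ∈ Finset.range N, -z.im * ‖f (-(k : ℤ))‖ ^ 2 =
      J.flux f 0 - J.flux f (-N) := by
    intro N
    induction N with
    | zero => simp
    | succ N ih =>
      rw [Finset.sum_range_succ, ih]
      have := hf.flux_eq (-N)
      push_cast
      rw [neg_add, ← sub_eq_add_neg]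
      linarith
  have h2 : Summable fun k : ℕ => -z.im * ‖f (-(k : ℤ))‖ ^ 2 :=
    summable_of_sum_range_le (c := J.flux f 0)
      (fun k => mul_nonneg (by linarith) (sq_nonneg _)) fun N => by
        rw [h1]
        linarith [h (-N)]
  exact (summable_mul_left_iff (neg_ne_zero.mpr hz.ne)).mp h2

/-- One solution serves both half planes: f is f₊ at z if Im z > 0, and conj f is f₋ at conj z if Im
z < 0. The conjugations in the definition of `M` undo the latter. -/
theorem IsChain.M_eq (h : IsChain r J σ) (hr0 : 0 < r) (hr1 : r ≤ 1) {l : ℂ} (hl : l ∈ upper)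
    (hz : (-l - 1 / l).im ≠ 0) : J.M (-l - 1 / l) = marchenkoF (σ 0) l := by
  obtain ⟨f, hf, hf0, hf1, hflux⟩ := h.exists_solution hr0 hr1 hl
  have hfne : f ≠ 0 := fun h0 => by simp [h0] at hf0
  have ha := J.a_ne_zero 0
  rcases lt_or_gt_of_ne hz with hz | hz
  · have hw : J.IsWeylMinus (conj (-l - 1 / l)) fun n => conj (f n) := by
      refine ⟨hf.conj, fun h0 => hfne ?_, ?_⟩
      · ext n
        simpa using congrFun h0 n
      · simpa using hf.summable_minus hz hflux
    rw [J.M_of_im_neg hz, JacobiMatrix.mMinus_eq_of_isWeylMinus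
      (by rw [Complex.conj_im]; linarith) hw, hf0, hf1]
    simp only [map_one, mul_one, map_neg, map_mul, map_div₀, Complex.conj_conj,
      Complex.conj_ofReal]
    field_simp
  · have hw : J.IsWeylPlus (-l - 1 / l) f := ⟨hf, hfne, hf.summable_plus hz hflux⟩
    rw [J.M_of_im_pos hz, JacobiMatrix.mPlus_eq_of_isWeylPlus hz hw, hf0, hf1]
    field_simp

theorem hasStrictDerivAt_joukowsky {l : ℂ} (hl : l ≠ 0) :
    HasStrictDerivAt (fun l : ℂ => -l - 1 / l) (-1 + 1 / l ^ 2) l := by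
  have h := (hasStrictDerivAt_id l).neg.sub (hasStrictDerivAt_inv hl)
  have e : (fun l : ℂ => -l - 1 / l) = fun l : ℂ => -l - l⁻¹ := by
    ext l
    rw [one_div]
  rw [e]
  exact h.congr_deriv (by rw [one_div, sub_neg_eq_add])

theorem sq_ne_one_of_mem_upper {l : ℂ} (hl : l ∈ upper) : l ^ 2 ≠ 1 := by
  intro h
  have h1 : 0 < l.im := hl
  rcases sq_eq_one_iff.mp h with rfl | rfl <;> simp at h1

/-- The derivative of -l - 1/l vanishes only at ±1, so the map is open at l and every z near the
image has a preimage near l. No branch of the inverse has to be chosen. -/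
theorem IsChain.tendsto_M (h : IsChain r J σ) (hr0 : 0 < r) (hr1 : r ≤ 1) {l : ℂ}
    (hl : l ∈ upper) :
    Tendsto J.M (𝓝[{z | z.im ≠ 0}] (-l - 1 / l)) (𝓝 (marchenkoF (σ 0) l)) := by
  have hfin := (h.marchenko 0).finite
  have hl0 := ne_zero_of_mem_upper hl
  have hd : -1 + 1 / l ^ 2 ≠ 0 := by
    intro h0
    apply sq_ne_one_of_mem_upper hl
    field_simp at h0
    linear_combination -h0
  have hmap := (hasStrictDerivAt_joukowsky hl0).map_nhds_eq hd
  have hc : ContinuousAt (marchenkoF (σ 0)) l :=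
    (differentiableAt_marchenkoF (h.marchenko 0).support
      (notMem_image_ofReal (ne_of_gt hl) _)).continuousAt
  intro U hU
  have hV : {l | l ∈ upper ∧ marchenkoF (σ 0) l ∈ U} ∈ 𝓝 l :=
    inter_mem (isOpen_upper.mem_nhds hl) (hc hU)
  have hV2 := image_mem_map (m := fun l : ℂ => -l - 1 / l) hV
  rw [hmap] at hV2
  rw [mem_map, mem_nhdsWithin_iff_eventually]
  filter_upwards [hV2] with z hz hzim
  obtain ⟨w, ⟨hw, hwU⟩, rfl⟩ := hz
  rw [mem_preimage, h.M_eq hr0 hr1 hw hzim]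
  exact hwU

theorem exists_joukowsky_eq_ofReal {x : ℝ} (hx : x ∈ Ioo (-2 : ℝ) 2) :
    ∃ l ∈ upper, -l - 1 / l = (x : ℂ) := by
  have h0 : 0 < 4 - x ^ 2 := by nlinarith [hx.1, hx.2]
  have hs := Real.sq_sqrt h0.le
  have hs0 := Real.sqrt_pos.mpr h0
  set s := Real.sqrt (4 - x ^ 2)
  have hs' : (s : ℂ) ^ 2 = 4 - (x : ℂ) ^ 2 := by exact_mod_cast hs
  have hl : (-x / 2 + s / 2 * Complex.I : ℂ) ∈ upper := by
    have : (-x / 2 + s / 2 * Complex.I : ℂ) = ((-x / 2 : ℝ) : ℂ) + ((s / 2 : ℝ) : ℂ) * Complex.I := by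
      push_cast
      rfl
    change 0 < Complex.im _
    rw [this, Complex.add_im, Complex.ofReal_im, JacobiMatrix.im_ofReal_mul_I]
    linarith
  refine ⟨_, hl, ?_⟩
  have := ne_zero_of_mem_upper hl
  rw [eq_comm, eq_sub_iff_add_eq, ← eq_sub_iff_add_eq', div_eq_iff this]
  linear_combination (-1 / 4 : ℂ) * hs' + (s : ℂ) ^ 2 / 4 * Complex.I_sq

theorem tendsto_vertical (x : ℝ) {c : ℝ} (hc : c ≠ 0) :
    Tendsto (fun y : ℝ => (x : ℂ) + (c * y : ℝ) * Complex.I) (𝓝[>] 0) (𝓝[{z | z.im ≠ 0}] (x : ℂ)) := by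
  refine tendsto_nhdsWithin_iff.mpr ⟨?_, ?_⟩
  · have : Continuous fun y : ℝ => (x : ℂ) + (c * y : ℝ) * Complex.I := by fun_prop
    have h := this.tendsto 0
    simp only [mul_zero, Complex.ofReal_zero, zero_mul, add_zero] at h
    exact h.mono_left nhdsWithin_le_nhds
  · filter_upwards [self_mem_nhdsWithin] with y hy
    have hy' : y ≠ 0 := ne_of_gt hy
    rw [Complex.add_im, Complex.ofReal_im, JacobiMatrix.im_ofReal_mul_I, zero_add]
    exact mul_ne_zero hc hy'

theorem IsChain.tendsto_mPlus (h : IsChain r J σ) (hr0 : 0 < r) (hr1 : r ≤ 1) {l : ℂ}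
    (hl : l ∈ upper) {x : ℝ} (hx : -l - 1 / l = (x : ℂ)) :
    Tendsto (fun y : ℝ => J.mPlus (x + y * Complex.I)) (𝓝[>] 0) (𝓝 (marchenkoF (σ 0) l)) := by
  have h1 := h.tendsto_M hr0 hr1 hl
  rw [hx] at h1
  refine (h1.comp (tendsto_vertical x one_ne_zero)).congr' ?_
  filter_upwards [self_mem_nhdsWithin] with y hy
  rw [Function.comp_apply, one_mul, J.M_of_im_pos]
  simpa using hy

theorem IsChain.tendsto_mMinus (h : IsChain r J σ) (hr0 : 0 < r) (hr1 : r ≤ 1) {l : ℂ}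
    (hl : l ∈ upper) {x : ℝ} (hx : -l - 1 / l = (x : ℂ)) :
    Tendsto (fun y : ℝ => J.mMinus (x + y * Complex.I)) (𝓝[>] 0)
      (𝓝 (-conj (marchenkoF (σ 0) l))) := by
  have h1 := h.tendsto_M hr0 hr1 hl
  rw [hx] at h1
  have h2 := h1.comp (tendsto_vertical x (neg_ne_zero.mpr one_ne_zero))
  refine (((Complex.continuous_conj.tendsto _).comp h2).neg).congr' ?_
  filter_upwards [self_mem_nhdsWithin] with y hy
  rw [Function.comp_apply, Function.comp_apply, J.M_of_im_neg]
  · simp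
  · simpa using hy

/-- The function F is continuous at the point of the unit semicircle over x, so M has the same limit
from above and from below, here at every x in (-2, 2). -/
theorem IsChain.isReflectionless (h : IsChain r J σ) (hr0 : 0 < r) (hr1 : r ≤ 1) :
    J.IsReflectionless (Ioo (-2) 2) := by
  refine (ae_restrict_iff' measurableSet_Ioo).mpr (Eventually.of_forall fun x hx => ?_)
  obtain ⟨l, hl, hx⟩ := exists_joukowsky_eq_ofReal hx
  exact ⟨_, _, h.tendsto_mPlus hr0 hr1 hl hx, h.tendsto_mMinus hr0 hr1 hl hx, by simp⟩

theorem IsChain.represents (h : IsChain r J σ) (hr0 : 0 < r) (hr1 : r ≤ 1) :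
    Represents (σ 0) J := by
  intro l hl
  rw [JacobiMatrix.F]
  by_cases hz : (-l - 1 / l).im = 0
  · have hx : -l - 1 / l = (((-l - 1 / l).re : ℝ) : ℂ) := Complex.ext rfl (by simpa using hz)
    rw [hx, JacobiMatrix.M, if_neg (by simp), if_neg (by simp)]
    exact (h.tendsto_mPlus hr0 hr1 hl hx).limUnder_eq
  · exact h.M_eq hr0 hr1 hl hz

theorem IsMarchenko.exists_mem_MClass {σ₀ : Measure ℝ} (h : IsMarchenko r σ₀) (hr0 : 0 < r)
    (hr1 : r ≤ 1) (hrR : r + 1 / r = R) : ∃ J ∈ MClass R, Represents σ₀ J := by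
  obtain ⟨J, σ, rfl, hJ⟩ := h.exists_isChain hr0 hr1
  exact ⟨J, ⟨hJ.isReflectionless hr0 hr1, hJ.norm_toCLM_le hr0 hr1 hrR⟩, hJ.represents hr0 hr1⟩

end Chain

/-! ### The inequality between F(x) and F(1/x) from definiteness of E - J -/

namespace JacobiMatrix

section Gap

variable {J : JacobiMatrix} {E : ℝ}

/-- The trial vector for the quadratic form of `E - J`: the solution that decays at both ends of
the line, normalized at `0`. -/
def trial (J : JacobiMatrix) (E : ℝ) : SeqSpace :=
  (J.a 0 : ℂ) • J.green (Ioi 0) 1 E + (J.green (Iic 0) 0 E 0)⁻¹ • J.green (Iic 0) 0 E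

theorem trial_apply (J : JacobiMatrix) (E : ℝ) (n : ℤ) : J.trial E n =
    J.a 0 * J.green (Ioi 0) 1 E n + (J.green (Iic 0) 0 E 0)⁻¹ * J.green (Iic 0) 0 E n := rfl

theorem trial_zero (hE : ‖J.toCLM‖ < |E|) : J.trial E 0 = 1 := by
  have hreg : J.Regular E := Or.inr (by simpa using hE)
  rw [trial_apply, green_apply_of_notMem hreg (by simp) (by simp), mul_zero, zero_add,
    inv_mul_cancel₀ (green_real_ne_zero hE _ _)]

/-- The two half line Green vectors are scaled so that the glued vector solves the equation at every
site except 0. The defect there is a₀² times the sum of the values of m₋ and m₊ continued to E. -/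
theorem sub_toCLM_trial (hE : ‖J.toCLM‖ < |E|) : (E : ℂ) • J.trial E - J.toCLM (J.trial E) =
    lp.single 2 0 ((J.green (Iic 0) 0 E 0)⁻¹ - (J.a 0 : ℂ) ^ 2 * J.green (Ioi 0) 1 E 1) := by
  have hreg : J.Regular E := Or.inr (by simpa using hE)
  have hg := green_real_ne_zero hE (Iic 0) 0
  have m1 : (1 : ℤ) ∈ Ioi (0 : ℤ) := by simp
  have m0 : (0 : ℤ) ∈ Iic (0 : ℤ) := by simp
  have zp : ∀ n : ℤ, n ≤ 0 → J.green (Ioi 0) 1 E n = 0 := fun n hn =>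
    green_apply_of_notMem hreg m1 (by simpa using hn)
  have zm : ∀ n : ℤ, 0 < n → J.green (Iic 0) 0 E n = 0 := fun n hn =>
    green_apply_of_notMem hreg m0 (by simpa using hn)
  ext n
  rw [lp.coeFn_sub, Pi.sub_apply, lp.coeFn_smul, Pi.smul_apply, smul_eq_mul, toCLM_apply,
    lp.single_apply, Pi.single_apply]
  simp only [trial_apply]
  rcases lt_trichotomy n 0 with hn | rfl | hn
  · rw [if_neg hn.ne, zp n hn.le, zp (n + 1) (by lia), zp (n - 1) (by lia)]
    have := green_apply_of_mem hreg m0 (show n ∈ Iic (0 : ℤ) from hn.le)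
    rw [if_neg hn.ne] at this
    linear_combination (J.green (Iic 0) 0 E 0)⁻¹ * this
  · rw [if_pos rfl, zp 0 le_rfl, zp (0 - 1) (by lia), zm (0 + 1) (by lia), zero_add]
    have := green_apply_of_mem hreg m0 m0
    rw [if_pos rfl, zm (0 + 1) (by lia)] at this
    linear_combination (J.green (Iic 0) 0 E 0)⁻¹ * this
  · rw [if_neg hn.ne', zm n hn, zm (n + 1) (by lia)]
    have := green_apply_of_mem hreg m1 (show n ∈ Ioi (0 : ℤ) from hn)
    rcases eq_or_ne n 1 with rfl | h1
    · rw [if_pos rfl, zp (1 - 1) (by lia)] at this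
      rw [sub_self, zp 0 le_rfl, inv_mul_cancel₀ hg]
      simp only [sub_self] at this
      linear_combination J.a 0 * this
    · rw [if_neg h1] at this
      rw [zm (n - 1) (by lia)]
      linear_combination J.a 0 * this

/-- The trial vector is 1 at site 0, so the form of E - J on it equals the defect. This is x(F(1/x)
- F(x)) > 0 up to a positive factor. -/
theorem gap_pos (hE : ‖J.toCLM‖ < |E|) :
    0 < E * ((J.green (Iic 0) 0 E 0)⁻¹ - (J.a 0 : ℂ) ^ 2 * J.green (Ioi 0) 1 E 1).re := by
  have hne : J.trial E ≠ 0 := fun h0 => by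
    have := trial_zero hE
    rw [h0] at this
    simp at this
  have h := mul_re_inner_sub_pos hE hne
  rw [sub_toCLM_trial hE, lp.inner_single_right, trial_zero hE] at h
  simpa using h

end Gap

/-! ### Continuation of M across (-2,2), and boundary behaviour of F -/

section Continuation

variable {J : JacobiMatrix} {z : ℂ}

theorem differentiableAt_mPlus (J : JacobiMatrix) (hz : 0 < z.im) :
    DifferentiableAt ℂ J.mPlus z := by
  refine (differentiableAt_green (J := J) (Regular.of_im_pos hz) (Ioi 0) 1 1).neg.congr_of_eventuallyEq ?_
  filter_upwards [isOpen_upper.mem_nhds hz] with w hw using J.mPlus_eq_green hw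

theorem differentiableAt_mMinus (J : JacobiMatrix) (hz : 0 < z.im) :
    DifferentiableAt ℂ J.mMinus z := by
  have h : DifferentiableAt ℂ (fun z => 1 / ((J.a 0 : ℂ) ^ 2 * J.green (Iic 0) 0 z 0)) z :=
    (differentiableAt_const _).div ((differentiableAt_green (Regular.of_im_pos hz)
      (Iic 0) 0 0).const_mul _)
      (mul_ne_zero (pow_ne_zero 2 (J.a_ne_zero 0)) (J.green_minus_ne_zero hz))
  refine h.congr_of_eventuallyEq ?_
  filter_upwards [isOpen_upper.mem_nhds hz] with w hw using J.mMinus_eq_green hw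

theorem differentiableAt_M (J : JacobiMatrix) (hz : z.im ≠ 0) : DifferentiableAt ℂ J.M z := by
  rcases lt_or_gt_of_ne hz with hz | hz
  · have h1 : DifferentiableAt ℂ J.mMinus (conj z) :=
      J.differentiableAt_mMinus (by rw [Complex.conj_im]; linarith)
    have h2 := h1.conj_conj
    rw [Complex.conj_conj] at h2
    refine h2.neg.congr_of_eventuallyEq ?_
    filter_upwards [(isOpen_lt Complex.continuous_im continuous_const).mem_nhds hz] with w hw
    exact J.M_of_im_neg hw
  · refine (J.differentiableAt_mPlus hz).congr_of_eventuallyEq ?_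
    filter_upwards [isOpen_upper.mem_nhds hz] with w hw using J.M_of_im_pos hw

theorem im_M_pos (J : JacobiMatrix) (hz : z.im ≠ 0) : 0 < (J.M z).im := by
  rcases lt_or_gt_of_ne hz with hz | hz
  · rw [J.M_of_im_neg hz, Complex.neg_im, Complex.conj_im, neg_neg, ← mMinusAt_zero]
    exact J.im_mMinusAt_pos 0 (by rw [Complex.conj_im]; linarith)
  · rw [J.M_of_im_pos hz, ← mPlusAt_zero]
    exact J.im_mPlusAt_pos 0 hz

/-- The identity m₊ = -conj m₋ says that the vertical limits of M from above and from below
coincide. -/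
theorem IsReflectionless.tendsto_M {S : Set ℝ} (h : J.IsReflectionless S) (hS : MeasurableSet S) :
    ∀ᵐ x : ℝ, x ∈ S → ∃ w, Tendsto (fun y : ℝ => J.M (x + y * Complex.I)) (𝓝[≠] 0) (𝓝 w) := by
  filter_upwards [(ae_restrict_iff' hS).mp h] with x hx hxS
  obtain ⟨wp, wm, hp, hm, hw⟩ := hx hxS
  refine ⟨wp, ?_⟩
  rw [← nhdsLT_sup_nhdsGT, tendsto_sup]
  constructor
  · have hneg : Tendsto (fun y : ℝ => -y) (𝓝[<] 0) (𝓝[>] 0) := by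
      refine tendsto_nhdsWithin_iff.mpr ⟨?_, ?_⟩
      · have h0 := (continuous_neg (G := ℝ)).tendsto 0
        rw [neg_zero] at h0
        exact h0.mono_left nhdsWithin_le_nhds
      · filter_upwards [self_mem_nhdsWithin] with y hy using neg_pos.mpr (mem_Iio.mp hy)
    have h1 := ((Complex.continuous_conj.tendsto _).comp (hm.comp hneg)).neg
    rw [← hw] at h1
    refine h1.congr' ?_
    filter_upwards [self_mem_nhdsWithin] with y hy
    have hy' : ((x : ℂ) + y * Complex.I).im < 0 := by simpa using hy
    rw [J.M_of_im_neg hy']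
    simp
  · refine hp.congr' ?_
    filter_upwards [self_mem_nhdsWithin] with y hy
    have hy' : 0 < ((x : ℂ) + y * Complex.I).im := by simpa using hy
    rw [J.M_of_im_pos hy']

/-- The extension exists by gluing. It agrees with `M` at every real point of the interval because
`M` is defined there as a limit from above, which the continuous extension computes. -/
theorem IsReflectionless.differentiableOn_M {a b : ℝ} (h : J.IsReflectionless (Ioo a b)) :
    DifferentiableOn ℂ J.M (strip a b) := by
  obtain ⟨ψ, hψ, heq⟩ := exists_extension_of_im_pos (N := J.M) (a := a) (b := b)
    (fun z _ hz => J.differentiableAt_M hz) (fun z _ hz => J.im_M_pos hz)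
    (h.tendsto_M measurableSet_Ioo)
  refine hψ.congr fun z hz => ?_
  by_cases hzi : z.im = 0
  · have hzx : z = (z.re : ℂ) := Complex.ext rfl (by simpa using hzi)
    rw [M, if_neg (by simp [hzi]), if_neg (by simp [hzi])]
    refine Tendsto.limUnder_eq ?_
    have hc : ContinuousAt ψ z := (hψ.continuousOn).continuousAt (isOpen_strip.mem_nhds hz)
    have hv : Tendsto (fun y : ℝ => z + y * Complex.I) (𝓝[>] 0) (𝓝 z) := by
      have : Continuous fun y : ℝ => z + y * Complex.I := by fun_prop
      have h1 := this.tendsto 0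
      simp only [Complex.ofReal_zero, zero_mul, add_zero] at h1
      exact h1.mono_left nhdsWithin_le_nhds
    refine (hc.tendsto.comp hv).congr' ?_
    filter_upwards [self_mem_nhdsWithin] with y hy
    have hy' : 0 < y := hy
    have him : (z + y * Complex.I).im = y := by simp [hzi]
    rw [Function.comp_apply, heq _ _ (by rw [him]; exact hy'.ne'),
      J.M_of_im_pos (by rwa [him])]
    have : (z + y * Complex.I).re = z.re := by simp
    change (z + y * Complex.I).re ∈ Ioo a b
    rw [this]
    exact hz
  · exact (heq z hz hzi).symm

/-- A real value forces |l| = 1, and then -l - 1/l = -2 Re l. -/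
theorem joukowsky_re_mem {l : ℂ} (hl : l ∈ upper) (h : (-l - 1 / l).im = 0) :
    -l - 1 / l ∈ strip (-2) 2 := by
  have hl' : 0 < l.im := hl
  have hl0 := Complex.normSq_pos.mpr (ne_zero_of_mem_upper hl)
  rw [im_joukowsky] at h
  have h1 : Complex.normSq l = 1 := by
    have := (mul_eq_zero.mp h).resolve_left hl'.ne'
    field_simp at this
    linarith
  have h2 : (-l - 1 / l).re = -2 * l.re := by
    rw [Complex.sub_re, Complex.neg_re, one_div, Complex.inv_re, h1]
    ring
  change (-l - 1 / l).re ∈ Ioo _ _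
  rw [h2]
  rw [Complex.normSq_apply] at h1
  constructor <;> nlinarith

theorem IsReflectionless.differentiableAt_F (h : J.IsReflectionless (Ioo (-2) 2)) {l : ℂ}
    (hl : l ∈ upper) : DifferentiableAt ℂ J.F l := by
  have h1 : DifferentiableAt ℂ J.M (-l - 1 / l) := by
    by_cases hz : (-l - 1 / l).im = 0
    · exact h.differentiableOn_M.differentiableAt (isOpen_strip.mem_nhds (joukowsky_re_mem hl hz))
    · exact J.differentiableAt_M hz
  exact h1.comp l (hasStrictDerivAt_joukowsky (ne_zero_of_mem_upper hl)).hasDerivAt.differentiableAt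

theorem IsReflectionless.im_F_nonneg (h : J.IsReflectionless (Ioo (-2) 2)) {l : ℂ}
    (hl : l ∈ upper) : 0 ≤ (J.F l).im := by
  by_cases hz : (-l - 1 / l).im = 0
  · have hmem := joukowsky_re_mem hl hz
    have hc : ContinuousAt J.M (-l - 1 / l) :=
      (h.differentiableOn_M.differentiableAt (isOpen_strip.mem_nhds hmem)).continuousAt
    rw [F]
    have hx : -l - 1 / l = (((-l - 1 / l).re : ℝ) : ℂ) := Complex.ext rfl (by simpa using hz)
    rw [hx] at hc ⊢
    have ht := (Complex.continuous_im.tendsto _).comp (hc.tendsto.comp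
      ((tendsto_vertical _ one_ne_zero).mono_right nhdsWithin_le_nhds))
    refine ge_of_tendsto ht ?_
    filter_upwards [self_mem_nhdsWithin] with y hy
    refine (J.im_M_pos ?_).le
    have hy' : y ≠ 0 := ne_of_gt hy
    simpa using hy'
  · exact (J.im_M_pos hz).le

theorem continuousAt_joukowsky_ofReal {x : ℝ} (hx0 : x ≠ 0) :
    Tendsto (fun l : ℂ => -l - 1 / l) (𝓝 (x : ℂ)) (𝓝 ((-x - 1 / x : ℝ) : ℂ)) := by
  have := (hasStrictDerivAt_joukowsky (l := (x : ℂ)) (by exact_mod_cast hx0)).hasDerivAt.continuousAt.tendsto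
  push_cast
  exact this

theorem im_joukowsky_pos {l : ℂ} (hl : l ∈ upper) (h : ‖l‖ < 1) : 0 < (-l - 1 / l).im := by
  have hl0 := Complex.normSq_pos.mpr (ne_zero_of_mem_upper hl)
  have h1 : Complex.normSq l < 1 := by
    rw [Complex.normSq_eq_norm_sq]
    nlinarith [norm_nonneg l]
  rw [im_joukowsky]
  have : 1 < 1 / Complex.normSq l := by rwa [lt_div_iff₀ hl0, one_mul]
  exact mul_pos hl (by linarith)

theorem im_joukowsky_neg {l : ℂ} (hl : l ∈ upper) (h : 1 < ‖l‖) : (-l - 1 / l).im < 0 := by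
  have hl0 := Complex.normSq_pos.mpr (ne_zero_of_mem_upper hl)
  have h1 : 1 < Complex.normSq l := by
    rw [Complex.normSq_eq_norm_sq]
    nlinarith [norm_nonneg l]
  rw [im_joukowsky]
  have : 1 / Complex.normSq l < 1 := by rwa [div_lt_iff₀ hl0, one_mul]
  exact mul_neg_of_pos_of_neg hl (by linarith)

/-- Near x the map l ↦ -l - 1/l sends the upper half plane to Im z > 0, where F is minus a Green
function that is continuous, and real, at E outside the norm disc. -/
theorem tendsto_F_inner {x E : ℝ} (hx0 : x ≠ 0) (hx : |x| < 1) (hxE : -x - 1 / x = E)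
    (hE : ‖J.toCLM‖ < |E|) :
    Tendsto J.F (𝓝[upper] (x : ℂ)) (𝓝 ((-(J.green (Ioi 0) 1 E 1).re : ℝ) : ℂ)) := by
  have hreg : J.Regular E := Or.inr (by simpa using hE)
  have hval : ((-(J.green (Ioi 0) 1 E 1).re : ℝ) : ℂ) = -J.green (Ioi 0) 1 E 1 :=
    Complex.ext (by simp) (by simp [im_green_real hreg])
  rw [hval]
  have h1 := (differentiableAt_green hreg (Ioi 0) 1 1).continuousAt.tendsto
  have h2 := continuousAt_joukowsky_ofReal hx0
  rw [hxE] at h2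
  refine ((h1.comp (h2.mono_left nhdsWithin_le_nhds)).neg).congr' ?_
  have h3 : ∀ᶠ l : ℂ in 𝓝[upper] (x : ℂ), ‖l‖ < 1 :=
    nhdsWithin_le_nhds ((isOpen_lt continuous_norm continuous_const).mem_nhds (by simpa using hx))
  filter_upwards [self_mem_nhdsWithin, h3] with l hl hl1
  have hz := im_joukowsky_pos hl hl1
  rw [F, J.M_of_im_pos hz, J.mPlus_eq_green hz]
  rfl

/-- Now Im z < 0, so F is computed from m₋, the reciprocal of a Green function of the left half line
that is real and nonzero at E. -/
theorem tendsto_F_outer {x E : ℝ} (hx : 1 < |x|) (hxE : -x - 1 / x = E)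
    (hE : ‖J.toCLM‖ < |E|) : Tendsto J.F (𝓝[upper] (x : ℂ))
      (𝓝 ((-(1 / (J.a 0 ^ 2 * (J.green (Iic 0) 0 E 0).re)) : ℝ) : ℂ)) := by
  have hx0 : x ≠ 0 := abs_pos.mp (zero_lt_one.trans hx)
  have hreg : J.Regular E := Or.inr (by simpa using hE)
  have hgr : (((J.green (Iic 0) 0 E 0).re : ℝ) : ℂ) = J.green (Iic 0) 0 E 0 :=
    Complex.ext (by simp) (by simp [im_green_real hreg])
  have hval : ((-(1 / (J.a 0 ^ 2 * (J.green (Iic 0) 0 E 0).re)) : ℝ) : ℂ) =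
      -conj (1 / ((J.a 0 : ℂ) ^ 2 * J.green (Iic 0) 0 E 0)) := by
    have h0 : 1 / ((J.a 0 : ℂ) ^ 2 * J.green (Iic 0) 0 E 0) =
        ((1 / (J.a 0 ^ 2 * (J.green (Iic 0) 0 E 0).re) : ℝ) : ℂ) := by
      push_cast
      rw [hgr]
    rw [h0, Complex.conj_ofReal, Complex.ofReal_neg]
  rw [hval]
  have hne : (J.a 0 : ℂ) ^ 2 * J.green (Iic 0) 0 E 0 ≠ 0 :=
    mul_ne_zero (pow_ne_zero 2 (J.a_ne_zero 0)) (green_real_ne_zero hE _ _)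
  have h1 := tendsto_const_nhds (x := (1 : ℂ)).div
    ((differentiableAt_green hreg (Iic 0) 0 0).continuousAt.tendsto.const_mul
      ((J.a 0 : ℂ) ^ 2)) hne
  have h2 := continuousAt_joukowsky_ofReal hx0
  rw [hxE] at h2
  have h2' := (Complex.continuous_conj.tendsto _).comp (h2.mono_left (nhdsWithin_le_nhds (s := upper)))
  rw [Complex.conj_ofReal] at h2'
  refine (((Complex.continuous_conj.tendsto _).comp (h1.comp h2')).neg).congr' ?_
  have h3 : ∀ᶠ l : ℂ in 𝓝[upper] (x : ℂ), 1 < ‖l‖ :=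
    nhdsWithin_le_nhds ((isOpen_lt continuous_const continuous_norm).mem_nhds (by simpa using hx))
  filter_upwards [self_mem_nhdsWithin, h3] with l hl hl1
  have hz := im_joukowsky_neg hl hl1
  rw [F, J.M_of_im_neg hz, J.mMinus_eq_green (by rw [Complex.conj_im]; linarith)]
  rfl

theorem tendsto_one_div_sub_self :
    Tendsto (fun y : ℝ => 1 / y - y) (𝓝[>] 0) atTop := by
  have h1 : Tendsto (fun y : ℝ => 1 / y) (𝓝[>] 0) atTop := by
    simpa using tendsto_inv_nhdsGT_zero (𝕜 := ℝ)
  have h2 : Tendsto (fun y : ℝ => -y) (𝓝[>] 0) (𝓝 (-0)) :=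
    (continuous_neg.tendsto 0).mono_left nhdsWithin_le_nhds
  exact h1.atTop_add h2

/-- Carries the behaviour of m₊ at i∞ over to the behaviour of F at 0 along the imaginary axis. -/
theorem F_mul_I {y : ℝ} (hy0 : 0 < y) (hy1 : y < 1) :
    J.F (y * Complex.I) = J.mPlusAt 0 ((1 / y - y : ℝ) * Complex.I) := by
  have hz : -((y : ℂ) * Complex.I) - 1 / (y * Complex.I) = ((1 / y - y : ℝ) : ℂ) * Complex.I := by
    have hy : (y : ℂ) ≠ 0 := by exact_mod_cast hy0.ne'
    have hI := Complex.I_ne_zero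
    push_cast
    field_simp
    linear_combination (-1 : ℂ) * Complex.I_sq
  rw [F, hz, J.M_of_im_pos]
  · rfl
  · rw [im_ofReal_mul_I, sub_pos, lt_div_iff₀ hy0]
    nlinarith

theorem tendsto_F_imagZero (J : JacobiMatrix) : Tendsto J.F imagZero (𝓝 0) := by
  refine tendsto_map'_iff.mpr (((J.tendsto_mPlusAt 0).comp tendsto_one_div_sub_self).congr' ?_)
  filter_upwards [Ioo_mem_nhdsGT (zero_lt_one' ℝ)] with y hy
  exact (F_mul_I hy.1 hy.2).symm

theorem tendsto_F_div_imagZero (J : JacobiMatrix) :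
    Tendsto (fun l => J.F l / l) imagZero (𝓝 1) := by
  have h1 := (J.tendsto_mul_mPlusAt 0).comp tendsto_one_div_sub_self
  have h2 : Tendsto (fun y : ℝ => (-(1 / (1 - (y : ℂ) ^ 2)))) (𝓝[>] 0) (𝓝 (-1)) := by
    have h3 : ContinuousAt (fun y : ℝ => (-(1 / (1 - (y : ℂ) ^ 2)))) 0 := by
      refine (continuousAt_const.div ?_ (by simp)).neg
      fun_prop
    have h4 := h3.tendsto
    simp only [Complex.ofReal_zero] at h4
    norm_num at h4
    simpa using h4.mono_left nhdsWithin_le_nhds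
  have h3 := h1.mul h2
  rw [neg_mul_neg, one_mul] at h3
  refine tendsto_map'_iff.mpr (h3.congr' ?_)
  filter_upwards [Ioo_mem_nhdsGT (zero_lt_one' ℝ)] with y hy
  simp only [Function.comp_apply]
  rw [F_mul_I hy.1 hy.2]
  have hy0 : (y : ℂ) ≠ 0 := by exact_mod_cast hy.1.ne'
  have hI := Complex.I_ne_zero
  have hy1 : 1 - (y : ℂ) ^ 2 ≠ 0 := by
    have : 1 - y ^ 2 ≠ 0 := by nlinarith [hy.1, hy.2]
    exact_mod_cast this
  generalize J.mPlusAt 0 _ = m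
  push_cast
  field_simp
  linear_combination (-m) * Complex.I_sq

end Continuation

end JacobiMatrix

/-! ### From the Jacobi matrix to the measure, and conclusion -/

theorem exists_isMarchenko {J : JacobiMatrix} {R r : ℝ} (hJ : J ∈ MClass R) (hr0 : 0 < r)
    (hr1 : r ≤ 1) (hrR : r + 1 / r = R) : ∃ σ, IsMarchenko r σ ∧ Represents σ J := by
  obtain ⟨hrefl, hnorm⟩ := hJ
  have hE : ∀ x : ℝ, x ≠ 0 → |x| < r → ‖J.toCLM‖ < |-x - 1 / x| := fun x hx0 hx =>
    hnorm.trans_lt (lt_abs_joukowsky hr1 hrR hx0 hx)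
  have hinner : ∀ x : ℝ, x ≠ 0 → |x| < r → _ := fun x hx0 hx =>
    JacobiMatrix.tendsto_F_inner hx0 (hx.trans_le hr1) rfl (hE x hx0 hx)
  have houter : ∀ x : ℝ, x ≠ 0 → |x| < r → _ := fun x hx0 hx =>
    JacobiMatrix.tendsto_F_outer (J := J) (x := 1 / x) (E := -x - 1 / x)
      (by rw [abs_div, abs_one, lt_div_iff₀ (abs_pos.mpr hx0), one_mul]; exact hx.trans_le hr1)
      (by rw [one_div_one_div]; ring) (hE x hx0 hx)
  obtain ⟨A, B, c, σ, hB0, hfin, hσ, hrep⟩ := exists_herglotz_of_insert_zero (N := J.F)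
    (S := bands r) (fun l hl => (hrefl.differentiableAt_F hl).differentiableWithinAt)
    (fun l hl => hrefl.im_F_nonneg hl) (isCompact_bands r) (fun x hx hx0 => by
      have : ∃ v : ℝ, Tendsto J.F (𝓝[upper] (x : ℂ)) (𝓝 (v : ℂ)) := by
        rcases cases_notMem_bands hr0 hx hx0 with h1 | ⟨y, hy0, hy, rfl⟩
        · exact ⟨_, hinner x hx0 h1⟩
        · exact ⟨_, houter y hy0 hy⟩
      obtain ⟨v, hv⟩ := this
      have h2 := (Complex.continuous_im.tendsto _).comp hv
      rwa [Complex.ofReal_im] at h2)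
  obtain ⟨hB, hF⟩ := eq_marchenkoF_of_normalized hr0 hσ hrep J.tendsto_F_imagZero
    J.tendsto_F_div_imagZero
  refine ⟨σ, ⟨hfin, hσ, fun x hx0 hx => ?_⟩, fun l hl => hF l hl⟩
  have hreal : ∀ (x v : ℝ), x ∉ bands r → Tendsto J.F (𝓝[upper] (x : ℂ)) (𝓝 (v : ℂ)) →
      marchenkoR σ x = v := fun x v hx hv => by
    have hne := neBot_nhdsWithin_upper x
    have h1 := (continuousAt_marchenkoF_ofReal hσ hx).tendsto.mono_left
      (nhdsWithin_le_nhds (s := upper))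
    rw [marchenkoF_ofReal] at h1
    have h2 := tendsto_nhds_unique (h1.congr' (by
      filter_upwards [self_mem_nhdsWithin] with l hl using (hF l hl).symm)) hv
    exact_mod_cast h2
  rw [hreal x _ (notMem_bands_of_abs_lt hx) (hinner x hx0 hx),
    hreal (1 / x) _ (notMem_bands_one_div hx0 hx) (houter x hx0 hx)]
  have hgap := JacobiMatrix.gap_pos (hE x hx0 hx)
  have hreg : J.Regular ((-x - 1 / x : ℝ) : ℂ) := Or.inr (by
    rw [Complex.norm_real]; exact hE x hx0 hx)
  have hg : J.green (Iic 0) 0 ((-x - 1 / x : ℝ) : ℂ) 0 =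
      ((J.green (Iic 0) 0 ((-x - 1 / x : ℝ) : ℂ) 0).re : ℂ) :=
    Complex.ext (by simp) (by simpa using JacobiMatrix.im_green_real hreg (Iic 0) 0)
  have hgne := JacobiMatrix.green_real_ne_zero (hE x hx0 hx) (Iic 0) 0
  set g := (J.green (Iic 0) 0 ((-x - 1 / x : ℝ) : ℂ) 0).re
  rw [hg] at hgne
  have hgne' : g ≠ 0 := Complex.ofReal_ne_zero.mp hgne
  rw [hg, Complex.sub_re, ← Complex.ofReal_inv, Complex.ofReal_re, ← Complex.ofReal_pow,
    Complex.re_ofReal_mul] at hgap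
  set p := (J.green (Ioi 0) 1 ((-x - 1 / x : ℝ) : ℂ) 1).re
  have ha := J.a_pos 0
  -- Uses F(x) = -p, F(1/x) = -1/(a₀² g) and -x - 1/x = -x(1 + 1/x²): the definiteness inequality is
  -- a positive multiple of the one to be proved.
  have key : (-x - 1 / x) * (g⁻¹ - J.a 0 ^ 2 * p) =
      (1 + 1 / x ^ 2) * J.a 0 ^ 2 * (x * (-(1 / (J.a 0 ^ 2 * g)) - -p)) := by
    field_simp
    ring
  rw [key] at hgap
  exact (mul_pos_iff_of_pos_left (by positivity)).mp hgap

end Marchenko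

end

theorem mainTheorem1 (R r : ℝ) (hR : 2 ≤ R) (hr0 : 0 < r) (hr1 : r ≤ 1) (hrR : r + 1 / r = R) :
    (∀ J : Marchenko.JacobiMatrix,
      J ∈ Marchenko.MClass R ↔
        ∃ σ : MeasureTheory.Measure ℝ,
          Marchenko.IsAdmissible R r σ ∧ Marchenko.Represents σ J) ∧
    (∀ J ∈ Marchenko.MClass R,
      ∃! σ : MeasureTheory.Measure ℝ,
        Marchenko.IsAdmissible R r σ ∧ Marchenko.Represents σ J) ∧
    (∀ σ : MeasureTheory.Measure ℝ, Marchenko.IsAdmissible R r σ →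
      ∃! J : Marchenko.JacobiMatrix,
        J ∈ Marchenko.MClass R ∧ Marchenko.Represents σ J) := by
  simp only [Marchenko.isAdmissible_iff_isMarchenko hr0 hr1 hrR]
  have huniq : ∀ (σ : MeasureTheory.Measure ℝ) (J J' : Marchenko.JacobiMatrix),
      Marchenko.Represents σ J → Marchenko.Represents σ J' → J = J' := fun σ J J' h h' =>
    Marchenko.JacobiMatrix.eq_of_F_eq fun l hl => (h l hl).trans (h' l hl).symm
  refine ⟨fun J => ⟨fun hJ => Marchenko.exists_isMarchenko hJ hr0 hr1 hrR, ?_⟩, fun J hJ => ?_,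
    fun σ hσ => ?_⟩
  -- Membership of J is not checked directly: the matrix constructed from σ lies in the class and
  -- has the same F, so it is J.
  · rintro ⟨σ, hσ, hJ⟩
    obtain ⟨J', hJ', hrep⟩ := hσ.exists_mem_MClass hr0 hr1 hrR
    rwa [huniq σ J J' hJ hrep]
  · obtain ⟨σ, hσ, hrep⟩ := Marchenko.exists_isMarchenko hJ hr0 hr1 hrR
    refine ⟨σ, ⟨hσ, hrep⟩, fun τ hτ => ?_⟩
    exact hτ.1.eq_of_marchenkoF_eq hσ hr0 fun l hl => (hτ.2 l hl).symm.trans (hrep l hl)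
  · obtain ⟨J, hJ, hrep⟩ := hσ.exists_mem_MClass hr0 hr1 hrR
    exact ⟨J, ⟨hJ, hrep⟩, fun J' hJ' => huniq σ J' J hJ'.2 hrep⟩
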